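/- Let $n\ge 1$ and $1<p\le q<\infty$, and let $p'=\frac{p}{p-1}$, $q'=\frac{q}{q-1}$. There is a constant $C=C(n,p,q)<\infty$ such that the following holds for every $0\le\alpha<n$ and every pair of weights $(u,\sigma)$ on $\mathbb R^n$, where a weight is a measurable function $w:\mathbb R^n\to[0,\infty)$ that is positive on a set of positive Lebesgue measure, and $w(E)=\int_E w\,dx$. Let $I_\alpha g(x)=\int_{\mathbb R^n}\frac{g(y)}{|x-y|^{n-\alpha}}\,dy$, and let $$\mathcal I_\alpha=\sup_Q \sigma(Q)^{-1/p}\Big(\int_Q I_\alpha(\chi_Q\sigma)(x)^q\,u(x)\,dx\Big)^{1/q},\qquad \mathcal I_\alpha^*=\sup_Q u(Q)^{-1/q'}\Big(\int_Q I_\alpha(\chi_Q u)(x)^{p'}\,\sigma(x)\,dx\Big)^{1/p'},$$ where the suprema are over all cubes $Q$ with sides parallel to the coordinate axes; a term with $\sigma(Q)=0$ (respectively $u(Q)=0$) is $0$, and a term whose integral is infinite is $\infty$. For $A\in[0,\infty)$, say that the strong type inequality holds with constant $A$ if for every real-valued $f\in L^p(\sigma)$ the integral $I_\alpha(f\sigma)(x)$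 converges absolutely for $u\,dx$-almost every $x$ and $$\Big(\int_{\mathbb R^n}|I_\alpha(f\sigma)(x)|^q\,u(x)\,dx\Big)^{1/q}\le A\Big(\int_{\mathbb R^n}|f(x)|^p\,\sigma(x)\,dx\Big)^{1/p},$$ and that the weak type inequality holds with constant $A$ if for every such $f$ the same convergence holds and $$\sup_{t>0}\,t\,u(\{x\in\mathbb R^n:|I_\alpha(f\sigma)(x)|>t\})^{1/q}\le A\Big(\int_{\mathbb R^n}|f(x)|^p\,\sigma(x)\,dx\Big)^{1/p}.$$ 1. Both testing conditions $\mathcal I_\alpha<\infty$ and $\mathcal I_\alpha^*<\infty$ hold if and only if the strong type inequality holds with some finite constant; in that case it holds with constant $C\,(\mathcal I_\alpha+\mathcal I_\alpha^*)$. 2. The dual testing condition $\mathcal I_\alpha^*<\infty$ holds if and only if the weak type inequality holds with some finite constant; in that case it holds with constant $C\,\mathcal I_\alpha^*$. -/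

import Mathlib

open MeasureTheory
open scoped ENNReal NNReal

namespace FracTesting

/-- A weight on `ℝⁿ`: a non-negative (finite-valued, Lebesgue) measurable function that is positive
on a set of positive Lebesgue measure. No local integrability is assumed. -/
structure IsWeight {n : ℕ} (w : EuclideanSpace ℝ (Fin n) → ℝ) : Prop where
  aemeasurable : AEMeasurable w volume
  nonneg : ∀ x, 0 ≤ w x
  pos : 0 < volume {x | 0 < w x}

/-- The measure `w dx`. -/
noncomputable def wMeasure {n : ℕ} (w : EuclideanSpace ℝ (Fin n) → ℝ) :
    Measure (EuclideanSpace ℝ (Fin n)) :=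
  volume.withDensity (fun x => ENNReal.ofReal (w x))

/-- The (half-open) cube with sides parallel to the coordinate axes, lower corner `a` and
side-length `l`. -/
def cube {n : ℕ} (a : EuclideanSpace ℝ (Fin n)) (l : ℝ) : Set (EuclideanSpace ℝ (Fin n)) :=
  {x | ∀ i, a i ≤ x i ∧ x i < a i + l}

/-- The integrand `g(y) / |x - y|^(n - α)` of the fractional integral (Euclidean norm). -/
noncomputable def fracIntegrand {n : ℕ} (α : ℝ) (g : EuclideanSpace ℝ (Fin n) → ℝ)
    (x y : EuclideanSpace ℝ (Fin n)) : ℝ :=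
  g y / ‖x - y‖ ^ ((n : ℝ) - α)

/-- The fractional integral `I_α g (x) = ∫ g(y) / |x - y|^(n - α) dy` of a real function; it is
meaningful at those `x` where the integral converges absolutely. -/
noncomputable def fracInt {n : ℕ} (α : ℝ) (g : EuclideanSpace ℝ (Fin n) → ℝ)
    (x : EuclideanSpace ℝ (Fin n)) : ℝ :=
  ∫ y, fracIntegrand α g x y

/-- The fractional integral of a non-negative function, with values in `[0, ∞]`. -/
noncomputable def fracIntPos {n : ℕ} (α : ℝ) (g : EuclideanSpace ℝ (Fin n) → ℝ)
    (x : EuclideanSpace ℝ (Fin n)) : ℝ≥0∞ :=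
  ∫⁻ y, ENNReal.ofReal (fracIntegrand α g x y)

/-- `(∫_Q I_α(χ_Q σ)^q u dx)^(1/q)`. -/
noncomputable def testingNorm {n : ℕ} (α q : ℝ) (u σ : EuclideanSpace ℝ (Fin n) → ℝ)
    (Q : Set (EuclideanSpace ℝ (Fin n))) : ℝ≥0∞ :=
  (∫⁻ x in Q, fracIntPos α (Q.indicator σ) x ^ q ∂(wMeasure u)) ^ (1 / q)

open scoped Classical in
/-- The testing constant `sup_Q σ(Q)^(-1/p) (∫_Q I_α(χ_Q σ)^q u dx)^(1/q)` over all cubes.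
If `σ(Q) = 0` then the integral vanishes and so does the term (`0 / 0 = 0` in `ℝ≥0∞`). A term whose
integral is infinite is infinite, also when `σ(Q) = ∞` (where `∞ / ∞` would be `0` in `ℝ≥0∞`). -/
noncomputable def testingConst {n : ℕ} (α p q : ℝ) (u σ : EuclideanSpace ℝ (Fin n) → ℝ) : ℝ≥0∞ :=
  ⨆ (a : EuclideanSpace ℝ (Fin n)) (l : ℝ) (_ : 0 < l),
    if testingNorm α q u σ (cube a l) = ∞ then ∞
    else testingNorm α q u σ (cube a l) / wMeasure σ (cube a l) ^ (1 / p)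

/-- The dual testing constant `sup_Q u(Q)^(-1/q') (∫_Q I_α(χ_Q u)^p' σ dx)^(1/p')`, that is, the
testing constant of the dual inequality `I_α(· u) : L^q'(u) → L^p'(σ)`. -/
noncomputable def dualTestingConst {n : ℕ} (α p q : ℝ) (u σ : EuclideanSpace ℝ (Fin n) → ℝ) :
    ℝ≥0∞ :=
  testingConst α q.conjExponent p.conjExponent σ u

/-- The strong type inequality with constant `A`: for all `f ∈ L^p(σ)`, the integral defining
`I_α(f σ)` converges absolutely `u`-almost everywhere, and
`‖I_α(f σ)‖_{L^q(u)} ≤ A ‖f‖_{L^p(σ)}`. -/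
def StrongType {n : ℕ} (α p q : ℝ) (u σ : EuclideanSpace ℝ (Fin n) → ℝ) (A : ℝ≥0∞) : Prop :=
  ∀ f : EuclideanSpace ℝ (Fin n) → ℝ, MemLp f (ENNReal.ofReal p) (wMeasure σ) →
    (∀ᵐ x ∂(wMeasure u), Integrable (fracIntegrand α (fun y => f y * σ y) x) volume) ∧
    eLpNorm (fracInt α (fun y => f y * σ y)) (ENNReal.ofReal q) (wMeasure u) ≤
      A * eLpNorm f (ENNReal.ofReal p) (wMeasure σ)

/-- The weak type inequality with constant `A`: for all `f ∈ L^p(σ)`, the integral defining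
`I_α(f σ)` converges absolutely `u`-almost everywhere, and
`t u({|I_α(f σ)| > t})^(1/q) ≤ A ‖f‖_{L^p(σ)}` for all `t > 0`. -/
def WeakType {n : ℕ} (α p q : ℝ) (u σ : EuclideanSpace ℝ (Fin n) → ℝ) (A : ℝ≥0∞) : Prop :=
  ∀ f : EuclideanSpace ℝ (Fin n) → ℝ, MemLp f (ENNReal.ofReal p) (wMeasure σ) →
    (∀ᵐ x ∂(wMeasure u), Integrable (fracIntegrand α (fun y => f y * σ y) x) volume) ∧
    ∀ t : ℝ, 0 < t →
      ENNReal.ofReal t *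
          wMeasure u {x | t < |fracInt α (fun y => f y * σ y) x|} ^ (1 / q) ≤
        A * eLpNorm f (ENNReal.ofReal p) (wMeasure σ)

end FracTesting

/-! Put ε = n - α, so 0 < ε ≤ n, μ = σ dx and ν = u dx. Everything concerns the positive kernel |x -
y|^(-ε) between two measures without atoms.

Discretization. The kernel is comparable with the sum, over 2^n shifted grids, of the dyadic kernels
∑_Q ℓ(Q)^(-ε) χ_Q(x) χ_Q(y) (`exists_kern_le`, `cellKern_le`). With side-lengths 2^k the geometric
series would cost a factor that blows up as ε → 0. To keep the constants independent of α,
consecutive generations differ by a factor 4^m with 1 ≤ mε ≤ n + 1: the coefficients then decay by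
at least 1/4 per generation, while rounding a distance up to a side-length costs at most (3·4^m)^ε ≤
3^n 4^(n+1). Testing on cubes thus gives testing on finite laminar families of cells, and bounds
uniform in the family return to the potential by monotone convergence.

Strong type. By duality it suffices to bound ∑ τ_Q (∫_Q f dμ)(∫_Q g dν). The members Q are split
according to which of ⟨f⟩_Q^p μ(Q) and ⟨g⟩_Q^q' ν(Q) is larger. Where f dominates, the Q are grouped
under principal sets F on which ⟨f⟩ is essentially constant; each group is handled by Hölder and
testing on F, with g replaced by its averages on the principal children of F. The Carleson embedding
sums the averages of f, and by domination also those of g (`bilinear_one_sided`). The other half is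
the dual statement.

Weak type. A good-λ argument uses only dual testing: on a maximal set Q of a level set, the local
part of the operator is integrated against ν and moved to the other side (`dyadic_good_lambda`).

Necessity. The strong inequality implies the weak one. The weak one first forces cubes to have
finite measure (`PotWeak.source_ne_top`, `PotWeak.target_ne_top`), then, by duality and the
embedding of weak L^q into L^1 on sets of finite measure, dual testing (`PotWeak.dualTesting`).
Direct testing is the strong inequality for f = χ_Q. -/

namespace FracTesting

/-! ### Geometric sums -/

theorem sum_int_le_of_ratio {w : ℤ → ℝ≥0∞} {r : ℝ≥0∞} (hw : ∀ j, w (j + 1) ≤ r * w j)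
    {J : Finset ℤ} {j₀ : ℤ} (hJ : ∀ j ∈ J, j₀ ≤ j) : ∑ j ∈ J, w j ≤ (1 - r)⁻¹ * w j₀ := by
  have h1 : ∀ i : ℕ, w (j₀ + i) ≤ r ^ i * w j₀ := by
    intro i
    induction i with
    | zero => simp
    | succ i ih =>
      calc w (j₀ + (i + 1 : ℕ)) = w ((j₀ + i) + 1) := by push_cast; ring_nf
        _ ≤ r * w (j₀ + i) := hw _
        _ ≤ r * (r ^ i * w j₀) := by gcongr
        _ = _ := by ring
  have inj : Set.InjOn (fun j : ℤ => (j - j₀).toNat) J := by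
    intro a ha b hb h
    have := hJ a ha
    have := hJ b hb
    simp only at h
    omega
  calc ∑ j ∈ J, w j ≤ ∑ j ∈ J, r ^ (j - j₀).toNat * w j₀ := Finset.sum_le_sum fun j hj => by
        have := h1 (j - j₀).toNat
        rwa [Int.toNat_of_nonneg (by have := hJ j hj; omega), add_sub_cancel] at this
    _ = ∑ i ∈ J.image (fun j => (j - j₀).toNat), r ^ i * w j₀ :=
      (Finset.sum_image (f := fun i : ℕ => r ^ i * w j₀) inj).symm
    _ ≤ ∑' i : ℕ, r ^ i * w j₀ := ENNReal.sum_le_tsum _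
    _ = _ := by rw [ENNReal.tsum_mul_right, ENNReal.tsum_geometric]

theorem two_zpow_ne_top (k : ℤ) : (2 : ℝ≥0∞) ^ k ≠ ∞ :=
  (ENNReal.zpow_lt_top (by simp) (by simp) k).ne

theorem two_zpow_succ (k : ℤ) : (2 : ℝ≥0∞) ^ (k + 1) = 2 * 2 ^ k := by
  rw [ENNReal.zpow_add (by simp) (by simp), zpow_one, mul_comm]

/-- The top term dominates; the reflection j ↦ -j turns the sum into a series decreasing with ratio
2^(-s). -/
theorem sum_two_zpow_rpow_le {s : ℝ} (hs : 0 ≤ s) {c : ℝ≥0∞} {J : Finset ℤ}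
    (hJ : ∀ j ∈ J, (2 : ℝ≥0∞) ^ j ≤ c) :
    ∑ j ∈ J, ((2 : ℝ≥0∞) ^ j) ^ s ≤ (1 - (2⁻¹ : ℝ≥0∞) ^ s)⁻¹ * c ^ s := by
  rcases J.eq_empty_or_nonempty with rfl | hne
  · simp
  have inj : Set.InjOn (fun j : ℤ => -j) J := fun a _ b _ h => neg_injective h
  have key := sum_int_le_of_ratio (w := fun j => ((2 : ℝ≥0∞) ^ (-j)) ^ s)
    (r := (2⁻¹ : ℝ≥0∞) ^ s) (J := J.image (fun j => -j)) (j₀ := -J.max' hne) ?_ ?_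
  · rw [Finset.sum_image inj] at key
    simp only [neg_neg] at key
    refine key.trans ?_
    gcongr
    exact hJ _ (J.max'_mem hne)
  · intro j
    rw [← ENNReal.mul_rpow_of_nonneg _ _ hs]
    gcongr
    rw [neg_add, ENNReal.zpow_add (by simp) (by simp), mul_comm, zpow_neg_one]
  · intro j hj
    obtain ⟨i, hi, rfl⟩ := Finset.mem_image.1 hj
    exact neg_le_neg (J.le_max' i hi)

theorem one_sub_two_inv_rpow_inv_ne_top {s : ℝ} (hs : 0 < s) :
    (1 - (2⁻¹ : ℝ≥0∞) ^ s)⁻¹ ≠ ∞ := by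
  rw [Ne, ENNReal.inv_eq_top, tsub_eq_zero_iff_le, not_le]
  exact ENNReal.rpow_lt_one (by simp) hs

theorem mul_rpow_sub_one {p : ℝ} (hp : 1 ≤ p) (x : ℝ≥0∞) : x * x ^ (p - 1) = x ^ p := by
  have := ENNReal.rpow_add_of_nonneg (x := x) 1 (p - 1) (by norm_num) (by linarith)
  rw [ENNReal.rpow_one, add_sub_cancel] at this
  exact this.symm

/-! ### Laminar families and principal sets -/

variable {X : Type*}

/-- Any two members of the family are nested or disjoint. -/
def Laminar (𝒬 : Finset (Set X)) : Prop :=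
  ∀ Q ∈ 𝒬, ∀ R ∈ 𝒬, Q ⊆ R ∨ R ⊆ Q ∨ Disjoint Q R

theorem Laminar.mono {𝒬 𝒬' : Finset (Set X)} (h : Laminar 𝒬) (hs : 𝒬' ⊆ 𝒬) : Laminar 𝒬' :=
  fun Q hQ R hR => h Q (hs hQ) R (hs hR)

theorem Laminar.nested {𝒬 : Finset (Set X)} (h : Laminar 𝒬) {Q R : Set X} (hQ : Q ∈ 𝒬)
    (hR : R ∈ 𝒬) {x : X} (hxQ : x ∈ Q) (hxR : x ∈ R) : Q ⊆ R ∨ R ⊆ Q := by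
  rcases h Q hQ R hR with h | h | h
  · exact Or.inl h
  · exact Or.inr h
  · exact absurd hxR (Set.disjoint_left.1 h hxQ)

/-- Principal sets of a finite laminar family for a positive function `a` of its members: `K` is
the running dyadic level of `a`, and `π Q` is the largest member containing `Q` at the same level. -/
theorem Laminar.exists_principal {𝒬 : Finset (Set X)} (hL : Laminar 𝒬)
    (hne : ∀ Q ∈ 𝒬, Q.Nonempty) {a : Set X → ℝ≥0∞} (ha : ∀ Q ∈ 𝒬, a Q ≠ 0 ∧ a Q ≠ ∞) :
    ∃ (π : Set X → Set X) (K : Set X → ℤ), ∀ Q ∈ 𝒬,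
      π Q ∈ 𝒬 ∧ Q ⊆ π Q ∧ K (π Q) = K Q ∧ a Q ≤ 2 ^ (K Q + 1) ∧ 2 ^ K Q ≤ a (π Q) ∧
      (∀ R ∈ 𝒬, Q ⊆ R → R ⊆ π Q → π R = π Q) ∧
      (∀ R ∈ 𝒬, K R = K Q → (Q ∩ R).Nonempty → π R = π Q) := by
  classical
  have hlev : ∀ Q : Set X, ∃ l : ℤ, Q ∈ 𝒬 → (2 : ℝ≥0∞) ^ l ≤ a Q ∧ a Q < 2 ^ (l + 1) := by
    intro Q
    by_cases hQ : Q ∈ 𝒬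
    · obtain ⟨l, hl⟩ := ENNReal.exists_mem_Ico_zpow (ha Q hQ).1 (ha Q hQ).2
        (y := 2) (by norm_num) (by simp)
      exact ⟨l, fun _ => hl⟩
    · exact ⟨0, fun h => absurd h hQ⟩
  choose l hl using hlev
  have hmax : ∀ Q : Set X, ∃ M : Set X, Q ∈ 𝒬 → (M ∈ 𝒬 ∧ Q ⊆ M) ∧
      ∀ R ∈ 𝒬, Q ⊆ R → l R ≤ l M := by
    intro Q
    by_cases hQ : Q ∈ 𝒬
    · obtain ⟨M, hM, hM2⟩ := (𝒬.filter (Q ⊆ ·)).exists_max_image l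
        ⟨Q, by simp [hQ]⟩
      simp only [Finset.mem_filter] at hM hM2
      exact ⟨M, fun _ => ⟨hM, fun R hR hQR => hM2 R ⟨hR, hQR⟩⟩⟩
    · exact ⟨∅, fun h => absurd h hQ⟩
  choose M hM using hmax
  -- `K Q` is the largest level attained on the members containing `Q`. Unlike `l`, it is monotone
  -- under inclusion.
  let K : Set X → ℤ := fun Q => l (M Q)
  have Kanti : ∀ Q ∈ 𝒬, ∀ R ∈ 𝒬, Q ⊆ R → K R ≤ K Q := fun Q hQ R hR h =>
    (hM Q hQ).2 _ (hM R hR).1.1 (h.trans (hM R hR).1.2)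
  have hpi : ∀ Q : Set X, ∃ P : Set X, Q ∈ 𝒬 → P ∈ 𝒬 ∧ Q ⊆ P ∧ K P = K Q ∧
      ∀ R ∈ 𝒬, Q ⊆ R → K R = K Q → R ⊆ P := by
    intro Q
    by_cases hQ : Q ∈ 𝒬
    · obtain ⟨P, hP⟩ := (𝒬.filter (fun R => Q ⊆ R ∧ K R = K Q)).exists_maximal
        ⟨Q, by simp [hQ]⟩
      have hP1 := hP.prop
      simp only [Finset.mem_filter] at hP1
      refine ⟨P, fun _ => ⟨hP1.1, hP1.2.1, hP1.2.2, fun R hR hQR hK => ?_⟩⟩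
      obtain ⟨x, hx⟩ := hne Q hQ
      rcases hL.nested hR hP1.1 (hQR hx) (hP1.2.1 hx) with h | h
      · exact h
      · exact hP.le_of_ge (by simp [hR, hQR, hK]) h
    · exact ⟨∅, fun h => absurd h hQ⟩
  choose π hπ using hpi
  have hsame : ∀ Q ∈ 𝒬, ∀ R ∈ 𝒬, Q ⊆ R → K R = K Q → π R = π Q := by
    intro Q hQ R hR hQR hK
    obtain ⟨h1, h2, h3, h4⟩ := hπ Q hQ
    obtain ⟨g1, g2, g3, g4⟩ := hπ R hR
    exact Set.Subset.antisymm (h4 _ g1 (hQR.trans g2) (g3.trans hK))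
      (g4 _ h1 (h4 R hR hQR hK) (h3.trans hK.symm))
  refine ⟨π, K, fun Q hQ => ?_⟩
  obtain ⟨h1, h2, h3, h4⟩ := hπ Q hQ
  refine ⟨h1, h2, h3, ?_, ?_, ?_, ?_⟩
  · refine (hl Q hQ).2.le.trans (ENNReal.zpow_le_of_le (by norm_num) ?_)
    have := (hM Q hQ).2 Q hQ subset_rfl
    simp only [K]
    omega
  · have hMP := hM (π Q) h1
    have e1 : K (M (π Q)) = K Q := by
      refine le_antisymm (Kanti Q hQ _ hMP.1.1 (h2.trans hMP.1.2)) ?_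
      rw [← h3]
      exact (hM _ hMP.1.1).2 _ hMP.1.1 subset_rfl
    -- The maximizer above `π Q` contains `Q` and has the same `K`, so it cannot be larger than `π
    -- Q`. Hence `π Q` attains the running level itself, which bounds `a (π Q)` from below.
    have e2 : M (π Q) = π Q :=
      Set.Subset.antisymm (h4 _ hMP.1.1 (h2.trans hMP.1.2) e1) hMP.1.2
    have e3 : K Q = l (π Q) := by rw [← h3]; simp only [K]; rw [e2]
    rw [e3]
    exact (hl _ h1).1
  · intro R hR hQR hRP
    refine hsame Q hQ R hR hQR (le_antisymm (Kanti Q hQ R hR hQR) ?_)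
    rw [← h3]
    exact Kanti R hR _ h1 hRP
  · rintro R hR hK ⟨x, hxQ, hxR⟩
    rcases hL.nested hQ hR hxQ hxR with h | h
    · exact hsame Q hQ R hR h hK
    · exact (hsame R hR Q hQ h hK.symm).symm

/-! ### The Carleson embedding for principal sets -/

variable [MeasurableSpace X]

/-- The constant of the Carleson embedding. -/
noncomputable def carlesonConst (p : ℝ) : ℝ≥0∞ :=
  2 ^ p * 2 * ((1 - (2⁻¹ : ℝ≥0∞) ^ (p - 1))⁻¹ * 2 ^ (p - 1))

theorem carlesonConst_ne_top {p : ℝ} (hp : 1 < p) : carlesonConst p ≠ ∞ := by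
  unfold carlesonConst
  refine ENNReal.mul_ne_top (ENNReal.mul_ne_top ?_ (by simp)) (ENNReal.mul_ne_top
    (one_sub_two_inv_rpow_inv_ne_top (by linarith)) ?_)
  · exact ENNReal.rpow_ne_top_of_nonneg (by linarith) (by simp)
  · exact ENNReal.rpow_ne_top_of_nonneg (by linarith) (by simp)

/-- No maximal function is needed. The part of F where f < 2^K / 2 carries at most half of 2^K μ(F),
so 2^K μ(F) is at most twice the integral of f over F ∩ {2 f ≥ 2^K}. After multiplication by
2^(K(p-1)), the sum over F is, at each point, a geometric sum with top term at most (2 f)^(p-1),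
because sets of equal level are disjoint. -/
theorem carleson_embedding {μ : Measure X} {p : ℝ} (hp : 1 < p) {f : X → ℝ≥0∞}
    (hf : Measurable f) {𝓕 : Finset (Set X)} (hm : ∀ F ∈ 𝓕, MeasurableSet F)
    (hμ : ∀ F ∈ 𝓕, μ F ≠ ∞) {a : Set X → ℝ≥0∞}
    (ha : ∀ F ∈ 𝓕, a F * μ F ≤ ∫⁻ x in F, f x ∂μ) {K : Set X → ℤ}
    (hK : ∀ F ∈ 𝓕, 2 ^ K F ≤ a F ∧ a F ≤ 2 ^ (K F + 1))
    (hdisj : ∀ F ∈ 𝓕, ∀ F' ∈ 𝓕, K F = K F' → (F ∩ F').Nonempty → F = F') :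
    ∑ F ∈ 𝓕, a F ^ p * μ F ≤ carlesonConst p * ∫⁻ x, f x ^ p ∂μ := by
  classical
  let S : ℤ → Set X := fun k => {x | (2 : ℝ≥0∞) ^ k ≤ 2 * f x}
  have hS : ∀ k, MeasurableSet (S k) := fun k =>
    measurableSet_le measurable_const (hf.const_mul 2)
  have h1 : ∀ F ∈ 𝓕, 2 ^ K F * μ F ≤ 2 * ∫⁻ x in F, (S (K F)).indicator f x ∂μ := by
    intro F hF
    set c : ℝ≥0∞ := 2 ^ K F with hc
    have e1 : c * μ F ≤ (∫⁻ x in F, (S (K F)).indicator f x ∂μ) + c / 2 * μ F := by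
      calc c * μ F ≤ a F * μ F := by gcongr; exact (hK F hF).1
        _ ≤ ∫⁻ x in F, f x ∂μ := ha F hF
        _ ≤ ∫⁻ x in F, ((S (K F)).indicator f x + c / 2) ∂μ := by
            refine lintegral_mono fun x => ?_
            by_cases hx : x ∈ S (K F)
            · simp [hx]
            · simp only [Set.indicator_of_notMem hx, zero_add]
              have hx' : 2 * f x < c := by simpa [S] using hx
              rw [ENNReal.le_div_iff_mul_le (by simp) (by simp), mul_comm]
              exact hx'.le
        _ = _ := by
            rw [lintegral_add_right _ measurable_const]; simp
    have hfin : c / 2 * μ F ≠ ∞ :=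
      ENNReal.mul_ne_top (ENNReal.div_ne_top (two_zpow_ne_top _) (by simp)) (hμ F hF)
    have e2 : c * μ F = c / 2 * μ F + c / 2 * μ F := by
      rw [← add_mul, ENNReal.add_halves]
    rw [e2] at e1 ⊢
    have e3 := (ENNReal.add_le_add_iff_right hfin).1 e1
    rw [two_mul]
    exact add_le_add e3 e3
  have h2 : ∀ F ∈ 𝓕, a F ^ p * μ F ≤ 2 ^ p * 2 * ∫⁻ x,
      F.indicator (fun x => (S (K F)).indicator (fun x => f x * (2 ^ K F) ^ (p - 1)) x) x ∂μ := by
    intro F hF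
    set c : ℝ≥0∞ := 2 ^ K F with hc
    have e0 : ∀ x, F.indicator (fun x => (S (K F)).indicator (fun x => f x * c ^ (p - 1)) x) x
        = F.indicator (fun x => c ^ (p - 1) * (S (K F)).indicator f x) x := by
      intro x
      congr 1; ext y
      by_cases hy : y ∈ S (K F) <;> simp [hy, mul_comm]
    calc a F ^ p * μ F ≤ (2 * c) ^ p * μ F := by
          gcongr
          rw [hc, ← two_zpow_succ]
          exact (hK F hF).2
      _ = 2 ^ p * c ^ (p - 1) * (c * μ F) := by
          rw [ENNReal.mul_rpow_of_nonneg _ _ (by linarith), ← mul_rpow_sub_one hp.le c]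
          ring
      _ ≤ 2 ^ p * c ^ (p - 1) * (2 * ∫⁻ x in F, (S (K F)).indicator f x ∂μ) := by
          exact mul_le_mul_right (h1 F hF) _
      _ = _ := by
          simp_rw [e0]
          rw [lintegral_indicator (hm F hF), lintegral_const_mul _ (hf.indicator (hS _))]
          ring
  have h3 : ∀ x, ∑ F ∈ 𝓕, F.indicator (fun x => (S (K F)).indicator
      (fun x => f x * (2 ^ K F) ^ (p - 1)) x) x ≤
      ((1 - (2⁻¹ : ℝ≥0∞) ^ (p - 1))⁻¹ * 2 ^ (p - 1)) * f x ^ p := by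
    intro x
    set 𝓖 := 𝓕.filter (fun F => x ∈ F ∧ x ∈ S (K F)) with h𝓖
    have e1 : ∑ F ∈ 𝓕, F.indicator (fun x => (S (K F)).indicator
        (fun x => f x * (2 ^ K F) ^ (p - 1)) x) x = ∑ F ∈ 𝓖, f x * (2 ^ K F) ^ (p - 1) := by
      rw [h𝓖, Finset.sum_filter]
      refine Finset.sum_congr rfl fun F _ => ?_
      by_cases hx : x ∈ F <;> by_cases hx' : x ∈ S (K F) <;> simp [hx, hx']
    -- Members through `x` of the same level coincide, so each power of 2 occurs at most once.
    have inj : Set.InjOn K 𝓖 := by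
      intro F hF F' hF' h
      simp only [h𝓖, Finset.coe_filter, Set.mem_ofPred_eq] at hF hF'
      exact hdisj F hF.1 F' hF'.1 h ⟨x, hF.2.1, hF'.2.1⟩
    rw [e1, ← Finset.mul_sum, ← Finset.sum_image (f := fun j => ((2 : ℝ≥0∞) ^ j) ^ (p - 1)) inj]
    calc f x * ∑ j ∈ 𝓖.image K, ((2 : ℝ≥0∞) ^ j) ^ (p - 1)
        ≤ f x * ((1 - (2⁻¹ : ℝ≥0∞) ^ (p - 1))⁻¹ * (2 * f x) ^ (p - 1)) := by
          gcongr
          refine sum_two_zpow_rpow_le (by linarith) fun j hj => ?_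
          obtain ⟨F, hF, rfl⟩ := Finset.mem_image.1 hj
          exact (Finset.mem_filter.1 hF).2.2
      _ = ((1 - (2⁻¹ : ℝ≥0∞) ^ (p - 1))⁻¹ * 2 ^ (p - 1)) * (f x * f x ^ (p - 1)) := by
          rw [ENNReal.mul_rpow_of_nonneg _ _ (by linarith)]; ring
      _ = _ := by
          rw [mul_rpow_sub_one hp.le]
  calc ∑ F ∈ 𝓕, a F ^ p * μ F ≤ ∑ F ∈ 𝓕, 2 ^ p * 2 * ∫⁻ x,
      F.indicator (fun x => (S (K F)).indicator (fun x => f x * (2 ^ K F) ^ (p - 1)) x) x ∂μ :=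
        Finset.sum_le_sum h2
    _ = 2 ^ p * 2 * ∫⁻ x, ∑ F ∈ 𝓕, F.indicator (fun x => (S (K F)).indicator
          (fun x => f x * (2 ^ K F) ^ (p - 1)) x) x ∂μ := by
        rw [← Finset.mul_sum, lintegral_finsetSum]
        exact fun F hF => (((hf.mul_const _).indicator (hS _)).indicator (hm F hF))
    _ ≤ 2 ^ p * 2 * ∫⁻ x, ((1 - (2⁻¹ : ℝ≥0∞) ^ (p - 1))⁻¹ * 2 ^ (p - 1)) * f x ^ p ∂μ := by
        gcongr with x; exact h3 x
    _ = _ := by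
        rw [lintegral_const_mul _ (hf.pow_const p), carlesonConst]; ring

end FracTesting

namespace FracTesting

variable {X : Type*}

/-! ### Children in a laminar family -/

open scoped Classical in
/-- The maximal proper subsets of `F` in the family `𝓕`. -/
noncomputable def children (𝓕 : Finset (Set X)) (F : Set X) : Finset (Set X) :=
  𝓕.filter fun G => G ⊂ F ∧ ∀ H ∈ 𝓕, G ⊂ H → ¬ H ⊂ F

theorem mem_children {𝓕 : Finset (Set X)} {F G : Set X} :
    G ∈ children 𝓕 F ↔ G ∈ 𝓕 ∧ G ⊂ F ∧ ∀ H ∈ 𝓕, G ⊂ H → ¬ H ⊂ F := by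
  simp [children]

theorem exists_children_of_ssubset {𝓕 : Finset (Set X)} {F G : Set X} (hG : G ∈ 𝓕)
    (h : G ⊂ F) : ∃ H ∈ children 𝓕 F, G ⊆ H := by
  classical
  obtain ⟨H, hGH, hH⟩ := (𝓕.filter (· ⊂ F)).exists_le_maximal (Finset.mem_filter.2 ⟨hG, h⟩)
  have hH1 := Finset.mem_filter.1 hH.prop
  refine ⟨H, mem_children.2 ⟨hH1.1, hH1.2, fun H' hH' hlt hlt' => ?_⟩, hGH⟩
  exact hlt.not_subset (hH.le_of_ge (Finset.mem_filter.2 ⟨hH', hlt'⟩) hlt.subset)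

/-- The part of `F` that is not covered by its children. -/
def core (𝓕 : Finset (Set X)) (F : Set X) : Set X := F \ ⋃ G ∈ children 𝓕 F, G

theorem Laminar.children_disjoint {𝓕 : Finset (Set X)} (hL : Laminar 𝓕) {F G G' : Set X}
    (hG : G ∈ children 𝓕 F) (hG' : G' ∈ children 𝓕 F) {x : X} (hx : x ∈ G) (hx' : x ∈ G') :
    G = G' := by
  rw [mem_children] at hG hG'
  by_contra hne
  rcases hL.nested hG.1 hG'.1 hx hx' with h | h
  · exact hG.2.2 _ hG'.1 (h.ssubset_of_ne hne) hG'.2.1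
  · exact hG'.2.2 _ hG.1 (h.ssubset_of_ne (Ne.symm hne)) hG.2.1

theorem Laminar.core_disjoint {𝓕 : Finset (Set X)} (hL : Laminar 𝓕) {F F' : Set X}
    (hF : F ∈ 𝓕) (hF' : F' ∈ 𝓕) {x : X} (hx : x ∈ core 𝓕 F) (hx' : x ∈ core 𝓕 F') : F = F' := by
  by_contra hne
  have key : ∀ A B : Set X, A ∈ 𝓕 → B ∈ 𝓕 → x ∈ A → x ∈ core 𝓕 B → A ≠ B → ¬ A ⊆ B := by
    intro A B hA hB hxA hxB hne hAB
    obtain ⟨H, hH, hAH⟩ := exists_children_of_ssubset hA (hAB.ssubset_of_ne hne)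
    exact hxB.2 (Set.mem_biUnion hH (hAH hxA))
  rcases hL.nested hF hF' hx.1 hx'.1 with h | h
  · exact key F F' hF hF' hx.1 hx' hne h
  · exact key F' F hF' hF hx'.1 hx (Ne.symm hne) h

theorem Laminar.parent_unique {𝓕 : Finset (Set X)} (hL : Laminar 𝓕) (hne : ∀ F ∈ 𝓕, F.Nonempty)
    {F F' G : Set X} (hF : F ∈ 𝓕) (hF' : F' ∈ 𝓕) (hG : G ∈ children 𝓕 F)
    (hG' : G ∈ children 𝓕 F') : F = F' := by
  rw [mem_children] at hG hG'
  obtain ⟨x, hx⟩ := hne G hG.1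
  by_contra hFF
  rcases hL.nested hF hF' (hG.2.1.subset hx) (hG'.2.1.subset hx) with h | h
  · exact hG'.2.2 F hF hG.2.1 (h.ssubset_of_ne hFF)
  · exact hG.2.2 F' hF' hG'.2.1 (h.ssubset_of_ne (Ne.symm hFF))

/-- Each member is a child of at most one other, so nothing is counted twice. -/
theorem Laminar.sum_children_le {𝓕 : Finset (Set X)} (hL : Laminar 𝓕)
    (hne : ∀ F ∈ 𝓕, F.Nonempty) (w : Set X → ℝ≥0∞) :
    ∑ F ∈ 𝓕, ∑ G ∈ children 𝓕 F, w G ≤ ∑ G ∈ 𝓕, w G := by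
  classical
  rw [← Finset.sum_biUnion]
  · refine Finset.sum_le_sum_of_subset fun G hG => ?_
    obtain ⟨F, _, hF⟩ := Finset.mem_biUnion.1 hG
    exact (mem_children.1 hF).1
  · intro F hF F' hF' hFF
    rw [Function.onFun, Finset.disjoint_left]
    exact fun G hG hG' => hFF (hL.parent_unique hne hF hF' hG hG')

/-- The step function `∑_{Q ∈ 𝒬} c_Q χ_Q`. -/
noncomputable def stepSum (𝒬 : Finset (Set X)) (c : Set X → ℝ≥0∞) (x : X) : ℝ≥0∞ :=
  ∑ Q ∈ 𝒬, Q.indicator (fun _ => c Q) x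

theorem stepSum_mono {𝒬 𝒬' : Finset (Set X)} (h : 𝒬 ⊆ 𝒬') (c : Set X → ℝ≥0∞) (x : X) :
    stepSum 𝒬 c x ≤ stepSum 𝒬' c x :=
  Finset.sum_le_sum_of_subset h

variable [MeasurableSpace X]

theorem measurableSet_core {𝓕 : Finset (Set X)} (hm : ∀ F ∈ 𝓕, MeasurableSet F) {F : Set X}
    (hF : F ∈ 𝓕) : MeasurableSet (core 𝓕 F) :=
  (hm F hF).diff (Finset.measurableSet_biUnion _ fun G hG => hm G (mem_children.1 hG).1)

theorem Laminar.sum_lintegral_core_le {𝓕 : Finset (Set X)} (hL : Laminar 𝓕)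
    (hm : ∀ F ∈ 𝓕, MeasurableSet F) (ν : Measure X) (h : X → ℝ≥0∞) :
    ∑ F ∈ 𝓕, ∫⁻ x in core 𝓕 F, h x ∂ν ≤ ∫⁻ x, h x ∂ν := by
  rw [← lintegral_biUnion_finset]
  · exact setLIntegral_le_lintegral _ _
  · intro F hF F' hF' hFF
    rw [Function.onFun, Set.disjoint_left]
    exact fun x hx hx' => hFF (hL.core_disjoint hF hF' hx hx')
  · exact fun F hF => measurableSet_core hm hF

/-- The average of `g` over `G`. -/
noncomputable def avg (ν : Measure X) (g : X → ℝ≥0∞) (G : Set X) : ℝ≥0∞ :=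
  (∫⁻ y in G, g y ∂ν) / ν G

theorem avg_mul {ν : Measure X} {g : X → ℝ≥0∞} {G : Set X} (h0 : ν G ≠ 0) (h1 : ν G ≠ ∞) :
    avg ν g G * ν G = ∫⁻ y in G, g y ∂ν :=
  ENNReal.div_mul_cancel h0 h1

/-- The function `g` on `F`, averaged over the children of `F`. -/
noncomputable def condAvg (𝓕 : Finset (Set X)) (ν : Measure X) (g : X → ℝ≥0∞) (F : Set X)
    (x : X) : ℝ≥0∞ :=
  (core 𝓕 F).indicator g x + ∑ G ∈ children 𝓕 F, G.indicator (fun _ => avg ν g G) x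

theorem measurable_condAvg {𝓕 : Finset (Set X)} (hm : ∀ F ∈ 𝓕, MeasurableSet F) {F : Set X}
    (hF : F ∈ 𝓕) {ν : Measure X} {g : X → ℝ≥0∞} (hg : Measurable g) :
    Measurable (condAvg 𝓕 ν g F) :=
  (hg.indicator (measurableSet_core hm hF)).add <| Finset.measurable_sum _ fun G hG =>
    measurable_const.indicator (hm G (mem_children.1 hG).1)

/-- The core and the children are pairwise disjoint, so at each point at most one summand is nonzero
and the power can be taken termwise. -/
theorem Laminar.lintegral_condAvg_rpow {𝓕 : Finset (Set X)} (hL : Laminar 𝓕)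
    (hm : ∀ F ∈ 𝓕, MeasurableSet F) {F : Set X} (hF : F ∈ 𝓕) {ν : Measure X} {g : X → ℝ≥0∞}
    {s : ℝ} (hs : 0 < s) :
    ∫⁻ x, condAvg 𝓕 ν g F x ^ s ∂ν = ∫⁻ x in core 𝓕 F, g x ^ s ∂ν +
      ∑ G ∈ children 𝓕 F, avg ν g G ^ s * ν G := by
  have hmG : ∀ G ∈ children 𝓕 F, MeasurableSet G := fun G hG => hm G (mem_children.1 hG).1
  have h1 : ∀ x, condAvg 𝓕 ν g F x ^ s = (core 𝓕 F).indicator (fun x => g x ^ s) x +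
      ∑ G ∈ children 𝓕 F, G.indicator (fun _ => avg ν g G ^ s) x := by
    intro x
    unfold condAvg
    by_cases hx : ∃ G ∈ children 𝓕 F, x ∈ G
    · obtain ⟨G, hG, hxG⟩ := hx
      have hc : x ∉ core 𝓕 F := fun h => h.2 (Set.mem_biUnion hG hxG)
      have hne : ∀ G' ∈ children 𝓕 F, G' ≠ G → x ∉ G' := fun G' hG' hne hx' =>
        hne (hL.children_disjoint hG' hG hx' hxG)
      rw [Set.indicator_of_notMem hc, Set.indicator_of_notMem hc, zero_add, zero_add,
        Finset.sum_eq_single_of_mem G hG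
          fun G' hG' hn => Set.indicator_of_notMem (hne G' hG' hn) _,
        Finset.sum_eq_single_of_mem G hG
          fun G' hG' hn => Set.indicator_of_notMem (hne G' hG' hn) _,
        Set.indicator_of_mem hxG, Set.indicator_of_mem hxG]
    · push Not at hx
      rw [Finset.sum_eq_zero fun G hG => Set.indicator_of_notMem (hx G hG) _,
        Finset.sum_eq_zero fun G hG => Set.indicator_of_notMem (hx G hG) _, add_zero, add_zero]
      by_cases hc : x ∈ core 𝓕 F <;> simp [hc, hs]
  simp_rw [h1]
  rw [lintegral_add_right _ (Finset.measurable_sum _ fun G hG =>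
      measurable_const.indicator (hmG G hG)),
    lintegral_indicator (measurableSet_core hm hF),
    lintegral_finsetSum _ fun G hG => measurable_const.indicator (hmG G hG)]
  congr 1
  exact Finset.sum_congr rfl fun G hG => lintegral_indicator_const (hmG G hG) _

/-- Averaging over a child preserves its integral, and Q contains each child or misses it. Inside a
block, g may therefore be replaced by a function whose norms sum over the blocks. -/
theorem setLIntegral_le_condAvg {𝓕 : Finset (Set X)}
    (hm : ∀ F ∈ 𝓕, MeasurableSet F) {F : Set X} (hF : F ∈ 𝓕) {ν : Measure X}
    (h0 : ∀ G ∈ 𝓕, ν G ≠ 0) (h1 : ∀ G ∈ 𝓕, ν G ≠ ∞) {g : X → ℝ≥0∞} (hg : Measurable g)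
    {Q : Set X} (hQm : MeasurableSet Q) (hQF : Q ⊆ F)
    (hQ : ∀ G ∈ children 𝓕 F, G ⊆ Q ∨ Disjoint G Q) :
    ∫⁻ x in Q, g x ∂ν ≤ ∫⁻ x in Q, condAvg 𝓕 ν g F x ∂ν := by
  have hmG : ∀ G ∈ children 𝓕 F, MeasurableSet G := fun G hG => hm G (mem_children.1 hG).1
  calc ∫⁻ x in Q, g x ∂ν
      ≤ ∫⁻ x in Q, ((core 𝓕 F).indicator g x + ∑ G ∈ children 𝓕 F, G.indicator g x) ∂ν := by
        refine setLIntegral_mono' hQm fun x hx => ?_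
        by_cases hc : x ∈ core 𝓕 F
        · simp [hc]
        · have : x ∈ ⋃ G ∈ children 𝓕 F, G := by
            by_contra h
            exact hc ⟨hQF hx, h⟩
          obtain ⟨G, hG, hxG⟩ := Set.mem_iUnion₂.1 this
          calc g x = G.indicator g x := (Set.indicator_of_mem hxG _).symm
            _ ≤ ∑ G ∈ children 𝓕 F, G.indicator g x :=
              Finset.single_le_sum_of_canonicallyOrdered
                (f := fun G : Set X => G.indicator g x) hG
            _ ≤ (core 𝓕 F).indicator g x + ∑ G ∈ children 𝓕 F, G.indicator g x := le_add_self
    _ = (∫⁻ x in Q, (core 𝓕 F).indicator g x ∂ν) +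
        ∑ G ∈ children 𝓕 F, ∫⁻ x in Q, G.indicator g x ∂ν := by
        rw [lintegral_add_left (hg.indicator (measurableSet_core hm hF)),
          lintegral_finsetSum _ fun G hG => hg.indicator (hmG G hG)]
    _ ≤ (∫⁻ x in Q, (core 𝓕 F).indicator g x ∂ν) +
        ∑ G ∈ children 𝓕 F, ∫⁻ x in Q, G.indicator (fun _ => avg ν g G) x ∂ν := by
        refine add_le_add le_rfl (Finset.sum_le_sum fun G hG => ?_)
        rw [lintegral_indicator (hmG G hG), lintegral_indicator (hmG G hG),
          Measure.restrict_restrict (hmG G hG)]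
        rcases hQ G hG with h | h
        · rw [Set.inter_eq_left.2 h, setLIntegral_const,
            avg_mul (h0 G (mem_children.1 hG).1) (h1 G (mem_children.1 hG).1)]
        · simp [h.inter_eq]
    _ = _ := by
        unfold condAvg
        rw [lintegral_add_left (hg.indicator (measurableSet_core hm hF)),
          lintegral_finsetSum _ fun G hG => measurable_const.indicator (hmG G hG)]

/-! ### Positive dyadic operators -/

theorem measurable_stepSum {𝒬 : Finset (Set X)} (hm : ∀ Q ∈ 𝒬, MeasurableSet Q)
    (c : Set X → ℝ≥0∞) : Measurable (stepSum 𝒬 c) :=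
  Finset.measurable_sum _ fun Q hQ => measurable_const.indicator (hm Q hQ)

theorem lintegral_stepSum_mul {𝒬 : Finset (Set X)} (hm : ∀ Q ∈ 𝒬, MeasurableSet Q)
    (c : Set X → ℝ≥0∞) (ν : Measure X) {g : X → ℝ≥0∞} (hg : Measurable g) :
    ∫⁻ x, stepSum 𝒬 c x * g x ∂ν = ∑ Q ∈ 𝒬, c Q * ∫⁻ x in Q, g x ∂ν := by
  unfold stepSum
  simp_rw [Finset.sum_mul]
  rw [lintegral_finsetSum (f := fun (Q : Set X) x => Q.indicator (fun _ => c Q) x * g x) _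
    fun Q hQ => (measurable_const.indicator (hm Q hQ)).mul hg]
  refine Finset.sum_congr rfl fun Q hQ => ?_
  rw [← lintegral_const_mul _ hg, ← lintegral_indicator (hm Q hQ)]
  congr 1
  ext x
  by_cases hx : x ∈ Q <;> simp [hx]

theorem setLIntegral_stepSum_mul {𝒬 : Finset (Set X)} (hm : ∀ Q ∈ 𝒬, MeasurableSet Q)
    (c : Set X → ℝ≥0∞) (ν : Measure X) {g : X → ℝ≥0∞} (hg : Measurable g) {F : Set X}
    (hF : ∀ Q ∈ 𝒬, Q ⊆ F) :
    ∫⁻ x in F, stepSum 𝒬 c x * g x ∂ν = ∑ Q ∈ 𝒬, c Q * ∫⁻ x in Q, g x ∂ν := by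
  rw [lintegral_stepSum_mul hm c _ hg]
  refine Finset.sum_congr rfl fun Q hQ => ?_
  rw [Measure.restrict_restrict_of_subset (hF Q hQ)]

theorem sum_rpow_le_rpow_sum {ι : Type*} (s : Finset ι) (b : ι → ℝ≥0∞) {r : ℝ} (hr : 1 ≤ r) :
    ∑ i ∈ s, b i ^ r ≤ (∑ i ∈ s, b i) ^ r := by
  classical
  induction s using Finset.induction_on with
  | empty => simp
  | insert i s hi ih =>
    rw [Finset.sum_insert hi, Finset.sum_insert hi]
    exact (add_le_add_right ih _).trans (ENNReal.add_rpow_le_rpow_add _ _ hr)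

theorem setLIntegral_ne_top_of_rpow {p : ℝ} (hp : 1 < p) {μ : Measure X} {f : X → ℝ≥0∞}
    (hf : Measurable f) (hf1 : ∫⁻ x, f x ^ p ∂μ ≠ ∞) {Q : Set X} (hQ : μ Q ≠ ∞) :
    ∫⁻ x in Q, f x ∂μ ≠ ∞ := by
  have hpp := Real.HolderConjugate.conjExponent hp
  have h := ENNReal.lintegral_mul_le_Lp_mul_Lq (μ.restrict Q) hpp hf.aemeasurable
    (aemeasurable_const (b := (1 : ℝ≥0∞)))
  simp only [Pi.mul_apply, mul_one, ENNReal.one_rpow, lintegral_const,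
    Measure.restrict_apply MeasurableSet.univ, Set.univ_inter, one_mul] at h
  refine ne_top_of_le_ne_top (ENNReal.mul_ne_top ?_ ?_) h
  · exact ENNReal.rpow_ne_top_of_nonneg (one_div_nonneg.2 hpp.nonneg)
      (ne_top_of_le_ne_top hf1 (setLIntegral_le_lintegral _ _))
  · exact ENNReal.rpow_ne_top_of_nonneg (one_div_nonneg.2 hpp.symm.nonneg) hQ

open scoped Classical in
/-- Testing condition with constant `T` for the positive dyadic operator with coefficients `τ`. -/
def DyadicTesting (p q : ℝ) (μ ν : Measure X) (τ : Set X → ℝ≥0∞) (𝒬 : Finset (Set X))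
    (T : ℝ≥0∞) : Prop :=
  ∀ Q ∈ 𝒬, (∫⁻ x in Q, stepSum (𝒬.filter (· ⊆ Q)) (fun R => τ R * μ R) x ^ q ∂ν) ^ (1 / q) ≤
    T * μ Q ^ (1 / p)

theorem DyadicTesting.mono {p q : ℝ} (hq : 0 < q) {μ ν : Measure X} {τ : Set X → ℝ≥0∞}
    {𝒬 𝒬' : Finset (Set X)} {T : ℝ≥0∞} (h : DyadicTesting p q μ ν τ 𝒬 T) (hs : 𝒬' ⊆ 𝒬) :
    DyadicTesting p q μ ν τ 𝒬' T := by
  classical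
  intro Q hQ
  refine le_trans ?_ (h Q (hs hQ))
  gcongr with x
  exact stepSum_mono (Finset.filter_subset_filter _ hs) _ x

/-- The constant of the one-sided bilinear estimate. -/
noncomputable def bilinearConst (p q' : ℝ) : ℝ≥0∞ :=
  2 * (carlesonConst p ^ (1 / p) * (1 + carlesonConst p) ^ (1 / q'))

theorem bilinearConst_ne_top {p q' : ℝ} (hp : 1 < p) (hq' : 0 ≤ q') : bilinearConst p q' ≠ ∞ := by
  have := carlesonConst_ne_top hp
  unfold bilinearConst
  refine ENNReal.mul_ne_top (by simp) (ENNReal.mul_ne_top ?_ ?_)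
  · exact ENNReal.rpow_ne_top_of_nonneg (by positivity) this
  · exact ENNReal.rpow_ne_top_of_nonneg (by positivity) (by simp [this])

/-- Blocks are the fibres of π over the principal sets F for the averages of f. On a block ⟨f⟩_Q ≤ 2
⟨f⟩_F, so Hölder and testing on F give 2 T ⟨f⟩_F μ(F)^(1/p) times the L^q' norm of `condAvg`. Hölder
over F then leaves the Carleson sum for f and the sum of the `b F`, the q'-th powers of those norms.
-/
theorem bilinear_one_sided {p p' q q' : ℝ} (hpp : p.HolderConjugate p')
    (hqq : q.HolderConjugate q') (hpq : p ≤ q) {μ ν : Measure X} {τ : Set X → ℝ≥0∞}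
    {𝒬 : Finset (Set X)} (hL : Laminar 𝒬) (hm : ∀ Q ∈ 𝒬, MeasurableSet Q) {T : ℝ≥0∞}
    (hT : DyadicTesting p q μ ν τ 𝒬 T) {f g : X → ℝ≥0∞} (hf : Measurable f) (hg : Measurable g)
    (hf1 : ∫⁻ x, f x ^ p ∂μ ≤ 1) (hg1 : ∫⁻ x, g x ^ q' ∂ν ≤ 1)
    (hμ : ∀ Q ∈ 𝒬, μ Q ≠ ∞) (hν0 : ∀ Q ∈ 𝒬, ν Q ≠ 0) (hν : ∀ Q ∈ 𝒬, ν Q ≠ ∞)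
    (hF : ∀ Q ∈ 𝒬, ∫⁻ x in Q, f x ∂μ ≠ 0)
    (hdom : ∀ Q ∈ 𝒬, avg ν g Q ^ q' * ν Q ≤ avg μ f Q ^ p * μ Q) :
    ∑ Q ∈ 𝒬, τ Q * (∫⁻ x in Q, f x ∂μ) * (∫⁻ x in Q, g x ∂ν) ≤ bilinearConst p q' * T := by
  classical
  have hμ0 : ∀ Q ∈ 𝒬, μ Q ≠ 0 := fun Q hQ h => hF Q hQ (setLIntegral_measure_zero _ _ h)
  have hne : ∀ Q ∈ 𝒬, Q.Nonempty := fun Q hQ => nonempty_of_measure_ne_zero (hμ0 Q hQ)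
  have hFfin : ∀ Q ∈ 𝒬, ∫⁻ x in Q, f x ∂μ ≠ ∞ := fun Q hQ =>
    setLIntegral_ne_top_of_rpow hpp.lt hf (ne_top_of_le_ne_top (by simp) hf1) (hμ Q hQ)
  obtain ⟨π, K, hπ⟩ := hL.exists_principal hne (a := avg μ f) fun Q hQ =>
    ⟨ENNReal.div_ne_zero.2 ⟨hF Q hQ, hμ Q hQ⟩, ENNReal.div_ne_top (hFfin Q hQ) (hμ0 Q hQ)⟩
  set 𝓕 : Finset (Set X) := 𝒬.image π with h𝓕
  have hππ : ∀ Q ∈ 𝒬, π (π Q) = π Q := fun Q hQ =>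
    (hπ Q hQ).2.2.2.2.2.1 _ (hπ Q hQ).1 (hπ Q hQ).2.1 subset_rfl
  have h𝓕mem : ∀ F ∈ 𝓕, F ∈ 𝒬 ∧ π F = F := by
    intro F hF
    obtain ⟨Q, hQ, rfl⟩ := Finset.mem_image.1 hF
    exact ⟨(hπ Q hQ).1, hππ Q hQ⟩
  have h𝓕sub : 𝓕 ⊆ 𝒬 := fun F hF => (h𝓕mem F hF).1
  have h𝓕L := hL.mono h𝓕sub
  have h𝓕m : ∀ F ∈ 𝓕, MeasurableSet F := fun F hF => hm F (h𝓕sub hF)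
  have h𝓕ne : ∀ F ∈ 𝓕, F.Nonempty := fun F hF => hne F (h𝓕sub hF)
  have hcar : ∑ F ∈ 𝓕, avg μ f F ^ p * μ F ≤ carlesonConst p := by
    refine (carleson_embedding hpp.lt hf h𝓕m (fun F hF => hμ F (h𝓕sub hF)) (a := avg μ f)
      (fun F hF => (avg_mul (hμ0 F (h𝓕sub hF)) (hμ F (h𝓕sub hF))).le) (K := K) ?_ ?_).trans ?_
    · intro F hF
      have := hπ F (h𝓕sub hF)
      rw [(h𝓕mem F hF).2] at this
      exact ⟨this.2.2.2.2.1, this.2.2.2.1⟩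
    · intro F hF F' hF' hK hI
      have := (hπ F (h𝓕sub hF)).2.2.2.2.2.2 F' (h𝓕sub hF') hK.symm hI
      rw [(h𝓕mem F hF).2, (h𝓕mem F' hF').2] at this
      exact this.symm
    · exact (mul_le_mul_right hf1 _).trans_eq (mul_one _)
  let B : Set X → Finset (Set X) := fun F => 𝒬.filter (π · = F)
  let b : Set X → ℝ≥0∞ := fun F => ∫⁻ x, condAvg 𝓕 ν g F x ^ q' ∂ν
  have hblock : ∀ F ∈ 𝓕, ∑ Q ∈ B F, τ Q * (∫⁻ x in Q, f x ∂μ) * (∫⁻ x in Q, g x ∂ν) ≤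
      2 * T * ((avg μ f F * μ F ^ (1 / p)) * b F ^ (1 / q')) := by
    intro F hF
    have hBsub : ∀ Q ∈ B F, Q ∈ 𝒬 ∧ π Q = F ∧ Q ⊆ F := by
      intro Q hQ
      obtain ⟨h1, h2⟩ := Finset.mem_filter.1 hQ
      exact ⟨h1, h2, h2 ▸ (hπ Q h1).2.1⟩
    have hcm := measurable_condAvg h𝓕m hF (ν := ν) hg
    have hBm : ∀ Q ∈ B F, MeasurableSet Q := fun Q hQ => hm Q (hBsub Q hQ).1
    calc ∑ Q ∈ B F, τ Q * (∫⁻ x in Q, f x ∂μ) * (∫⁻ x in Q, g x ∂ν)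
        ≤ ∑ Q ∈ B F, 2 * avg μ f F * ((τ Q * μ Q) * ∫⁻ x in Q, condAvg 𝓕 ν g F x ∂ν) := by
          refine Finset.sum_le_sum fun Q hQ => ?_
          obtain ⟨hQ1, hQ2, hQ3⟩ := hBsub Q hQ
          have e1 : ∫⁻ x in Q, f x ∂μ ≤ 2 * avg μ f F * μ Q := by
            rw [← avg_mul (hμ0 Q hQ1) (hμ Q hQ1)]
            gcongr
            have := hπ Q hQ1
            calc avg μ f Q ≤ 2 ^ (K Q + 1) := this.2.2.2.1
              _ = 2 * 2 ^ K Q := two_zpow_succ _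
              _ ≤ 2 * avg μ f F := by rw [← hQ2]; exact mul_le_mul_right this.2.2.2.2.1 _
          have e2 : ∫⁻ x in Q, g x ∂ν ≤ ∫⁻ x in Q, condAvg 𝓕 ν g F x ∂ν := by
            refine setLIntegral_le_condAvg h𝓕m hF (fun G hG => hν0 G (h𝓕sub hG))
              (fun G hG => hν G (h𝓕sub hG)) hg (hm Q hQ1) hQ3 fun G hG => ?_
            obtain ⟨hG1, hG2, -⟩ := mem_children.1 hG
            rcases hL G (h𝓕sub hG1) Q hQ1 with h | h | h
            · exact Or.inl h
            -- A child `G` with Q ⊆ G ⊂ F = π Q would have principal set `F`, whereas every member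
            -- of `𝓕` is its own principal set.
            · exfalso
              have := (hπ Q hQ1).2.2.2.2.2.1 G (h𝓕sub hG1) h (hQ2 ▸ hG2.subset)
              rw [(h𝓕mem G hG1).2, hQ2] at this
              exact hG2.ne this
            · exact Or.inr h
          calc τ Q * (∫⁻ x in Q, f x ∂μ) * (∫⁻ x in Q, g x ∂ν)
              ≤ τ Q * (2 * avg μ f F * μ Q) * (∫⁻ x in Q, condAvg 𝓕 ν g F x ∂ν) := by gcongr
            _ = _ := by ring
      _ = 2 * avg μ f F * ∫⁻ x in F, stepSum (B F) (fun R => τ R * μ R) x *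
            condAvg 𝓕 ν g F x ∂ν := by
          rw [setLIntegral_stepSum_mul hBm _ _ hcm fun Q hQ => (hBsub Q hQ).2.2, Finset.mul_sum]
      _ ≤ 2 * avg μ f F * ((∫⁻ x in F, stepSum (B F) (fun R => τ R * μ R) x ^ q ∂ν) ^ (1 / q) *
            (∫⁻ x in F, condAvg 𝓕 ν g F x ^ q' ∂ν) ^ (1 / q')) := by
          gcongr
          exact ENNReal.lintegral_mul_le_Lp_mul_Lq _ hqq
            (measurable_stepSum hBm _).aemeasurable hcm.aemeasurable
      _ ≤ 2 * avg μ f F * ((T * μ F ^ (1 / p)) * b F ^ (1 / q')) := by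
          have hq0 := hqq.nonneg
          have hq0' := hqq.symm.nonneg
          gcongr
          · refine le_trans ?_ (hT F (h𝓕sub hF))
            gcongr with x
            refine stepSum_mono (fun Q hQ => ?_) _ x
            exact Finset.mem_filter.2 ⟨(hBsub Q hQ).1, (hBsub Q hQ).2.2⟩
          · exact setLIntegral_le_lintegral _ _
      _ = _ := by ring
  -- The cores are disjoint and give at most ∫ g^q' ≤ 1. On the children, `hdom` trades the averages
  -- of g for those of f, which the Carleson embedding controls.
  have hb : ∑ F ∈ 𝓕, b F ≤ 1 + carlesonConst p := by
    simp only [b]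
    rw [Finset.sum_congr rfl fun F hF => h𝓕L.lintegral_condAvg_rpow h𝓕m hF hqq.symm.pos,
      Finset.sum_add_distrib]
    gcongr
    · exact (h𝓕L.sum_lintegral_core_le h𝓕m ν _).trans hg1
    · refine (h𝓕L.sum_children_le h𝓕ne _).trans (le_trans ?_ hcar)
      exact Finset.sum_le_sum fun F hF => hdom F (h𝓕sub hF)
  -- The place where p ≤ q is used: it allows the ℓ^(p'/q') norm of `b` to be bounded by its ℓ^1
  -- norm.
  have hqp : 1 ≤ p' / q' := by
    rw [one_le_div hqq.symm.pos]
    have h1 := hpp.inv_add_inv_eq_one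
    have h2 := hqq.inv_add_inv_eq_one
    have h3 : q⁻¹ ≤ p⁻¹ := inv_anti₀ hpp.pos hpq
    exact (inv_le_inv₀ hpp.symm.pos hqq.symm.pos).1 (by linarith)
  calc ∑ Q ∈ 𝒬, τ Q * (∫⁻ x in Q, f x ∂μ) * (∫⁻ x in Q, g x ∂ν)
      = ∑ F ∈ 𝓕, ∑ Q ∈ B F, τ Q * (∫⁻ x in Q, f x ∂μ) * (∫⁻ x in Q, g x ∂ν) :=
        (Finset.sum_fiberwise_of_maps_to (fun Q hQ => Finset.mem_image_of_mem π hQ) _).symm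
    _ ≤ ∑ F ∈ 𝓕, 2 * T * ((avg μ f F * μ F ^ (1 / p)) * b F ^ (1 / q')) :=
        Finset.sum_le_sum hblock
    _ = 2 * T * ∑ F ∈ 𝓕, (avg μ f F * μ F ^ (1 / p)) * b F ^ (1 / q') := by
        rw [Finset.mul_sum]
    _ ≤ 2 * T * ((∑ F ∈ 𝓕, (avg μ f F * μ F ^ (1 / p)) ^ p) ^ (1 / p) *
          (∑ F ∈ 𝓕, (b F ^ (1 / q')) ^ p') ^ (1 / p')) := by
        gcongr
        exact ENNReal.inner_le_Lp_mul_Lq _ _ _ hpp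
    _ ≤ 2 * T * (carlesonConst p ^ (1 / p) * ((1 + carlesonConst p) ^ (p' / q')) ^ (1 / p')) := by
        have hp0 := hpp.nonneg
        have hp0' := hpp.symm.nonneg
        have hq0' := hqq.symm.nonneg
        gcongr
        · refine le_trans (Finset.sum_le_sum fun F hF => le_of_eq ?_) hcar
          rw [ENNReal.mul_rpow_of_nonneg _ _ hp0, ← ENNReal.rpow_mul, one_div,
            inv_mul_cancel₀ hpp.ne_zero, ENNReal.rpow_one]
        · have : ∀ F, (b F ^ (1 / q')) ^ p' = b F ^ (p' / q') := fun F => by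
            rw [← ENNReal.rpow_mul]; congr 1; ring
          simp_rw [this]
          refine (sum_rpow_le_rpow_sum _ _ hqp).trans ?_
          gcongr
    _ = bilinearConst p q' * T := by
        rw [← ENNReal.rpow_mul, bilinearConst]
        have : p' / q' * (1 / p') = 1 / q' := by
          have := hpp.symm.ne_zero
          have := hqq.symm.ne_zero
          field_simp
        rw [this]; ring

end FracTesting

namespace FracTesting

variable {X : Type*} [MeasurableSpace X]

/-- The positive dyadic operator `f ↦ ∑_{Q ∈ 𝒬} τ_Q (∫_Q f dμ) χ_Q`. -/
noncomputable def dyadicOp (μ : Measure X) (τ : Set X → ℝ≥0∞) (𝒬 : Finset (Set X))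
    (f : X → ℝ≥0∞) : X → ℝ≥0∞ :=
  stepSum 𝒬 fun Q => τ Q * ∫⁻ y in Q, f y ∂μ

theorem measurable_dyadicOp {𝒬 : Finset (Set X)} (hm : ∀ Q ∈ 𝒬, MeasurableSet Q)
    (μ : Measure X) (τ : Set X → ℝ≥0∞) (f : X → ℝ≥0∞) : Measurable (dyadicOp μ τ 𝒬 f) :=
  measurable_stepSum hm _

/-! ### The strong type inequality for positive dyadic operators -/

/-- Each member falls under the half in which f or g dominates. The second half is the first one
with (p, μ, f) and (q', ν, g) exchanged, since p ≤ q means q' ≤ p'. -/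
theorem dyadic_bilinear {p p' q q' : ℝ} (hpp : p.HolderConjugate p')
    (hqq : q.HolderConjugate q') (hpq : p ≤ q) {μ ν : Measure X} {τ : Set X → ℝ≥0∞}
    {𝒬 : Finset (Set X)} (hL : Laminar 𝒬) (hm : ∀ Q ∈ 𝒬, MeasurableSet Q) {T T' : ℝ≥0∞}
    (hT : DyadicTesting p q μ ν τ 𝒬 T) (hT' : DyadicTesting q' p' ν μ τ 𝒬 T')
    {f g : X → ℝ≥0∞} (hf : Measurable f) (hg : Measurable g)
    (hf1 : ∫⁻ x, f x ^ p ∂μ ≤ 1) (hg1 : ∫⁻ x, g x ^ q' ∂ν ≤ 1)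
    (hμ : ∀ Q ∈ 𝒬, μ Q ≠ ∞) (hν : ∀ Q ∈ 𝒬, ν Q ≠ ∞) :
    ∑ Q ∈ 𝒬, τ Q * (∫⁻ x in Q, f x ∂μ) * (∫⁻ x in Q, g x ∂ν) ≤
      bilinearConst p q' * T + bilinearConst q' p * T' := by
  classical
  have hqp : q' ≤ p' := by
    have h1 := hpp.inv_add_inv_eq_one
    have h2 := hqq.inv_add_inv_eq_one
    have h3 : q⁻¹ ≤ p⁻¹ := inv_anti₀ hpp.pos hpq
    exact (inv_le_inv₀ hpp.symm.pos hqq.symm.pos).1 (by linarith)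
  -- Members on which one integral vanishes contribute nothing; discarding them makes both measures
  -- nonzero, so that averages are meaningful.
  set 𝒬₀ := 𝒬.filter (fun Q => ∫⁻ x in Q, f x ∂μ ≠ 0 ∧ ∫⁻ x in Q, g x ∂ν ≠ 0) with h𝒬₀
  have hsum : ∑ Q ∈ 𝒬, τ Q * (∫⁻ x in Q, f x ∂μ) * (∫⁻ x in Q, g x ∂ν) =
      ∑ Q ∈ 𝒬₀, τ Q * (∫⁻ x in Q, f x ∂μ) * (∫⁻ x in Q, g x ∂ν) := by
    refine (Finset.sum_subset (Finset.filter_subset _ _) fun Q hQ hQ' => ?_).symm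
    by_cases h : ∫⁻ x in Q, f x ∂μ = 0
    · simp [h]
    · have : ∫⁻ x in Q, g x ∂ν = 0 := by
        by_contra h'
        exact hQ' (Finset.mem_filter.2 ⟨hQ, h, h'⟩)
      simp [this]
  rw [hsum, ← Finset.sum_filter_add_sum_filter_not 𝒬₀
    (fun Q => avg ν g Q ^ q' * ν Q ≤ avg μ f Q ^ p * μ Q)]
  have hmem : ∀ Q ∈ 𝒬₀, Q ∈ 𝒬 ∧ ∫⁻ x in Q, f x ∂μ ≠ 0 ∧ ∫⁻ x in Q, g x ∂ν ≠ 0 :=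
    fun Q hQ => Finset.mem_filter.1 hQ
  have hsub : ∀ (P : Set X → Prop) [DecidablePred P], 𝒬₀.filter P ⊆ 𝒬 := fun P _ =>
    (Finset.filter_subset _ _).trans (Finset.filter_subset _ _)
  refine add_le_add ?_ ?_
  · refine bilinear_one_sided hpp hqq hpq (hL.mono (hsub _)) (fun Q hQ => hm Q (hsub _ hQ))
      (hT.mono hqq.pos (hsub _)) hf hg hf1 hg1 (fun Q hQ => hμ Q (hsub _ hQ)) ?_
      (fun Q hQ => hν Q (hsub _ hQ)) ?_ ?_
    · exact fun Q hQ h => (hmem Q (Finset.mem_filter.1 hQ).1).2.2 (setLIntegral_measure_zero _ _ h)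
    · exact fun Q hQ => (hmem Q (Finset.mem_filter.1 hQ).1).2.1
    · exact fun Q hQ => (Finset.mem_filter.1 hQ).2
  · rw [Finset.sum_congr rfl fun Q _ => mul_right_comm (τ Q) (∫⁻ x in Q, f x ∂μ)
      (∫⁻ x in Q, g x ∂ν)]
    refine bilinear_one_sided hqq.symm hpp.symm hqp (hL.mono (hsub _))
      (fun Q hQ => hm Q (hsub _ hQ))
      (hT'.mono hpp.symm.pos (hsub _)) hg hf hg1 hf1 (fun Q hQ => hν Q (hsub _ hQ)) ?_
      (fun Q hQ => hμ Q (hsub _ hQ)) ?_ ?_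
    · exact fun Q hQ h => (hmem Q (Finset.mem_filter.1 hQ).1).2.1 (setLIntegral_measure_zero _ _ h)
    · exact fun Q hQ => (hmem Q (Finset.mem_filter.1 hQ).1).2.2
    · exact fun Q hQ => (not_le.1 (Finset.mem_filter.1 hQ).2).le

/-- Duality with the extremal g = (Tf)^(q-1), where T is the dyadic operator, after normalizing f
and g. -/
theorem dyadic_strong {p p' q q' : ℝ} (hpp : p.HolderConjugate p')
    (hqq : q.HolderConjugate q') (hpq : p ≤ q) {μ ν : Measure X} {τ : Set X → ℝ≥0∞}
    {𝒬 : Finset (Set X)} (hL : Laminar 𝒬) (hm : ∀ Q ∈ 𝒬, MeasurableSet Q) {T T' : ℝ≥0∞}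
    (hT : DyadicTesting p q μ ν τ 𝒬 T) (hT' : DyadicTesting q' p' ν μ τ 𝒬 T')
    {f : X → ℝ≥0∞} (hf : Measurable f) (hf1 : ∫⁻ x, f x ^ p ∂μ ≠ ∞)
    (hμ : ∀ Q ∈ 𝒬, μ Q ≠ ∞) (hν : ∀ Q ∈ 𝒬, ν Q ≠ ∞) (hτ : ∀ Q ∈ 𝒬, τ Q ≠ ∞) :
    (∫⁻ x, dyadicOp μ τ 𝒬 f x ^ q ∂ν) ^ (1 / q) ≤
      (bilinearConst p q' * T + bilinearConst q' p * T') * (∫⁻ x, f x ^ p ∂μ) ^ (1 / p) := by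
  have hopm := measurable_dyadicOp hm μ τ f
  set M := ∫⁻ x, f x ^ p ∂μ with hM
  set N := ∫⁻ x, dyadicOp μ τ 𝒬 f x ^ q ∂ν with hN
  have hp0 := hpp.pos
  have hq0 := hqq.pos
  have hq0' := hqq.symm.pos
  rcases eq_or_ne N 0 with hN0 | hN0
  · rw [hN0, ENNReal.zero_rpow_of_pos (by positivity)]
    exact zero_le
  have hM0 : M ≠ 0 := by
    intro h
    apply hN0
    have h0 : f =ᵐ[μ] 0 := by
      have := (lintegral_eq_zero_iff (hf.pow_const p)).1 h
      filter_upwards [this] with x hx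
      simpa [hp0, hp0.le.not_gt] using hx
    have hz : ∀ Q : Set X, ∫⁻ y in Q, f y ∂μ = 0 := fun Q => by
      rw [lintegral_congr_ae (ae_restrict_of_ae h0)]; simp
    rw [hN]
    simp [dyadicOp, hz, stepSum, hq0]
  -- The operator is bounded and supported on a set of finite ν-measure, the family being finite.
  -- This legitimates the division by a power of `N`.
  have hNtop : N ≠ ∞ := by
    set c := ∑ Q ∈ 𝒬, τ Q * ∫⁻ y in Q, f y ∂μ with hc
    have hcfin : c ≠ ∞ := ENNReal.sum_ne_top.2 fun Q hQ => ENNReal.mul_ne_top (hτ Q hQ)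
      (setLIntegral_ne_top_of_rpow hpp.lt hf hf1 (hμ Q hQ))
    have hle : ∀ x, dyadicOp μ τ 𝒬 f x ^ q ≤ (⋃ Q ∈ 𝒬, Q).indicator (fun _ => c ^ q) x := by
      intro x
      by_cases hx : x ∈ ⋃ Q ∈ 𝒬, Q
      · rw [Set.indicator_of_mem hx]
        gcongr
        exact Finset.sum_le_sum fun Q _ => Set.indicator_le_self _ _ _
      · have : dyadicOp μ τ 𝒬 f x = 0 := Finset.sum_eq_zero fun Q hQ =>
          Set.indicator_of_notMem (fun h => hx (Set.mem_biUnion hQ h)) _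
        simp [this, hq0]
    refine ne_top_of_le_ne_top ?_ (lintegral_mono hle)
    rw [lintegral_indicator_const (Finset.measurableSet_biUnion _ hm)]
    refine ENNReal.mul_ne_top (ENNReal.rpow_ne_top_of_nonneg hq0.le hcfin) ?_
    exact ne_top_of_le_ne_top (ENNReal.sum_ne_top.2 hν) (measure_biUnion_finset_le _ _)
  set A := M ^ (1 / p) with hA
  set B := N ^ (1 / q') with hB
  have hA0 : A ≠ 0 := (ENNReal.rpow_pos (pos_iff_ne_zero.2 hM0) hf1).ne'
  have hA1 : A ≠ ∞ := ENNReal.rpow_ne_top_of_nonneg (by positivity) hf1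
  have hB0 : B ≠ 0 := (ENNReal.rpow_pos (pos_iff_ne_zero.2 hN0) hNtop).ne'
  have hB1 : B ≠ ∞ := ENNReal.rpow_ne_top_of_nonneg (by positivity) hNtop
  have hAp : A ^ p = M := by
    rw [hA, ← ENNReal.rpow_mul, one_div_mul_cancel hpp.ne_zero, ENNReal.rpow_one]
  have hBq : B ^ q' = N := by
    rw [hB, ← ENNReal.rpow_mul, one_div_mul_cancel hqq.symm.ne_zero, ENNReal.rpow_one]
  have hgm : Measurable fun x => dyadicOp μ τ 𝒬 f x ^ (q - 1) := hopm.pow_const _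
  have key := dyadic_bilinear hpp hqq hpq hL hm hT hT' (f := fun x => A⁻¹ * f x)
    (g := fun x => B⁻¹ * dyadicOp μ τ 𝒬 f x ^ (q - 1)) (hf.const_mul _) (hgm.const_mul _) ?_ ?_
    hμ hν
  · have e1 : ∑ Q ∈ 𝒬, τ Q * (∫⁻ x in Q, A⁻¹ * f x ∂μ) *
        (∫⁻ x in Q, B⁻¹ * dyadicOp μ τ 𝒬 f x ^ (q - 1) ∂ν) = A⁻¹ * B⁻¹ * N := by
      calc _ = A⁻¹ * B⁻¹ * ∑ Q ∈ 𝒬, (τ Q * (∫⁻ x in Q, f x ∂μ)) *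
            (∫⁻ x in Q, dyadicOp μ τ 𝒬 f x ^ (q - 1) ∂ν) := by
            rw [Finset.mul_sum]
            refine Finset.sum_congr rfl fun Q _ => ?_
            rw [lintegral_const_mul _ hf, lintegral_const_mul _ hgm]
            ring
        _ = A⁻¹ * B⁻¹ * ∫⁻ x, dyadicOp μ τ 𝒬 f x * dyadicOp μ τ 𝒬 f x ^ (q - 1) ∂ν := by
            rw [← lintegral_stepSum_mul hm _ _ hgm]; rfl
        _ = _ := by simp_rw [mul_rpow_sub_one hqq.lt.le]; rw [hN]
    rw [e1] at key
    have e2 : N = B * N ^ (1 / q) := by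
      rw [hB, ← ENNReal.rpow_add _ _ hN0 hNtop]
      have : 1 / q' + 1 / q = 1 := by
        have := hqq.inv_add_inv_eq_one
        simp only [one_div]; linarith
      rw [this, ENNReal.rpow_one]
    calc N ^ (1 / q) = (A⁻¹ * A) * (B⁻¹ * B) * N ^ (1 / q) := by
          rw [ENNReal.inv_mul_cancel hA0 hA1, ENNReal.inv_mul_cancel hB0 hB1, one_mul, one_mul]
      _ = (A⁻¹ * B⁻¹ * (B * N ^ (1 / q))) * A := by ring
      _ ≤ _ := by rw [← e2]; gcongr
  · simp_rw [ENNReal.mul_rpow_of_nonneg _ _ hp0.le]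
    rw [lintegral_const_mul _ (hf.pow_const p), ENNReal.inv_rpow, hAp,
      ENNReal.inv_mul_cancel hM0 hf1]
  · simp_rw [ENNReal.mul_rpow_of_nonneg _ _ hq0'.le, ← ENNReal.rpow_mul]
    have : (q - 1) * q' = q := hqq.sub_one_mul_conj
    rw [this, lintegral_const_mul _ (hopm.pow_const q), ENNReal.inv_rpow, hBq,
      ENNReal.inv_mul_cancel hN0 hNtop]

end FracTesting

namespace FracTesting

variable {X : Type*}

/-! ### The weak type inequality for positive dyadic operators -/

/-- The step function restricted to its members containing Q is the constant A(Q), so 𝒥 consists of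
the maximal Q with A(Q) > t. By maximality the proper ancestors of Q sum to at most t, and any
excess over t on Q comes from members inside Q. -/
theorem Laminar.exists_maximal_cover {𝒬 : Finset (Set X)} (hL : Laminar 𝒬)
    (c : Set X → ℝ≥0∞) (t : ℝ≥0∞) :
    ∃ 𝒥 ⊆ 𝒬, (∀ Q ∈ 𝒥, ∀ R ∈ 𝒥, (Q ∩ R).Nonempty → Q = R) ∧
      {x | t < stepSum 𝒬 c x} = (⋃ Q ∈ 𝒥, Q) ∧
      ∀ Q ∈ 𝒥, ∀ x ∈ Q, stepSum 𝒬 c x ≤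
        t + stepSum (@Finset.filter _ (· ⊆ Q) (Classical.decPred _) 𝒬) c x := by
  classical
  let A : Set X → ℝ≥0∞ := fun Q => ∑ R ∈ 𝒬.filter (Q ⊆ ·), c R
  have hstep : ∀ x, stepSum 𝒬 c x = ∑ R ∈ 𝒬.filter (x ∈ ·), c R := by
    intro x
    rw [Finset.sum_filter]
    exact Finset.sum_congr rfl fun R _ => by by_cases h : x ∈ R <;> simp [h]
  set 𝒜 := 𝒬.filter (fun Q => t < A Q) with h𝒜
  set 𝒥 := 𝒜.filter (fun Q => ∀ R ∈ 𝒜, Q ⊆ R → R = Q) with h𝒥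
  have hJ : ∀ Q ∈ 𝒥, Q ∈ 𝒬 ∧ t < A Q ∧ ∀ R ∈ 𝒜, Q ⊆ R → R = Q := by
    intro Q hQ
    obtain ⟨h1, h2⟩ := Finset.mem_filter.1 hQ
    exact ⟨(Finset.mem_filter.1 h1).1, (Finset.mem_filter.1 h1).2, h2⟩
  refine ⟨𝒥, fun Q hQ => (hJ Q hQ).1, ?_, ?_, ?_⟩
  · rintro Q hQ R hR ⟨x, hxQ, hxR⟩
    rcases hL.nested (hJ Q hQ).1 (hJ R hR).1 hxQ hxR with h | h
    · exact ((hJ Q hQ).2.2 R (Finset.mem_filter.1 hR).1 h).symm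
    · exact (hJ R hR).2.2 Q (Finset.mem_filter.1 hQ).1 h
  · ext x
    simp only [Set.mem_ofPred_eq, Set.mem_iUnion]
    constructor
    · intro hx
      have hnon : (𝒬.filter (x ∈ ·)).Nonempty := by
        by_contra h
        rw [Finset.not_nonempty_iff_eq_empty] at h
        rw [hstep, h] at hx
        simp at hx
      -- By laminarity every member through `x` contains the smallest one, so the value at `x` is at
      -- most `A Q`.
      obtain ⟨Q, hQ⟩ := (𝒬.filter (x ∈ ·)).exists_minimal hnon
      obtain ⟨hQ1, hQ2⟩ := Finset.mem_filter.1 hQ.prop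
      have hQA : Q ∈ 𝒜 := by
        refine Finset.mem_filter.2 ⟨hQ1, hx.trans_le ?_⟩
        rw [hstep]
        refine Finset.sum_le_sum_of_subset fun R hR => ?_
        obtain ⟨hR1, hR2⟩ := Finset.mem_filter.1 hR
        refine Finset.mem_filter.2 ⟨hR1, ?_⟩
        rcases hL.nested hQ1 hR1 hQ2 hR2 with h | h
        · exact h
        · exact hQ.le_of_le hR h
      obtain ⟨P, hQP, hP⟩ := 𝒜.exists_le_maximal hQA
      exact ⟨P, Finset.mem_filter.2 ⟨hP.prop, fun R hR hPR =>
        Set.Subset.antisymm (hP.le_of_ge hR hPR) hPR⟩, hQP hQ2⟩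
    · rintro ⟨Q, hQ, hx⟩
      refine (hJ Q hQ).2.1.trans_le ?_
      rw [hstep]
      refine Finset.sum_le_sum_of_subset fun R hR => ?_
      obtain ⟨hR1, hR2⟩ := Finset.mem_filter.1 hR
      exact Finset.mem_filter.2 ⟨hR1, hR2 hx⟩
  · intro Q hQ x hx
    have hout : ∑ R ∈ 𝒬.filter (Q ⊂ ·), c R ≤ t := by
      rcases (𝒬.filter (Q ⊂ ·)).eq_empty_or_nonempty with h | h
      · simp [h]
      · obtain ⟨P, hP⟩ := (𝒬.filter (Q ⊂ ·)).exists_minimal h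
        obtain ⟨hP1, hP2⟩ := Finset.mem_filter.1 hP.prop
        have : ∑ R ∈ 𝒬.filter (Q ⊂ ·), c R ≤ A P := by
          refine Finset.sum_le_sum_of_subset fun R hR => ?_
          obtain ⟨hR1, hR2⟩ := Finset.mem_filter.1 hR
          refine Finset.mem_filter.2 ⟨hR1, ?_⟩
          rcases hL.nested hP1 hR1 (hP2.subset hx) (hR2.subset hx) with h | h
          · exact h
          · exact hP.le_of_le hR h
        refine this.trans (not_lt.1 fun hlt => ?_)
        exact hP2.ne ((hJ Q hQ).2.2 P (Finset.mem_filter.2 ⟨hP1, hlt⟩) hP2.subset).symm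
    have hsplit : stepSum 𝒬 c x ≤ ∑ R ∈ 𝒬.filter (Q ⊂ ·), c R +
        stepSum (𝒬.filter (· ⊆ Q)) c x := by
      unfold stepSum
      rw [Finset.sum_filter, Finset.sum_filter, ← Finset.sum_add_distrib]
      refine Finset.sum_le_sum fun R hR => ?_
      by_cases hxR : x ∈ R
      · rcases hL.nested (hJ Q hQ).1 hR hx hxR with h | h
        · rcases h.eq_or_ssubset with h' | h'
          · simp [h', hxR]
          · simp [h', hxR]
        · simp [h, hxR]
      · simp [hxR]
    refine hsplit.trans (add_le_add hout (le_of_eq ?_))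
    congr!

variable [MeasurableSpace X]

/-- On a maximal Q of {Tf > t}, the local part exceeds t on Q ∩ {Tf > 2t}. Integrating it over Q
against ν, moving the operator to the other side and applying dual testing on Q gives t ν(Q ∩ S) ≤ T
ν(Q)^(1/q') ‖f χ_Q‖_p, where S = {Tf > 2t}. If ν(Q ∩ S) > η ν(Q), this bounds ν(Q) itself; otherwise
Q enters the first term. -/
theorem dyadic_good_lambda {p p' q q' : ℝ} (hpp : p.HolderConjugate p')
    (hqq : q.HolderConjugate q') (hpq : p ≤ q) {μ ν : Measure X} {τ : Set X → ℝ≥0∞}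
    {𝒬 : Finset (Set X)} (hL : Laminar 𝒬)
    (hm : ∀ Q ∈ 𝒬, MeasurableSet Q) {T : ℝ≥0∞} (hT : DyadicTesting q' p' ν μ τ 𝒬 T)
    {f : X → ℝ≥0∞} (hf : Measurable f) (hν : ∀ Q ∈ 𝒬, ν Q ≠ ∞) {t η : ℝ≥0∞} (ht0 : t ≠ 0)
    (ht : t ≠ ∞) (hη0 : η ≠ 0) (hη : η ≠ ∞) :
    ν {x | 2 * t < dyadicOp μ τ 𝒬 f x} ≤ η * ν {x | t < dyadicOp μ τ 𝒬 f x} +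
      (T / (t * η)) ^ q * (∫⁻ x, f x ^ p ∂μ) ^ (q / p) := by
  classical
  obtain ⟨𝒥, h𝒥𝒬, hdisj, hcov, hloc⟩ := hL.exists_maximal_cover
    (fun Q => τ Q * ∫⁻ y in Q, f y ∂μ) t
  change {x | t < dyadicOp μ τ 𝒬 f x} = _ at hcov
  have hJm : ∀ Q ∈ 𝒥, MeasurableSet Q := fun Q hQ => hm Q (h𝒥𝒬 hQ)
  have hJd : Set.PairwiseDisjoint (𝒥 : Set (Set X)) id := by
    intro Q hQ R hR hQR
    rw [Function.onFun, Set.disjoint_left]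
    exact fun x hx hx' => hQR (hdisj Q hQ R hR ⟨x, hx, hx'⟩)
  set S := {x | 2 * t < dyadicOp μ τ 𝒬 f x} with hS
  have hSm : MeasurableSet S := measurableSet_lt measurable_const (measurable_dyadicOp hm μ τ f)
  have hp0 := hpp.pos
  have hq0 := hqq.pos
  have hp0' := hpp.symm.pos
  have hq0' := hqq.symm.pos
  have h1 : ∀ Q ∈ 𝒥, t * ν (Q ∩ S) ≤ T * ν Q ^ (1 / q') * (∫⁻ x in Q, f x ^ p ∂μ) ^ (1 / p) := by
    intro Q hQ
    set 𝒬' := 𝒬.filter (· ⊆ Q) with h𝒬'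
    have hmem : ∀ R ∈ 𝒬', R ∈ 𝒬 ∧ R ⊆ Q := fun R hR => Finset.mem_filter.1 hR
    have hm' : ∀ R ∈ 𝒬', MeasurableSet R := fun R hR => hm R (hmem R hR).1
    calc t * ν (Q ∩ S) = ∫⁻ x in Q ∩ S, t ∂ν := by rw [setLIntegral_const]
      _ ≤ ∫⁻ x in Q ∩ S, stepSum 𝒬' (fun R => τ R * ∫⁻ y in R, f y ∂μ) x ∂ν := by
          refine setLIntegral_mono' ((hJm Q hQ).inter hSm) fun x hx => ?_
          have e1 := hloc Q hQ x hx.1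
          have e2 : t + t < t + stepSum 𝒬' (fun R => τ R * ∫⁻ y in R, f y ∂μ) x := by
            rw [← two_mul]
            refine lt_of_lt_of_le hx.2 (e1.trans (le_of_eq ?_))
            congr!
          exact ((ENNReal.add_lt_add_iff_left ht).1 e2).le
      _ ≤ ∫⁻ x in Q, stepSum 𝒬' (fun R => τ R * ∫⁻ y in R, f y ∂μ) x * 1 ∂ν := by
          simp only [mul_one]
          exact lintegral_mono_set Set.inter_subset_left
      _ = ∑ R ∈ 𝒬', (τ R * ∫⁻ y in R, f y ∂μ) * ν R := by
          rw [setLIntegral_stepSum_mul hm' _ _ measurable_const fun R hR => (hmem R hR).2]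
          simp
      _ = ∫⁻ x in Q, stepSum 𝒬' (fun R => τ R * ν R) x * f x ∂μ := by
          rw [setLIntegral_stepSum_mul hm' _ _ hf fun R hR => (hmem R hR).2]
          exact Finset.sum_congr rfl fun R _ => by ring
      _ ≤ (∫⁻ x in Q, stepSum 𝒬' (fun R => τ R * ν R) x ^ p' ∂μ) ^ (1 / p') *
            (∫⁻ x in Q, f x ^ p ∂μ) ^ (1 / p) :=
          ENNReal.lintegral_mul_le_Lp_mul_Lq _ hpp.symm (measurable_stepSum hm' _).aemeasurable
            hf.aemeasurable
      _ ≤ _ := by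
          gcongr
          refine le_trans (le_of_eq ?_) (hT Q (h𝒥𝒬 hQ))
          congr!
  have h2 : ∀ Q ∈ 𝒥, ν (Q ∩ S) ≤ η * ν Q + (T / (t * η)) ^ q *
      (∫⁻ x in Q, f x ^ p ∂μ) ^ (q / p) := by
    intro Q hQ
    rcases le_or_gt (ν (Q ∩ S)) (η * ν Q) with h | h
    · exact h.trans le_self_add
    · refine le_trans ?_ le_add_self
      have hQ1 : ν Q ≠ ∞ := hν Q (h𝒥𝒬 hQ)
      have hQ0 : ν Q ≠ 0 := fun h0 => by
        have : ν (Q ∩ S) = 0 := measure_mono_null Set.inter_subset_left h0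
        simp [this] at h
      set V := ν Q ^ (1 / q') with hV
      have hV0 : V ≠ 0 := (ENNReal.rpow_pos (pos_iff_ne_zero.2 hQ0) hQ1).ne'
      have hV1 : V ≠ ∞ := ENNReal.rpow_ne_top_of_nonneg (by positivity) hQ1
      have hsplit : ν Q = ν Q ^ (1 / q) * V := by
        rw [hV, ← ENNReal.rpow_add _ _ hQ0 hQ1]
        have : 1 / q + 1 / q' = 1 := by simpa only [one_div] using hqq.inv_add_inv_eq_one
        rw [this, ENNReal.rpow_one]
      have e1 : (t * η * ν Q ^ (1 / q)) * V ≤ (T * (∫⁻ x in Q, f x ^ p ∂μ) ^ (1 / p)) * V := by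
        calc (t * η * ν Q ^ (1 / q)) * V = t * (η * ν Q) := by rw [mul_assoc, ← hsplit, mul_assoc]
          _ ≤ t * ν (Q ∩ S) := by gcongr
          _ ≤ _ := h1 Q hQ
          _ = _ := by ring
      have e2 := (ENNReal.mul_le_mul_iff_left hV0 hV1).1 e1
      have e3 : ν Q ^ (1 / q) ≤ T / (t * η) * (∫⁻ x in Q, f x ^ p ∂μ) ^ (1 / p) := by
        rw [ENNReal.mul_div_right_comm.symm, ENNReal.le_div_iff_mul_le
          (Or.inl (mul_ne_zero ht0 hη0)) (Or.inl (ENNReal.mul_ne_top ht hη)), mul_comm]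
        exact e2
      calc ν (Q ∩ S) ≤ ν Q := measure_mono Set.inter_subset_left
        _ = (ν Q ^ (1 / q)) ^ q := by
            rw [← ENNReal.rpow_mul, one_div_mul_cancel hq0.ne', ENNReal.rpow_one]
        _ ≤ (T / (t * η) * (∫⁻ x in Q, f x ^ p ∂μ) ^ (1 / p)) ^ q := by gcongr
        _ = _ := by
            rw [ENNReal.mul_rpow_of_nonneg _ _ hq0.le, ← ENNReal.rpow_mul]
            congr 2; ring
  have hSsub : S ⊆ ⋃ Q ∈ 𝒥, (Q ∩ S) := by
    intro x hx
    have : x ∈ {x | t < dyadicOp μ τ 𝒬 f x} := by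
      have hx' : 2 * t < dyadicOp μ τ 𝒬 f x := hx
      refine lt_of_le_of_lt ?_ hx'
      rw [two_mul]; exact le_self_add
    rw [hcov] at this
    obtain ⟨Q, hQ, hxQ⟩ := Set.mem_iUnion₂.1 this
    exact Set.mem_biUnion hQ ⟨hxQ, hx⟩
  calc ν S ≤ ∑ Q ∈ 𝒥, ν (Q ∩ S) := (measure_mono hSsub).trans (measure_biUnion_finset_le _ _)
    _ ≤ ∑ Q ∈ 𝒥, (η * ν Q + (T / (t * η)) ^ q * (∫⁻ x in Q, f x ^ p ∂μ) ^ (q / p)) :=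
        Finset.sum_le_sum h2
    _ = η * ∑ Q ∈ 𝒥, ν Q + (T / (t * η)) ^ q * ∑ Q ∈ 𝒥, (∫⁻ x in Q, f x ^ p ∂μ) ^ (q / p) := by
        rw [Finset.sum_add_distrib, Finset.mul_sum, Finset.mul_sum]
    _ ≤ _ := by
        gcongr
        · rw [hcov]
          exact (measure_biUnion_finset hJd hJm).ge
        -- Since q / p ≥ 1, the local norms over the disjoint Q add up to the global one.
        · refine (sum_rpow_le_rpow_sum _ _ ((one_le_div hp0).2 hpq)).trans ?_
          gcongr
          refine (lintegral_biUnion_finset hJd hJm (fun x => f x ^ p)).ge.trans ?_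
          exact setLIntegral_le_lintegral _ _

/-- The constant of the dyadic weak type inequality. -/
noncomputable def weakConst (q : ℝ) : ℝ≥0∞ := 2 * (2 ^ q * (2 ^ (q + 1)) ^ q)

theorem weakConst_ne_top {q : ℝ} (hq : 0 ≤ q) : weakConst q ≠ ∞ := by
  have h2 : (2 : ℝ≥0∞) ^ (q + 1) ≠ ∞ := ENNReal.rpow_ne_top_of_nonneg (by linarith) (by simp)
  exact ENNReal.mul_ne_top (by simp) (ENNReal.mul_ne_top
    (ENNReal.rpow_ne_top_of_nonneg hq (by simp)) (ENNReal.rpow_ne_top_of_nonneg hq h2))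

/-- With φ(s) = s^q ν{Tf > s}, the good-λ inequality gives φ(2s) ≤ φ(s)/2 + D, and the first term is
absorbed after taking a supremum. -/
theorem dyadic_weak {p p' q q' : ℝ} (hpp : p.HolderConjugate p')
    (hqq : q.HolderConjugate q') (hpq : p ≤ q) {μ ν : Measure X} {τ : Set X → ℝ≥0∞}
    {𝒬 : Finset (Set X)} (hL : Laminar 𝒬)
    (hm : ∀ Q ∈ 𝒬, MeasurableSet Q) {T : ℝ≥0∞} (hT : DyadicTesting q' p' ν μ τ 𝒬 T)
    {f : X → ℝ≥0∞} (hf : Measurable f) (hν : ∀ Q ∈ 𝒬, ν Q ≠ ∞) {t : ℝ≥0∞} (ht0 : t ≠ 0)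
    (ht : t ≠ ∞) :
    t ^ q * ν {x | t < dyadicOp μ τ 𝒬 f x} ≤
      weakConst q * (T ^ q * (∫⁻ x, f x ^ p ∂μ) ^ (q / p)) := by
  have hq0 := hqq.pos
  set φ : ℝ≥0∞ → ℝ≥0∞ := fun s => s ^ q * ν {x | s < dyadicOp μ τ 𝒬 f x} with hφ
  -- Chosen so that 2^q η = 1/2.
  set η : ℝ≥0∞ := (2 ^ (q + 1))⁻¹ with hη
  have h20 : (2 : ℝ≥0∞) ^ (q + 1) ≠ 0 := (ENNReal.rpow_pos (by simp) (by simp)).ne'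
  have h21 : (2 : ℝ≥0∞) ^ (q + 1) ≠ ∞ := ENNReal.rpow_ne_top_of_nonneg (by linarith) (by simp)
  have hη0 : η ≠ 0 := ENNReal.inv_ne_zero.2 h21
  have hη1 : η ≠ ∞ := ENNReal.inv_ne_top.2 h20
  set D : ℝ≥0∞ := 2 ^ q * (2 ^ (q + 1)) ^ q * (T ^ q * (∫⁻ x, f x ^ p ∂μ) ^ (q / p)) with hD
  have step : ∀ s : ℝ≥0∞, s ≠ 0 → s ≠ ∞ → φ (2 * s) ≤ φ s / 2 + D := by
    intro s hs0 hs
    have hss : s ^ q * (s⁻¹) ^ q = 1 := by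
      rw [← ENNReal.mul_rpow_of_nonneg _ _ hq0.le, ENNReal.mul_inv_cancel hs0 hs, ENNReal.one_rpow]
    have h2q : (2 : ℝ≥0∞) ^ q * η = 2⁻¹ := by
      rw [hη, ENNReal.rpow_add _ _ (by simp) (by simp), ENNReal.rpow_one,
        ENNReal.mul_inv (by simp) (by simp), ← mul_assoc, ENNReal.mul_inv_cancel, one_mul]
      · exact (ENNReal.rpow_pos (by simp) (by simp)).ne'
      · exact ENNReal.rpow_ne_top_of_nonneg hq0.le (by simp)
    calc φ (2 * s) ≤ (2 * s) ^ q * (η * ν {x | s < dyadicOp μ τ 𝒬 f x} +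
          (T / (s * η)) ^ q * (∫⁻ x, f x ^ p ∂μ) ^ (q / p)) := by
          simp only [hφ]
          gcongr
          exact dyadic_good_lambda hpp hqq hpq hL hm hT hf hν hs0 hs hη0 hη1
      _ = (2 ^ q * η) * φ s + (s ^ q * (s⁻¹) ^ q) * D := by
          rw [ENNReal.mul_rpow_of_nonneg _ _ hq0.le, div_eq_mul_inv,
            ENNReal.mul_inv (Or.inl hs0) (Or.inl hs), hη, inv_inv,
            ENNReal.mul_rpow_of_nonneg _ _ hq0.le, ENNReal.mul_rpow_of_nonneg _ _ hq0.le, hφ, hD]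
          ring
      _ = φ s / 2 + D := by rw [h2q, hss, one_mul, div_eq_mul_inv, mul_comm]
  set S : ℝ≥0∞ := ⨆ (s : ℝ≥0∞) (_ : s ≠ 0 ∧ s ≤ t), φ s with hS
  -- Restricting to s ≤ t makes the supremum finite, as needed for absorption; halving s does not
  -- leave this range.
  have hSfin : S ≠ ∞ := by
    have hU : ν (⋃ Q ∈ 𝒬, Q) ≠ ∞ :=
      ne_top_of_le_ne_top (ENNReal.sum_ne_top.2 hν) (measure_biUnion_finset_le _ _)
    refine ne_top_of_le_ne_top (ENNReal.mul_ne_top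
      (ENNReal.rpow_ne_top_of_nonneg hq0.le ht) hU) (iSup₂_le fun s hs => ?_)
    simp only [hφ]
    gcongr
    · exact hs.2
    · intro x hx
      by_contra h
      have : dyadicOp μ τ 𝒬 f x = 0 := Finset.sum_eq_zero fun Q hQ =>
        Set.indicator_of_notMem (fun h' => h (Set.mem_biUnion hQ h')) _
      simp [this] at hx
  have hSD : S ≤ S / 2 + D := by
    refine iSup₂_le fun s hs => ?_
    have e : s = 2 * (s / 2) := (ENNReal.mul_div_cancel (by simp) (by simp)).symm
    have hs2 : s / 2 ≠ 0 := ENNReal.div_ne_zero.2 ⟨hs.1, by simp⟩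
    have hst : s / 2 ≤ t := ENNReal.half_le_self.trans hs.2
    rw [e]
    refine (step _ hs2 (ne_top_of_le_ne_top ht hst)).trans ?_
    gcongr
    exact le_iSup₂ (f := fun (s : ℝ≥0∞) (_ : s ≠ 0 ∧ s ≤ t) => φ s) (s / 2) ⟨hs2, hst⟩
  have hS2 : S / 2 ≤ D := by
    have hfin : S / 2 ≠ ∞ := ENNReal.div_ne_top hSfin (by simp)
    rw [← ENNReal.add_le_add_iff_left hfin, ENNReal.add_halves]
    exact hSD
  calc φ t ≤ S := le_iSup₂ (f := fun (s : ℝ≥0∞) (_ : s ≠ 0 ∧ s ≤ t) => φ s) t ⟨ht0, le_rfl⟩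
    _ = S / 2 + S / 2 := (ENNReal.add_halves S).symm
    _ ≤ D + D := add_le_add hS2 hS2
    _ = _ := by rw [hD, weakConst]; ring

end FracTesting

namespace FracTesting

variable {n : ℕ}

/-! ### Cubes -/

theorem cube_eq_preimage (a : EuclideanSpace ℝ (Fin n)) (l : ℝ) :
    cube a l = (MeasurableEquiv.toLp 2 (Fin n → ℝ)).symm ⁻¹'
      (Set.univ.pi fun i => Set.Ico (a i) (a i + l)) := by
  ext x
  simp only [cube, Set.mem_ofPred_eq, Set.mem_preimage, Set.mem_pi, Set.mem_univ, true_imp_iff,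
    Set.mem_Ico]
  rfl

theorem measurableSet_cube (a : EuclideanSpace ℝ (Fin n)) (l : ℝ) : MeasurableSet (cube a l) := by
  rw [cube_eq_preimage]
  exact (MeasurableEquiv.toLp 2 (Fin n → ℝ)).symm.measurable
    (MeasurableSet.univ_pi fun _ => measurableSet_Ico)

theorem volume_cube (a : EuclideanSpace ℝ (Fin n)) (l : ℝ) :
    volume (cube a l) = ENNReal.ofReal l ^ n := by
  rw [cube_eq_preimage, (EuclideanSpace.volume_preserving_symm_measurableEquiv_toLp
    (Fin n)).measure_preimage_equiv, Real.volume_pi_Ico]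
  simp

theorem norm_le_of_forall_abs_le {x : EuclideanSpace ℝ (Fin n)} {c : ℝ} (hc : 0 ≤ c)
    (h : ∀ i, |x i| ≤ c) : ‖x‖ ≤ n * c := by
  refine le_of_sq_le_sq ?_ (by positivity)
  rw [EuclideanSpace.norm_sq_eq]
  calc ∑ i, ‖x i‖ ^ 2 ≤ ∑ _i : Fin n, c ^ 2 := by
        gcongr with i
        exact h i
    _ = n * c ^ 2 := by simp
    _ ≤ (n * c) ^ 2 := by
        rw [mul_pow]
        gcongr
        rcases n.eq_zero_or_pos with rfl | hn
        · simp
        · have : (1 : ℝ) ≤ n := by exact_mod_cast hn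
          nlinarith

theorem norm_sub_le_of_mem_cube {a x y : EuclideanSpace ℝ (Fin n)} {l : ℝ} (hl : 0 ≤ l)
    (hx : x ∈ cube a l) (hy : y ∈ cube a l) : ‖x - y‖ ≤ n * l := by
  refine norm_le_of_forall_abs_le hl fun i => ?_
  have h1 : a i ≤ x i ∧ x i < a i + l := hx i
  have h2 : a i ≤ y i ∧ y i < a i + l := hy i
  rw [PiLp.sub_apply, abs_le]
  constructor <;> linarith

/-! ### Shifted grids of base `4 ^ m` -/

/-- The index of the cell of generation `k` containing `x`, in the grid of base `4 ^ m` that is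
shifted by `t / 3`. -/
noncomputable def cellIdx (m : ℕ) (t : Fin n → Fin 2) (k : ℤ) (x : EuclideanSpace ℝ (Fin n)) :
    Fin n → ℤ :=
  fun i => ⌊x i / ((4 : ℝ) ^ m) ^ k - (t i : ℝ) / 3⌋

/-- The cell of generation `k` and index `j`. -/
def cell (m : ℕ) (t : Fin n → Fin 2) (k : ℤ) (j : Fin n → ℤ) : Set (EuclideanSpace ℝ (Fin n)) :=
  {x | cellIdx m t k x = j}

theorem mem_cell {m : ℕ} {t : Fin n → Fin 2} {k : ℤ} {j : Fin n → ℤ}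
    {x : EuclideanSpace ℝ (Fin n)} : x ∈ cell m t k j ↔ cellIdx m t k x = j := Iff.rfl

theorem base_zpow_pos (m : ℕ) (k : ℤ) : 0 < ((4 : ℝ) ^ m) ^ k := by positivity

theorem cell_eq_cube (m : ℕ) (t : Fin n → Fin 2) (k : ℤ) (j : Fin n → ℤ) :
    cell m t k j =
      cube (WithLp.toLp 2 fun i => ((4 : ℝ) ^ m) ^ k * (j i + (t i : ℝ) / 3)) (((4 : ℝ) ^ m) ^ k) := by
  ext x
  have hb := base_zpow_pos m k
  rw [mem_cell, funext_iff]
  simp only [cube, Set.mem_ofPred_eq]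
  refine forall_congr' fun i => ?_
  rw [cellIdx, Int.floor_eq_iff]
  constructor
  · rintro ⟨h1, h2⟩
    rw [le_sub_iff_add_le, le_div_iff₀ hb] at h1
    rw [sub_lt_iff_lt_add, div_lt_iff₀ hb] at h2
    constructor <;> nlinarith
  · rintro ⟨h1, h2⟩
    rw [le_sub_iff_add_le, le_div_iff₀ hb, sub_lt_iff_lt_add, div_lt_iff₀ hb]
    constructor <;> nlinarith

theorem measurableSet_cell (m : ℕ) (t : Fin n → Fin 2) (k : ℤ) (j : Fin n → ℤ) :
    MeasurableSet (cell m t k j) := by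
  rw [cell_eq_cube]; exact measurableSet_cube _ _

/-- Nestedness of the shifted grid. Since 4^m = 3c + 1, the shift t/3 of the coarser generation is
t/3 + tc in units of the finer one: the two shifts differ by an integer, and the coarse index is a
function of the fine one. -/
theorem cellIdx_succ_eq (m : ℕ) (t : Fin n → Fin 2) (k : ℤ) {x y : EuclideanSpace ℝ (Fin n)}
    (h : cellIdx m t k x = cellIdx m t k y) : cellIdx m t (k + 1) x = cellIdx m t (k + 1) y := by
  obtain ⟨c, hc⟩ : ∃ c : ℕ, 4 ^ m = 3 * c + 1 := by
    have : 4 ^ m % 3 = 1 := by rw [Nat.pow_mod]; simp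
    exact ⟨4 ^ m / 3, by omega⟩
  have hcR : (4 : ℝ) ^ m = 3 * c + 1 := by exact_mod_cast hc
  have key : ∀ z : EuclideanSpace ℝ (Fin n), ∀ i, cellIdx m t (k + 1) z i =
      (cellIdx m t k z i - ((t i : ℕ) * c : ℕ)) / ((4 ^ m : ℕ) : ℤ) := by
    intro z i
    unfold cellIdx
    rw [← Int.floor_sub_natCast, ← Int.floor_div_natCast]
    congr 1
    have hb := (base_zpow_pos m k).ne'
    have h4 : ((4 : ℝ) ^ m) ≠ 0 := by positivity
    rw [zpow_add₀ h4, zpow_one]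
    push_cast
    rw [eq_div_iff h4, sub_mul, div_mul_eq_mul_div, mul_div_mul_right _ _ h4]
    have : (t i : ℝ) / 3 * 4 ^ m = (t i : ℝ) / 3 + (t i : ℝ) * c := by rw [hcR]; ring
    rw [this]; ring
  ext i
  rw [key, key, h]

theorem cellIdx_eq_of_le (m : ℕ) (t : Fin n → Fin 2) {k k' : ℤ} (hk : k ≤ k')
    {x y : EuclideanSpace ℝ (Fin n)} (h : cellIdx m t k x = cellIdx m t k y) :
    cellIdx m t k' x = cellIdx m t k' y := by
  induction k', hk using Int.leInduction with
  | base => exact h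
  | succ k' _ ih => exact cellIdx_succ_eq m t k' ih

open scoped Classical in
/-- Finitely many cells of a grid; they exhaust the grid as `M → ∞`. -/
noncomputable def cells (m : ℕ) (t : Fin n → Fin 2) (M : ℕ) :
    Finset (Set (EuclideanSpace ℝ (Fin n))) :=
  (Finset.Icc (-(M : ℤ)) M ×ˢ Finset.Icc (fun _ : Fin n => -(M : ℤ)) (fun _ => (M : ℤ))).image
    fun r => cell m t r.1 r.2

theorem exists_of_mem_cells {m : ℕ} {t : Fin n → Fin 2} {M : ℕ}
    {Q : Set (EuclideanSpace ℝ (Fin n))} (hQ : Q ∈ cells m t M) :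
    ∃ k j, Q = cell m t k j := by
  classical
  obtain ⟨r, _, rfl⟩ := Finset.mem_image.1 hQ
  exact ⟨_, _, rfl⟩

theorem measurableSet_of_mem_cells {m : ℕ} {t : Fin n → Fin 2} {M : ℕ}
    {Q : Set (EuclideanSpace ℝ (Fin n))} (hQ : Q ∈ cells m t M) : MeasurableSet Q := by
  obtain ⟨k, j, rfl⟩ := exists_of_mem_cells hQ
  exact measurableSet_cell _ _ _ _

theorem cells_mono (m : ℕ) (t : Fin n → Fin 2) : Monotone (cells m t) := by
  classical
  intro M M' h
  have h' : (M : ℤ) ≤ M' := by exact_mod_cast h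
  refine Finset.image_subset_image (Finset.product_subset_product ?_ ?_)
  · exact Finset.Icc_subset_Icc (neg_le_neg h') h'
  · exact Finset.Icc_subset_Icc (fun _ => neg_le_neg h') (fun _ => h')

theorem exists_cell_mem_cells (m : ℕ) (t : Fin n → Fin 2) (k : ℤ) (j : Fin n → ℤ) :
    ∃ M, cell m t k j ∈ cells m t M := by
  classical
  refine ⟨k.natAbs + ∑ i, (j i).natAbs, Finset.mem_image.2 ⟨(k, j), ?_, rfl⟩⟩
  have hj : ∀ i, (j i).natAbs ≤ ∑ i, (j i).natAbs := fun i =>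
    Finset.single_le_sum_of_canonicallyOrdered (f := fun i => (j i).natAbs) (Finset.mem_univ i)
  rw [Finset.mem_product, Finset.mem_Icc, Finset.mem_Icc, Pi.le_def, Pi.le_def]
  simp only
  refine ⟨by omega, fun i => ?_, fun i => ?_⟩ <;> have := hj i <;> omega

theorem laminar_cells (m : ℕ) (t : Fin n → Fin 2) (M : ℕ) : Laminar (cells m t M) := by
  have key : ∀ k k' j j', k ≤ k' → cell m t k j ⊆ cell m t k' j' ∨
      Disjoint (cell m t k j) (cell m t k' j') := by
    intro k k' j j' hk
    by_cases h : ∃ x, x ∈ cell m t k j ∧ x ∈ cell m t k' j'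
    · obtain ⟨x, hx, hx'⟩ := h
      rw [mem_cell] at hx hx'
      left
      intro y hy
      rw [mem_cell] at hy ⊢
      rw [← hx']
      exact cellIdx_eq_of_le m t hk (hy.trans hx.symm)
    · right
      rw [Set.disjoint_left]
      exact fun x hx hx' => h ⟨x, hx, hx'⟩
  intro Q hQ R hR
  obtain ⟨k, j, rfl⟩ := exists_of_mem_cells hQ
  obtain ⟨k', j', rfl⟩ := exists_of_mem_cells hR
  rcases le_total k k' with h | h
  · rcases key k k' j j' h with h | h
    · exact Or.inl h
    · exact Or.inr (Or.inr h)
  · rcases key k' k j' j h with h | h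
    · exact Or.inr (Or.inl h)
    · exact Or.inr (Or.inr h.symm)

/-- The one-third trick: if an integer N separates X ≤ Y with Y - X < 1/3, then both X - 1/3 and Y -
1/3 lie in [N - 1, N). -/
theorem exists_shift_floor_eq {X Y : ℝ} (h : |X - Y| < 1 / 3) :
    ∃ t : Fin 2, ⌊X - (t : ℝ) / 3⌋ = ⌊Y - (t : ℝ) / 3⌋ := by
  wlog hXY : X ≤ Y generalizing X Y
  · obtain ⟨t, ht⟩ := this (by rwa [abs_sub_comm]) (le_of_not_ge hXY)
    exact ⟨t, ht.symm⟩
  rw [abs_lt] at h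
  by_cases h0 : ⌊X⌋ = ⌊Y⌋
  · exact ⟨0, by simpa using h0⟩
  · refine ⟨1, ?_⟩
    have h1 : ⌊X⌋ < ⌊Y⌋ := lt_of_le_of_ne (Int.floor_le_floor hXY) h0
    have h2 : X < ⌊Y⌋ := Int.floor_lt.1 h1
    have h3 : (⌊Y⌋ : ℝ) ≤ Y := Int.floor_le Y
    have e1 : ⌊X - ((1 : Fin 2) : ℝ) / 3⌋ = ⌊Y⌋ - 1 := by
      rw [Int.floor_eq_iff]; push_cast
      constructor <;> norm_num <;> linarith
    have e2 : ⌊Y - ((1 : Fin 2) : ℝ) / 3⌋ = ⌊Y⌋ - 1 := by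
      rw [Int.floor_eq_iff]; push_cast
      constructor <;> norm_num <;> linarith
    rw [e1, e2]

theorem exists_shift_cellIdx_eq (m : ℕ) (k : ℤ) {x y : EuclideanSpace ℝ (Fin n)}
    (h : 3 * ‖x - y‖ < ((4 : ℝ) ^ m) ^ k) :
    ∃ t : Fin n → Fin 2, cellIdx m t k x = cellIdx m t k y := by
  have hb := base_zpow_pos m k
  have : ∀ i, ∃ s : Fin 2, ⌊x i / ((4 : ℝ) ^ m) ^ k - (s : ℝ) / 3⌋ =
      ⌊y i / ((4 : ℝ) ^ m) ^ k - (s : ℝ) / 3⌋ := by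
    intro i
    apply exists_shift_floor_eq
    rw [← sub_div, abs_div, abs_of_pos hb, div_lt_iff₀ hb]
    have := PiLp.norm_apply_le (x - y) i
    rw [PiLp.sub_apply, Real.norm_eq_abs] at this
    linarith
  choose t ht using this
  exact ⟨t, funext ht⟩

theorem norm_sub_le_of_cellIdx_eq {m : ℕ} {t : Fin n → Fin 2} {k : ℤ}
    {x y : EuclideanSpace ℝ (Fin n)} (h : cellIdx m t k x = cellIdx m t k y) :
    ‖x - y‖ ≤ n * ((4 : ℝ) ^ m) ^ k := by
  have hx : x ∈ cell m t k (cellIdx m t k y) := h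
  have hy : y ∈ cell m t k (cellIdx m t k y) := rfl
  rw [cell_eq_cube] at hx hy
  exact norm_sub_le_of_mem_cube (base_zpow_pos m k).le hx hy

/-! ### Comparison of the kernel with the dyadic kernels -/

/-- The kernel `|x - y| ^ (-ε)`. -/
noncomputable def kern (ε : ℝ) (x y : EuclideanSpace ℝ (Fin n)) : ℝ≥0∞ :=
  ENNReal.ofReal ((‖x - y‖ ^ ε)⁻¹)

/-- The coefficient `ℓ(Q) ^ (-ε)` of a cube `Q`, in terms of its volume. -/
noncomputable def sizeCoeff (ε : ℝ) (Q : Set (EuclideanSpace ℝ (Fin n))) : ℝ≥0∞ :=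
  volume Q ^ (-(ε / n))

theorem sizeCoeff_cell (hn : n ≠ 0) (ε : ℝ) (m : ℕ) (t : Fin n → Fin 2) (k : ℤ)
    (j : Fin n → ℤ) :
    sizeCoeff ε (cell m t k j) = ENNReal.ofReal ((((4 : ℝ) ^ m) ^ k) ^ (-ε)) := by
  have hn' : (n : ℝ) ≠ 0 := by exact_mod_cast hn
  rw [sizeCoeff, cell_eq_cube, volume_cube, ← ENNReal.rpow_natCast, ← ENNReal.rpow_mul,
    ENNReal.ofReal_rpow_of_pos (base_zpow_pos m k)]
  congr 2
  field_simp

/-- The kernel of the dyadic operator over the cells. -/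
noncomputable def cellKern (ε : ℝ) (m : ℕ) (t : Fin n → Fin 2) (M : ℕ)
    (x y : EuclideanSpace ℝ (Fin n)) : ℝ≥0∞ :=
  ∑ Q ∈ cells m t M, Q.indicator (fun _ => sizeCoeff ε Q * Q.indicator 1 y) x

theorem measurable_cellKern_summand (ε : ℝ) {m : ℕ} {t : Fin n → Fin 2} {M : ℕ}
    {R : Set (EuclideanSpace ℝ (Fin n))} (hR : R ∈ cells m t M) (x : EuclideanSpace ℝ (Fin n)) :
    Measurable fun y : EuclideanSpace ℝ (Fin n) =>
      R.indicator (fun _ => sizeCoeff ε R * R.indicator (1 : EuclideanSpace ℝ (Fin n) → ℝ≥0∞) y) x := by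
  by_cases hx : x ∈ R
  · simp only [Set.indicator_of_mem hx]
    exact (measurable_one.indicator (measurableSet_of_mem_cells hR)).const_mul _
  · simp only [Set.indicator_of_notMem hx]
    exact measurable_const

theorem cellKern_mono (ε : ℝ) (m : ℕ) (t : Fin n → Fin 2) (x y : EuclideanSpace ℝ (Fin n)) :
    Monotone fun M => cellKern ε m t M x y := fun _ _ h =>
  Finset.sum_le_sum_of_subset (cells_mono m t h)

/-- In one of the shifted grids x and y share a cell whose side is comparable with |x - y|, and that
single cell accounts for the kernel. -/
theorem exists_kern_le (hn : n ≠ 0) {ε : ℝ} (hε : 0 < ε) (hεn : ε ≤ n) {m : ℕ} (hm : 1 ≤ m * ε)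
    (hm' : m * ε ≤ n + 1) (x y : EuclideanSpace ℝ (Fin n)) :
    ∃ M, kern ε x y ≤ (3 ^ n * 4 ^ (n + 1)) * ∑ t : Fin n → Fin 2, cellKern ε m t M x y := by
  rcases eq_or_ne x y with rfl | hxy
  -- On the diagonal `kern` is 0, the inverse of 0 in ℝ being 0.
  · exact ⟨0, by simp [kern, hε.ne']⟩
  have hr : 0 < ‖x - y‖ := norm_pos_iff.2 (sub_ne_zero.2 hxy)
  set r := ‖x - y‖ with hrdef
  have hm0 : m ≠ 0 := by rintro rfl; norm_num at hm
  have hN : (1 : ℝ) < 4 ^ m := one_lt_pow₀ (by norm_num) hm0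
  -- The generation k + 1 has side in (3r, 3·4^m r]: large enough for the one-third trick, and
  -- losing at most (3·4^m)^ε.
  obtain ⟨k, hk1, hk2⟩ := exists_mem_Ico_zpow (by positivity : 0 < 3 * r) hN
  obtain ⟨t, ht⟩ := exists_shift_cellIdx_eq m (k + 1) hk2
  obtain ⟨M, hM⟩ := exists_cell_mem_cells m t (k + 1) (cellIdx m t (k + 1) y)
  refine ⟨M, ?_⟩
  set Q := cell m t (k + 1) (cellIdx m t (k + 1) y) with hQ
  have hx : x ∈ Q := ht
  have hy : y ∈ Q := rfl
  have h1 : sizeCoeff ε Q ≤ ∑ t : Fin n → Fin 2, cellKern ε m t M x y := by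
    calc sizeCoeff ε Q = Q.indicator (fun _ => sizeCoeff ε Q * Q.indicator 1 y) x := by
          simp [hx, hy]
      _ ≤ cellKern ε m t M x y := Finset.single_le_sum_of_canonicallyOrdered
          (f := fun Q : Set (EuclideanSpace ℝ (Fin n)) =>
            Q.indicator (fun _ => sizeCoeff ε Q * Q.indicator 1 y) x) hM
      _ ≤ _ := Finset.single_le_sum_of_canonicallyOrdered
          (f := fun t : Fin n → Fin 2 => cellKern ε m t M x y) (Finset.mem_univ t)
  refine le_trans ?_ (mul_le_mul_right h1 _)
  rw [hQ, sizeCoeff_cell hn, kern]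
  have e3 : ((3 : ℝ≥0∞) ^ n * 4 ^ (n + 1)) = ENNReal.ofReal (3 ^ n * 4 ^ (n + 1)) := by
    rw [ENNReal.ofReal_mul (by positivity), ENNReal.ofReal_pow (by norm_num),
      ENNReal.ofReal_pow (by norm_num)]
    norm_num
  rw [e3, ← ENNReal.ofReal_mul (by positivity)]
  apply ENNReal.ofReal_le_ofReal
  have hb := base_zpow_pos m (k + 1)
  have hle : ((4 : ℝ) ^ m) ^ (k + 1) ≤ (3 * 4 ^ m) * r := by
    rw [zpow_add₀ (by positivity), zpow_one]
    nlinarith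
  have hb2 : (((4 : ℝ) ^ m) ^ (k + 1)) ^ ε ≤ (3 ^ n * 4 ^ (n + 1)) * r ^ ε := by
    calc (((4 : ℝ) ^ m) ^ (k + 1)) ^ ε ≤ ((3 * 4 ^ m) * r) ^ ε :=
          Real.rpow_le_rpow hb.le hle hε.le
      _ = 3 ^ ε * (4 : ℝ) ^ (m * ε) * r ^ ε := by
          rw [Real.mul_rpow (by positivity) hr.le, Real.mul_rpow (by norm_num) (by positivity),
            ← Real.rpow_natCast 4 m, ← Real.rpow_mul (by norm_num)]
      _ ≤ (3 : ℝ) ^ (n : ℝ) * (4 : ℝ) ^ ((n + 1 : ℕ) : ℝ) * r ^ ε := by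
          gcongr
          · norm_num
          · norm_num
          · push_cast; exact hm'
      _ = _ := by rw [Real.rpow_natCast, Real.rpow_natCast]
  rw [Real.rpow_neg hb.le, ← div_eq_mul_inv, inv_eq_one_div, div_le_div_iff₀ (by positivity)
    (by positivity), one_mul]
  exact hb2

/-- At most one cell per generation contains both points. As mε ≥ 1, the coefficients form a
geometric sum dominated by the finest common cell, whose side is at least |x - y| / n. -/
theorem cellKern_le (hn : n ≠ 0) {ε : ℝ} (hε : 0 < ε) (hεn : ε ≤ n) {m : ℕ} (hm : 1 ≤ m * ε)
    (t : Fin n → Fin 2) (M : ℕ) {x y : EuclideanSpace ℝ (Fin n)} (hxy : x ≠ y) :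
    cellKern ε m t M x y ≤ 2 * n ^ n * kern ε x y := by
  classical
  have hr : 0 < ‖x - y‖ := norm_pos_iff.2 (sub_ne_zero.2 hxy)
  set w : ℤ → ℝ≥0∞ := fun k => ENNReal.ofReal ((((4 : ℝ) ^ m) ^ k) ^ (-ε)) with hw
  set I := Finset.Icc (-(M : ℤ)) M with hI
  set J := I.filter (fun k => cellIdx m t k x = cellIdx m t k y) with hJ
  have h1 : cellKern ε m t M x y ≤ ∑ k ∈ J, w k := by
    unfold cellKern cells
    refine (Finset.sum_image_le_of_nonneg (fun _ _ => zero_le)).trans ?_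
    rw [Finset.sum_product, hJ, Finset.sum_filter]
    refine Finset.sum_le_sum fun k _ => ?_
    simp only
    rw [← Finset.sum_filter_add_sum_filter_not _ (fun j => j = cellIdx m t k x)]
    rw [Finset.sum_eq_zero (s := Finset.filter (fun j => ¬ j = cellIdx m t k x) _), add_zero]
    · rw [Finset.filter_eq']
      split_ifs with h2 h3 h3
      · rw [Finset.sum_singleton]
        have hx : x ∈ cell m t k (cellIdx m t k x) := rfl
        have hy : y ∈ cell m t k (cellIdx m t k x) := h3.symm
        rw [Set.indicator_of_mem hx, Set.indicator_of_mem hy, sizeCoeff_cell hn]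
        simp [hw]
      · rw [Finset.sum_singleton]
        have hy : y ∉ cell m t k (cellIdx m t k x) := fun h => h3 (mem_cell.1 h).symm
        simp [hy]
      · simp
      · simp
    · intro j hj
      have hx : x ∉ cell m t k j := fun h => (Finset.mem_filter.1 hj).2 (mem_cell.1 h).symm
      exact Set.indicator_of_notMem hx _
  refine h1.trans ?_
  rcases J.eq_empty_or_nonempty with h | hne
  · simp [h]
  have h4 : ((4 : ℝ) ^ m) ^ (-ε) ≤ 1 / 4 := by
    rw [← Real.rpow_natCast, ← Real.rpow_mul (by norm_num)]
    calc (4 : ℝ) ^ ((m : ℝ) * -ε) ≤ 4 ^ (-1 : ℝ) :=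
          Real.rpow_le_rpow_of_exponent_le (by norm_num) (by linarith)
      _ = 1 / 4 := by rw [Real.rpow_neg_one]; norm_num
  have hstep : ∀ k, w (k + 1) ≤ 2⁻¹ * w k := by
    intro k
    have : (2 : ℝ≥0∞)⁻¹ = ENNReal.ofReal (1 / 2) := by
      rw [one_div, ENNReal.ofReal_inv_of_pos (by norm_num)]; norm_num
    simp only [hw]
    rw [this, ← ENNReal.ofReal_mul (by norm_num)]
    apply ENNReal.ofReal_le_ofReal
    rw [zpow_add₀ (by positivity), zpow_one, Real.mul_rpow (by positivity) (by positivity),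
      mul_comm]
    gcongr
    linarith
  have hk0 := Finset.mem_filter.1 (J.min'_mem hne)
  refine (sum_int_le_of_ratio hstep (j₀ := J.min' hne) fun j hj => J.min'_le j hj).trans ?_
  rw [ENNReal.one_sub_inv_two, inv_inv, mul_assoc]
  gcongr
  set b := ((4 : ℝ) ^ m) ^ (J.min' hne) with hb
  have hbpos : 0 < b := base_zpow_pos _ _
  have hle : ‖x - y‖ ≤ n * b := norm_sub_le_of_cellIdx_eq hk0.2
  have hn1 : (1 : ℝ) ≤ n := by exact_mod_cast Nat.one_le_iff_ne_zero.2 hn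
  have e3 : ((n : ℝ≥0∞) ^ n) = ENNReal.ofReal ((n : ℝ) ^ n) := by
    rw [ENNReal.ofReal_pow (by positivity)]; simp
  rw [kern, e3, ← ENNReal.ofReal_mul (by positivity)]
  apply ENNReal.ofReal_le_ofReal
  rw [← hb, Real.rpow_neg hbpos.le, ← div_eq_mul_inv, inv_eq_one_div,
    div_le_div_iff₀ (by positivity) (by positivity), one_mul]
  calc ‖x - y‖ ^ ε ≤ (n * b) ^ ε := Real.rpow_le_rpow hr.le hle hε.le
    _ = (n : ℝ) ^ ε * b ^ ε := Real.mul_rpow (by positivity) hbpos.le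
    _ ≤ (n : ℝ) ^ (n : ℝ) * b ^ ε := by gcongr
    _ = _ := by rw [Real.rpow_natCast]

end FracTesting

namespace FracTesting

variable {n : ℕ}

/-! ### Potentials of general measures -/

theorem measurable_kern (ε : ℝ) :
    Measurable fun z : EuclideanSpace ℝ (Fin n) × EuclideanSpace ℝ (Fin n) => kern ε z.1 z.2 := by
  unfold kern
  fun_prop

theorem measurable_kern_right (ε : ℝ) (x : EuclideanSpace ℝ (Fin n)) : Measurable (kern ε x) := by
  unfold kern
  fun_prop

theorem kern_comm (ε : ℝ) (x y : EuclideanSpace ℝ (Fin n)) : kern ε x y = kern ε y x := by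
  rw [kern, kern, norm_sub_rev]

/-- The potential `∫ f(y) |x - y| ^ (-ε) dμ(y)`. -/
noncomputable def pot (ε : ℝ) (μ : Measure (EuclideanSpace ℝ (Fin n)))
    (f : EuclideanSpace ℝ (Fin n) → ℝ≥0∞) (x : EuclideanSpace ℝ (Fin n)) : ℝ≥0∞ :=
  ∫⁻ y, kern ε x y * f y ∂μ

theorem measurable_pot (ε : ℝ) (μ : Measure (EuclideanSpace ℝ (Fin n))) [SFinite μ]
    {f : EuclideanSpace ℝ (Fin n) → ℝ≥0∞} (hf : Measurable f) : Measurable (pot ε μ f) :=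
  Measurable.lintegral_prod_right ((measurable_kern ε).mul (hf.comp measurable_snd))

/-- The testing condition over all cubes. -/
def KernelTesting (ε p q : ℝ) (μ ν : Measure (EuclideanSpace ℝ (Fin n))) (T : ℝ≥0∞) : Prop :=
  ∀ (a : EuclideanSpace ℝ (Fin n)) (l : ℝ), 0 < l →
    (∫⁻ x in cube a l, (∫⁻ y in cube a l, kern ε x y ∂μ) ^ q ∂ν) ^ (1 / q) ≤
      T * μ (cube a l) ^ (1 / p)

/-- A cell is a cube, and the localized dyadic operator applied to μ is pointwise at most a constant
times the localized potential. -/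
theorem KernelTesting.dyadicTesting (hn : n ≠ 0) {ε : ℝ} (hε : 0 < ε) (hεn : ε ≤ n) {m : ℕ}
    (hm : 1 ≤ m * ε) {p q : ℝ} (hq : 0 < q) {μ ν : Measure (EuclideanSpace ℝ (Fin n))}
    [NullSingletonClass μ] {T : ℝ≥0∞} (hT : KernelTesting ε p q μ ν T) (t : Fin n → Fin 2) (M : ℕ) :
    DyadicTesting p q μ ν (sizeCoeff ε) (cells m t M) (2 * n ^ n * T) := by
  classical
  intro Q hQ
  obtain ⟨k, j, hkj⟩ := exists_of_mem_cells hQ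
  rw [cell_eq_cube] at hkj
  set a := (WithLp.toLp 2 fun i => ((4 : ℝ) ^ m) ^ k * (j i + (t i : ℝ) / 3) :
    EuclideanSpace ℝ (Fin n))
  have key : ∀ x, stepSum ((cells m t M).filter (· ⊆ Q)) (fun R => sizeCoeff ε R * μ R) x ≤
      2 * n ^ n * ∫⁻ y in Q, kern ε x y ∂μ := by
    intro x
    calc stepSum ((cells m t M).filter (· ⊆ Q)) (fun R => sizeCoeff ε R * μ R) x
        = ∑ R ∈ (cells m t M).filter (· ⊆ Q), ∫⁻ y in Q,
            R.indicator (fun _ => sizeCoeff ε R * R.indicator 1 y) x ∂μ := by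
          refine Finset.sum_congr rfl fun R hR => ?_
          obtain ⟨hR1, hR2⟩ := Finset.mem_filter.1 hR
          by_cases hx : x ∈ R
          · simp only [Set.indicator_of_mem hx]
            rw [lintegral_const_mul _ (measurable_one.indicator (measurableSet_of_mem_cells hR1)),
              lintegral_indicator_one (measurableSet_of_mem_cells hR1), Measure.restrict_apply (measurableSet_of_mem_cells hR1),
              Set.inter_eq_left.2 hR2]
          · simp [hx]
      _ ≤ ∑ R ∈ cells m t M, ∫⁻ y in Q,
            R.indicator (fun _ => sizeCoeff ε R * R.indicator 1 y) x ∂μ :=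
          Finset.sum_le_sum_of_subset (Finset.filter_subset _ _)
      _ = ∫⁻ y in Q, cellKern ε m t M x y ∂μ := by
          unfold cellKern
          rw [lintegral_finsetSum _ fun R hR => measurable_cellKern_summand ε hR x]
      _ ≤ ∫⁻ y in Q, 2 * n ^ n * kern ε x y ∂μ := by
          refine lintegral_mono_ae ?_
          -- The comparison of kernels fails on the diagonal, where `kern` is 0; the point `x` is
          -- μ-null.
          have : ∀ᵐ y ∂(μ.restrict Q), y ≠ x := by
            refine ae_restrict_of_ae ?_
            rw [ae_iff]
            simp
          filter_upwards [this] with y hy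
          exact cellKern_le hn hε hεn hm t M hy.symm
      _ = _ := by rw [lintegral_const_mul _ (measurable_kern_right ε x)]
  refine (ENNReal.rpow_le_rpow (lintegral_mono fun x => ENNReal.rpow_le_rpow (key x) hq.le)
    (by positivity)).trans ?_
  calc (∫⁻ x in Q, (2 * n ^ n * ∫⁻ y in Q, kern ε x y ∂μ) ^ q ∂ν) ^ (1 / q)
      = 2 * n ^ n * (∫⁻ x in Q, (∫⁻ y in Q, kern ε x y ∂μ) ^ q ∂ν) ^ (1 / q) := by
        simp_rw [ENNReal.mul_rpow_of_nonneg (2 * (n : ℝ≥0∞) ^ n) _ hq.le]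
        have hfin : (2 * n ^ n : ℝ≥0∞) ≠ ∞ := by
          exact ENNReal.mul_ne_top (by simp) (ENNReal.pow_ne_top (by simp))
        rw [lintegral_const_mul' _ _ (ENNReal.rpow_ne_top_of_nonneg hq.le hfin),
          ENNReal.mul_rpow_of_nonneg _ _ (by positivity), ← ENNReal.rpow_mul,
          mul_one_div_cancel hq.ne', ENNReal.rpow_one]
    _ ≤ 2 * n ^ n * (T * μ Q ^ (1 / p)) := by
        gcongr
        rw [hkj]
        exact hT _ _ (base_zpow_pos m k)
    _ = _ := by ring

/-- The sum of the dyadic operators over the shifted grids. -/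
noncomputable def gridOp (ε : ℝ) (m : ℕ) (μ : Measure (EuclideanSpace ℝ (Fin n)))
    (f : EuclideanSpace ℝ (Fin n) → ℝ≥0∞) (M : ℕ) (x : EuclideanSpace ℝ (Fin n)) : ℝ≥0∞ :=
  (3 ^ n * 4 ^ (n + 1)) * ∑ t : Fin n → Fin 2, dyadicOp μ (sizeCoeff ε) (cells m t M) f x

theorem measurable_gridOp (ε : ℝ) (m : ℕ) (μ : Measure (EuclideanSpace ℝ (Fin n)))
    (f : EuclideanSpace ℝ (Fin n) → ℝ≥0∞) (M : ℕ) : Measurable (gridOp ε m μ f M) :=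
  (Finset.measurable_sum _ fun _ _ =>
    measurable_dyadicOp (fun _ hQ => measurableSet_of_mem_cells hQ) _ _ _).const_mul _

theorem gridOp_mono (ε : ℝ) (m : ℕ) (μ : Measure (EuclideanSpace ℝ (Fin n)))
    (f : EuclideanSpace ℝ (Fin n) → ℝ≥0∞) : Monotone (gridOp ε m μ f) := by
  intro M M' h x
  unfold gridOp dyadicOp
  gcongr with t
  exact stepSum_mono (cells_mono m t h) _ x

/-- The truncation M in `exists_kern_le` depends on the two points, so the supremum over M is taken
inside the integral and brought out by monotone convergence. -/
theorem pot_le_iSup_gridOp (hn : n ≠ 0) {ε : ℝ} (hε : 0 < ε) (hεn : ε ≤ n) {m : ℕ}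
    (hm : 1 ≤ m * ε) (hm' : m * ε ≤ n + 1) (μ : Measure (EuclideanSpace ℝ (Fin n)))
    {f : EuclideanSpace ℝ (Fin n) → ℝ≥0∞} (hf : Measurable f) (x : EuclideanSpace ℝ (Fin n)) :
    pot ε μ f x ≤ ⨆ M, gridOp ε m μ f M x := by
  have hck : ∀ (t : Fin n → Fin 2) (M : ℕ), Measurable fun y => cellKern ε m t M x y :=
    fun t M => Finset.measurable_sum _ fun R hR => measurable_cellKern_summand ε hR x
  have hG : ∀ M, ∫⁻ y, ((3 ^ n * 4 ^ (n + 1)) * ∑ t : Fin n → Fin 2, cellKern ε m t M x y) * f y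
      ∂μ = gridOp ε m μ f M x := by
    intro M
    unfold gridOp
    simp_rw [mul_assoc]
    have hfin : (3 : ℝ≥0∞) ^ n ≠ ∞ := by simp
    have hfin' : (4 : ℝ≥0∞) ^ (n + 1) ≠ ∞ := by simp
    rw [lintegral_const_mul' _ _ hfin, lintegral_const_mul' _ _ hfin']
    congr 2
    simp_rw [Finset.sum_mul]
    rw [lintegral_finsetSum (f := fun t y => cellKern ε m t M x y * f y) _
      fun t _ => (hck t M).mul hf]
    refine Finset.sum_congr rfl fun t _ => ?_
    unfold cellKern dyadicOp stepSum
    simp_rw [Finset.sum_mul]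
    rw [lintegral_finsetSum (f := fun (Q : Set (EuclideanSpace ℝ (Fin n))) y =>
      Q.indicator (fun _ => sizeCoeff ε Q * Q.indicator (1 : EuclideanSpace ℝ (Fin n) → ℝ≥0∞) y) x * f y) _
      fun R hR => (measurable_cellKern_summand ε hR x).mul hf]
    refine Finset.sum_congr rfl fun R hR => ?_
    have hRm := measurableSet_of_mem_cells hR
    by_cases hx : x ∈ R
    · simp only [Set.indicator_of_mem hx]
      rw [← lintegral_indicator hRm, ← lintegral_const_mul _ (hf.indicator hRm)]
      congr 1; ext y
      by_cases hy : y ∈ R <;> simp [hy]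
    · simp [hx]
  simp_rw [← hG]
  rw [← lintegral_iSup]
  · unfold pot
    refine lintegral_mono fun y => ?_
    obtain ⟨M, hM⟩ := exists_kern_le hn hε hεn hm hm' x y
    refine le_trans ?_ (le_iSup _ M)
    gcongr
  · exact fun M => ((Finset.measurable_sum _ fun t _ => hck t M).const_mul _).mul hf
  · intro M M' h y
    simp only
    gcongr with t
    exact cellKern_mono ε m t x y h

/-- The choice m = ⌈1/ε⌉ gives mε < 1 + ε ≤ n + 1. -/
theorem exists_generation {ε : ℝ} (hε : 0 < ε) (hεn : ε ≤ n) :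
    ∃ m : ℕ, 1 ≤ m * ε ∧ m * ε ≤ n + 1 := by
  refine ⟨⌈1 / ε⌉₊, ?_, ?_⟩
  · have := Nat.le_ceil (1 / ε)
    rwa [div_le_iff₀ hε] at this
  · have := Nat.ceil_lt_add_one (by positivity : 0 ≤ 1 / ε)
    have h2 : (⌈1 / ε⌉₊ : ℝ) * ε ≤ (1 / ε + 1) * ε := by gcongr
    have h3 : (1 / ε + 1) * ε = 1 + ε := by field_simp
    linarith

theorem sizeCoeff_ne_top (hn : n ≠ 0) (ε : ℝ) {m : ℕ} {t : Fin n → Fin 2} {M : ℕ}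
    {Q : Set (EuclideanSpace ℝ (Fin n))} (hQ : Q ∈ cells m t M) : sizeCoeff ε Q ≠ ∞ := by
  obtain ⟨k, j, rfl⟩ := exists_of_mem_cells hQ
  rw [sizeCoeff_cell hn]
  exact ENNReal.ofReal_ne_top

theorem measure_ne_top_of_mem_cells {μ : Measure (EuclideanSpace ℝ (Fin n))}
    (hμ : ∀ a l, 0 < l → μ (cube a l) ≠ ∞) {m : ℕ} {t : Fin n → Fin 2} {M : ℕ}
    {Q : Set (EuclideanSpace ℝ (Fin n))} (hQ : Q ∈ cells m t M) : μ Q ≠ ∞ := by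
  obtain ⟨k, j, rfl⟩ := exists_of_mem_cells hQ
  rw [cell_eq_cube]
  exact hμ _ _ (base_zpow_pos m k)

/-- The constant of the strong type inequality for potentials. -/
noncomputable def potStrongConst (n : ℕ) (p q' : ℝ) : ℝ≥0∞ :=
  3 ^ n * 4 ^ (n + 1) * 2 ^ n * (2 * n ^ n) * (bilinearConst p q' + bilinearConst q' p)

theorem potStrongConst_ne_top {p q' : ℝ} (hp : 1 < p) (hq' : 1 < q') :
    potStrongConst n p q' ≠ ∞ := by
  unfold potStrongConst
  have h1 : (3 : ℝ≥0∞) ^ n ≠ ∞ := by simp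
  have h2 : (4 : ℝ≥0∞) ^ (n + 1) ≠ ∞ := by simp
  have h3 : (2 : ℝ≥0∞) ^ n ≠ ∞ := by simp
  have h4 : (n : ℝ≥0∞) ^ n ≠ ∞ := ENNReal.pow_ne_top (by simp)
  have h5 := bilinearConst_ne_top (q' := q') hp (by linarith)
  have h6 := bilinearConst_ne_top (q' := p) hq' (by linarith)
  exact ENNReal.mul_ne_top (ENNReal.mul_ne_top (ENNReal.mul_ne_top (ENNReal.mul_ne_top h1 h2) h3)
    (ENNReal.mul_ne_top (by simp) h4)) (ENNReal.add_ne_top.2 ⟨h5, h6⟩)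

theorem card_shifts : (Fintype.card (Fin n → Fin 2) : ℝ≥0∞) = 2 ^ n := by simp

theorem pot_strong (hn : n ≠ 0) {ε : ℝ} (hε : 0 < ε) (hεn : ε ≤ n) {p p' q q' : ℝ}
    (hpp : p.HolderConjugate p') (hqq : q.HolderConjugate q') (hpq : p ≤ q)
    {μ ν : Measure (EuclideanSpace ℝ (Fin n))} [NullSingletonClass μ] [NullSingletonClass ν]
    (hμ : ∀ a l, 0 < l → μ (cube a l) ≠ ∞) (hν : ∀ a l, 0 < l → ν (cube a l) ≠ ∞)
    {T T' : ℝ≥0∞} (hT : KernelTesting ε p q μ ν T) (hT' : KernelTesting ε q' p' ν μ T')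
    {f : EuclideanSpace ℝ (Fin n) → ℝ≥0∞} (hf : Measurable f) (hf1 : ∫⁻ x, f x ^ p ∂μ ≠ ∞) :
    (∫⁻ x, pot ε μ f x ^ q ∂ν) ^ (1 / q) ≤
      potStrongConst n p q' * (T + T') * (∫⁻ x, f x ^ p ∂μ) ^ (1 / p) := by
  obtain ⟨m, hm, hm'⟩ := exists_generation hε hεn
  have hq0 := hqq.pos
  set B : ℝ≥0∞ := (2 * n ^ n) * ((bilinearConst p q' + bilinearConst q' p) * (T + T')) *
    (∫⁻ x, f x ^ p ∂μ) ^ (1 / p) with hB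
  have h1 : ∀ (t : Fin n → Fin 2) (M : ℕ),
      ∫⁻ x, dyadicOp μ (sizeCoeff ε) (cells m t M) f x ^ q ∂ν ≤ B ^ q := by
    intro t M
    have := dyadic_strong hpp hqq hpq (laminar_cells m t M)
      (fun Q hQ => measurableSet_of_mem_cells hQ)
      (hT.dyadicTesting hn hε hεn hm hq0 t M) (hT'.dyadicTesting hn hε hεn hm hpp.symm.pos t M)
      hf hf1 (fun Q hQ => measure_ne_top_of_mem_cells hμ hQ)
      (fun Q hQ => measure_ne_top_of_mem_cells hν hQ) (fun Q hQ => sizeCoeff_ne_top hn ε hQ)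
    have h2 : (∫⁻ x, dyadicOp μ (sizeCoeff ε) (cells m t M) f x ^ q ∂ν) ^ (1 / q) ≤ B := by
      refine this.trans ?_
      rw [hB]
      gcongr
      calc bilinearConst p q' * (2 * n ^ n * T) + bilinearConst q' p * (2 * n ^ n * T')
          = 2 * n ^ n * (bilinearConst p q' * T + bilinearConst q' p * T') := by ring
        _ ≤ _ := by
          gcongr
          rw [add_mul]
          gcongr
          · exact le_self_add
          · exact le_add_self
    rwa [one_div, ENNReal.rpow_inv_le_iff hq0] at h2
  set A : ℝ≥0∞ := 3 ^ n * 4 ^ (n + 1) with hA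
  have hAfin : A ≠ ∞ := ENNReal.mul_ne_top (by simp) (by simp)
  have h2 : ∀ M, ∫⁻ x, gridOp ε m μ f M x ^ q ∂ν ≤ (A * 2 ^ n * B) ^ q := by
    intro M
    have hdm : ∀ t : Fin n → Fin 2, Measurable (dyadicOp μ (sizeCoeff ε) (cells m t M) f) :=
      fun t => measurable_dyadicOp (fun _ hQ => measurableSet_of_mem_cells hQ) _ _ _
    calc ∫⁻ x, gridOp ε m μ f M x ^ q ∂ν
        ≤ ∫⁻ x, A ^ q * ((2 ^ n) ^ (q - 1) *
            ∑ t : Fin n → Fin 2, dyadicOp μ (sizeCoeff ε) (cells m t M) f x ^ q) ∂ν := by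
          refine lintegral_mono fun x => ?_
          rw [gridOp, ENNReal.mul_rpow_of_nonneg _ _ hq0.le]
          gcongr
          have := ENNReal.rpow_sum_le_const_mul_sum_rpow (Finset.univ : Finset (Fin n → Fin 2))
            (fun t => dyadicOp μ (sizeCoeff ε) (cells m t M) f x) hqq.lt.le
          rwa [Finset.card_univ, card_shifts] at this
      _ = A ^ q * ((2 ^ n) ^ (q - 1) * ∑ t : Fin n → Fin 2,
            ∫⁻ x, dyadicOp μ (sizeCoeff ε) (cells m t M) f x ^ q ∂ν) := by
          have hs : Measurable fun x => ∑ t : Fin n → Fin 2,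
              dyadicOp μ (sizeCoeff ε) (cells m t M) f x ^ q :=
            Finset.measurable_sum _ fun t _ => (hdm t).pow_const q
          rw [lintegral_const_mul _ (hs.const_mul _), lintegral_const_mul _ hs,
            lintegral_finsetSum _ fun t _ => (hdm t).pow_const q]
      _ ≤ A ^ q * ((2 ^ n) ^ (q - 1) * ∑ _t : Fin n → Fin 2, B ^ q) := by
          gcongr with t
          exact h1 t M
      _ = _ := by
          rw [Finset.sum_const, Finset.card_univ, nsmul_eq_mul, card_shifts,
            ENNReal.mul_rpow_of_nonneg (A * 2 ^ n) B hq0.le,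
            ENNReal.mul_rpow_of_nonneg A (2 ^ n) hq0.le,
            ← mul_rpow_sub_one hqq.lt.le ((2 : ℝ≥0∞) ^ n)]
          ring
  have h3 : ∫⁻ x, pot ε μ f x ^ q ∂ν ≤ (A * 2 ^ n * B) ^ q := by
    calc ∫⁻ x, pot ε μ f x ^ q ∂ν ≤ ∫⁻ x, ⨆ M, gridOp ε m μ f M x ^ q ∂ν := by
          refine lintegral_mono fun x => ?_
          have := ENNReal.rpow_le_rpow (pot_le_iSup_gridOp hn hε hεn hm hm' μ hf x) hq0.le
          refine this.trans (le_of_eq ?_)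
          exact (ENNReal.orderIsoRpow q hq0).map_iSup _
      _ = ⨆ M, ∫⁻ x, gridOp ε m μ f M x ^ q ∂ν := by
          rw [lintegral_iSup]
          · exact fun M => (measurable_gridOp ε m μ f M).pow_const q
          · intro M M' h x
            exact ENNReal.rpow_le_rpow (gridOp_mono ε m μ f h x) hq0.le
      _ ≤ _ := iSup_le h2
  rw [one_div, ENNReal.rpow_inv_le_iff hq0]
  refine h3.trans (le_of_eq ?_)
  congr 1
  rw [hB, hA, potStrongConst]
  ring

/-- The constant of the weak type inequality for potentials. -/
noncomputable def potWeakConst (n : ℕ) (q : ℝ) : ℝ≥0∞ :=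
  3 ^ n * 4 ^ (n + 1) * 2 ^ n * (2 ^ n * weakConst q) ^ (1 / q) * (2 * n ^ n)

theorem potWeakConst_ne_top {q : ℝ} (hq : 0 ≤ q) : potWeakConst n q ≠ ∞ := by
  unfold potWeakConst
  have h1 : (3 : ℝ≥0∞) ^ n ≠ ∞ := by simp
  have h2 : (4 : ℝ≥0∞) ^ (n + 1) ≠ ∞ := by simp
  have h3 : (2 : ℝ≥0∞) ^ n ≠ ∞ := by simp
  have h4 : (n : ℝ≥0∞) ^ n ≠ ∞ := ENNReal.pow_ne_top (by simp)
  have h5 := weakConst_ne_top hq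
  exact ENNReal.mul_ne_top (ENNReal.mul_ne_top (ENNReal.mul_ne_top (ENNReal.mul_ne_top h1 h2) h3)
    (ENNReal.rpow_ne_top_of_nonneg (by positivity) (ENNReal.mul_ne_top h3 h5)))
    (ENNReal.mul_ne_top (by simp) h4)

/-- If the sum over the 2^n grids exceeds s, then one of its terms exceeds s / L. Local finiteness
is needed for ν alone, because the dyadic weak estimate never divides by μ(Q). -/
theorem pot_weak (hn : n ≠ 0) {ε : ℝ} (hε : 0 < ε) (hεn : ε ≤ n) {p p' q q' : ℝ}
    (hpp : p.HolderConjugate p') (hqq : q.HolderConjugate q') (hpq : p ≤ q)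
    {μ ν : Measure (EuclideanSpace ℝ (Fin n))} [NullSingletonClass ν]
    (hν : ∀ a l, 0 < l → ν (cube a l) ≠ ∞)
    {T : ℝ≥0∞} (hT : KernelTesting ε q' p' ν μ T)
    {f : EuclideanSpace ℝ (Fin n) → ℝ≥0∞} (hf : Measurable f) {s : ℝ≥0∞} (hs0 : s ≠ 0)
    (hs : s ≠ ∞) :
    s * ν {x | s < pot ε μ f x} ^ (1 / q) ≤
      potWeakConst n q * T * (∫⁻ x, f x ^ p ∂μ) ^ (1 / p) := by
  obtain ⟨m, hm, hm'⟩ := exists_generation hε hεn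
  have hq0 := hqq.pos
  have hp0 := hpp.pos
  set A : ℝ≥0∞ := 3 ^ n * 4 ^ (n + 1) with hA
  have hAfin : A ≠ ∞ := ENNReal.mul_ne_top (by simp) (by simp)
  have hA0 : A ≠ 0 := mul_ne_zero (by simp) (by simp)
  set L : ℝ≥0∞ := A * 2 ^ n with hL
  have hLfin : L ≠ ∞ := ENNReal.mul_ne_top hAfin (by simp)
  have hL0 : L ≠ 0 := mul_ne_zero hA0 (by simp)
  set W : ℝ≥0∞ := weakConst q * ((2 * n ^ n * T) ^ q * (∫⁻ x, f x ^ p ∂μ) ^ (q / p)) with hW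
  have hsL0 : s / L ≠ 0 := ENNReal.div_ne_zero.2 ⟨hs0, hLfin⟩
  have hsL : s / L ≠ ∞ := ENNReal.div_ne_top hs hL0
  have hsplit : s ^ q = L ^ q * (s / L) ^ q := by
    rw [← ENNReal.mul_rpow_of_nonneg _ _ hq0.le, ENNReal.mul_div_cancel hL0 hLfin]
  have h1 : ∀ (t : Fin n → Fin 2) (M : ℕ), (s / L) ^ q *
      ν {x | s / L < dyadicOp μ (sizeCoeff ε) (cells m t M) f x} ≤ W := fun t M =>
    dyadic_weak hpp hqq hpq (laminar_cells m t M) (fun Q hQ => measurableSet_of_mem_cells hQ)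
      (hT.dyadicTesting hn hε hεn hm hpp.symm.pos t M) hf
      (fun Q hQ => measure_ne_top_of_mem_cells hν hQ) hsL0 hsL
  have h2 : ∀ M, s ^ q * ν {x | s < gridOp ε m μ f M x} ≤ L ^ q * (2 ^ n * W) := by
    intro M
    have hsub : {x | s < gridOp ε m μ f M x} ⊆ ⋃ t ∈ (Finset.univ : Finset (Fin n → Fin 2)),
        {x | s / L < dyadicOp μ (sizeCoeff ε) (cells m t M) f x} := by
      intro x hx
      have hx' : s < gridOp ε m μ f M x := hx
      by_contra hcon
      simp only [Finset.mem_univ, Set.iUnion_true, Set.mem_iUnion, Set.mem_ofPred_eq,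
        not_exists, not_lt] at hcon
      refine absurd hx' (not_lt.2 ?_)
      calc gridOp ε m μ f M x ≤ A * ∑ _t : Fin n → Fin 2, s / L := by
            unfold gridOp
            gcongr with t
            exact hcon t
        _ = L * (s / L) := by
            rw [Finset.sum_const, Finset.card_univ, nsmul_eq_mul, card_shifts, ← mul_assoc]
        _ = s := ENNReal.mul_div_cancel hL0 hLfin
    calc s ^ q * ν {x | s < gridOp ε m μ f M x}
        ≤ s ^ q * ∑ t : Fin n → Fin 2,
            ν {x | s / L < dyadicOp μ (sizeCoeff ε) (cells m t M) f x} := by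
          gcongr
          exact (measure_mono hsub).trans (measure_biUnion_finset_le _ _)
      _ = L ^ q * ∑ t : Fin n → Fin 2, (s / L) ^ q *
            ν {x | s / L < dyadicOp μ (sizeCoeff ε) (cells m t M) f x} := by
          rw [hsplit, ← Finset.mul_sum, mul_assoc]
      _ ≤ L ^ q * ∑ _t : Fin n → Fin 2, W := by
          gcongr with t
          exact h1 t M
      _ = _ := by rw [Finset.sum_const, Finset.card_univ, nsmul_eq_mul, card_shifts]
  have h3 : s ^ q * ν {x | s < pot ε μ f x} ≤ L ^ q * (2 ^ n * W) := by
    have hsub : {x | s < pot ε μ f x} ⊆ ⋃ M, {x | s < gridOp ε m μ f M x} := by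
      intro x hx
      have hx' : s < pot ε μ f x := hx
      obtain ⟨M, hM⟩ := lt_iSup_iff.1
        (hx'.trans_le (pot_le_iSup_gridOp hn hε hεn hm hm' μ hf x))
      exact Set.mem_iUnion.2 ⟨M, hM⟩
    have hmono : Monotone fun M => {x | s < gridOp ε m μ f M x} := fun M M' h x hx =>
      lt_of_lt_of_le (show s < gridOp ε m μ f M x from hx) (gridOp_mono ε m μ f h x)
    calc s ^ q * ν {x | s < pot ε μ f x} ≤ s ^ q * ν (⋃ M, {x | s < gridOp ε m μ f M x}) := by
          gcongr
      _ = ⨆ M, s ^ q * ν {x | s < gridOp ε m μ f M x} := by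
          rw [hmono.measure_iUnion, ENNReal.mul_iSup]
      _ ≤ _ := iSup_le h2
  have hroot : ∀ z : ℝ≥0∞, (z ^ q) ^ (1 / q) = z := fun z => by
    rw [← ENNReal.rpow_mul, mul_one_div_cancel hq0.ne', ENNReal.rpow_one]
  have hq1 : 0 ≤ 1 / q := by positivity
  calc s * ν {x | s < pot ε μ f x} ^ (1 / q) = (s ^ q * ν {x | s < pot ε μ f x}) ^ (1 / q) := by
        rw [ENNReal.mul_rpow_of_nonneg _ _ hq1, hroot]
    _ ≤ (L ^ q * (2 ^ n * W)) ^ (1 / q) := by gcongr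
    _ = L * (2 ^ n * weakConst q) ^ (1 / q) * (2 * n ^ n * T) *
          (∫⁻ x, f x ^ p ∂μ) ^ (1 / p) := by
        rw [hW, ← mul_assoc (2 ^ n), ENNReal.mul_rpow_of_nonneg (L ^ q) _ hq1, hroot,
          ENNReal.mul_rpow_of_nonneg (2 ^ n * weakConst q) _ hq1,
          ENNReal.mul_rpow_of_nonneg ((2 * n ^ n * T) ^ q) _ hq1, hroot, ← ENNReal.rpow_mul]
        have : q / p * (1 / q) = 1 / p := by field_simp
        rw [this]
        ring
    _ = _ := by rw [potWeakConst, hL, hA]; ring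

end FracTesting

namespace FracTesting

variable {n : ℕ}

/-! ### Local bounds for the kernel -/

/-- Concentric enlargements of the cube exhaust the space, so they cannot all be null. -/
theorem exists_cube_superset {ν : Measure (EuclideanSpace ℝ (Fin n))} (hν : ν ≠ 0)
    (a : EuclideanSpace ℝ (Fin n)) {l : ℝ} (hl : 0 < l) :
    ∃ b l', 0 < l' ∧ cube a l ⊆ cube b l' ∧ ν (cube b l') ≠ 0 := by
  let c : ℕ → EuclideanSpace ℝ (Fin n) := fun k => WithLp.toLp 2 fun i => a i - k
  have hc : ∀ k i, c k i = a i - k := fun k i => rfl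
  by_contra! hcon
  apply hν
  rw [← Measure.measure_univ_eq_zero]
  have hU : (Set.univ : Set (EuclideanSpace ℝ (Fin n))) = ⋃ k : ℕ, cube (c k) (l + 2 * k) := by
    refine (Set.eq_univ_of_forall fun x => ?_).symm
    obtain ⟨k, hk⟩ := exists_nat_ge ‖x - a‖
    refine Set.mem_iUnion.2 ⟨k, fun i => ?_⟩
    have h1 := (PiLp.norm_apply_le (x - a) i).trans hk
    rw [PiLp.sub_apply, Real.norm_eq_abs, abs_le] at h1
    rw [hc]
    constructor <;> linarith [h1.1, h1.2]
  rw [hU]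
  refine measure_iUnion_null fun k => hcon _ _ (by positivity) fun x hx i => ?_
  have h1 : a i ≤ x i ∧ x i < a i + l := hx i
  have hk : (0 : ℝ) ≤ k := k.cast_nonneg
  rw [hc]
  constructor <;> linarith [h1.1, h1.2]

/-- A lower bound for the kernel on a cube of side-length `l`. -/
noncomputable def kernLower (n : ℕ) (ε l : ℝ) : ℝ≥0∞ := ENNReal.ofReal (((n * l) ^ ε)⁻¹)

theorem kernLower_ne_zero (hn : n ≠ 0) (ε : ℝ) {l : ℝ} (hl : 0 < l) : kernLower n ε l ≠ 0 := by
  have : (0 : ℝ) < n := by exact_mod_cast Nat.pos_of_ne_zero hn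
  rw [kernLower, Ne, ENNReal.ofReal_eq_zero, not_le]
  positivity

theorem kernLower_ne_top (ε l : ℝ) : kernLower n ε l ≠ ∞ := ENNReal.ofReal_ne_top

theorem kernLower_le {ε : ℝ} (hε : 0 < ε) {a x y : EuclideanSpace ℝ (Fin n)} {l : ℝ} (hl : 0 < l)
    (hx : x ∈ cube a l) (hy : y ∈ cube a l) (hxy : x ≠ y) : kernLower n ε l ≤ kern ε x y := by
  have hr : 0 < ‖x - y‖ := norm_pos_iff.2 (sub_ne_zero.2 hxy)
  refine ENNReal.ofReal_le_ofReal (inv_anti₀ (by positivity) ?_)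
  exact Real.rpow_le_rpow hr.le (norm_sub_le_of_mem_cube hl.le hx hy) hε.le

theorem kernLower_mul_le {ε : ℝ} (hε : 0 < ε) {μ : Measure (EuclideanSpace ℝ (Fin n))}
    [NullSingletonClass μ] {a x : EuclideanSpace ℝ (Fin n)} {l : ℝ} (hl : 0 < l)
    (hx : x ∈ cube a l) {S : Set (EuclideanSpace ℝ (Fin n))} (hS : MeasurableSet S)
    (hSQ : S ⊆ cube a l) :
    kernLower n ε l * μ S ≤ ∫⁻ y in S, kern ε x y ∂μ := by
  rw [← setLIntegral_const]
  have : ∀ᵐ y ∂μ, y ≠ x := by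
    rw [ae_iff]
    simp
  refine setLIntegral_mono_ae' hS ?_
  filter_upwards [this] with y hy hyS
  exact kernLower_le hε hl hx (hSQ hyS) hy.symm

theorem pot_indicator_one (ε : ℝ) (μ : Measure (EuclideanSpace ℝ (Fin n)))
    {S : Set (EuclideanSpace ℝ (Fin n))} (hS : MeasurableSet S) (x : EuclideanSpace ℝ (Fin n)) :
    pot ε μ (S.indicator 1) x = ∫⁻ y in S, kern ε x y ∂μ := by
  rw [pot, ← lintegral_indicator hS]
  congr 1; ext y
  by_cases hy : y ∈ S <;> simp [hy]

/-! ### Consequences of a weak type inequality -/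

theorem ae_lt_top_of_weak {X : Type*} [MeasurableSpace X] {ν : Measure X} {q : ℝ} (hq : 0 < q)
    {H : X → ℝ≥0∞} {B : ℝ≥0∞} (hB : B ≠ ∞)
    (h : ∀ s : ℝ≥0∞, s ≠ 0 → s ≠ ∞ → s * ν {x | s < H x} ^ (1 / q) ≤ B) :
    ∀ᵐ x ∂ν, H x < ∞ := by
  have hZ : ∀ s : ℝ≥0∞, s ≠ 0 → s ≠ ∞ → s * ν {x | H x = ∞} ^ (1 / q) ≤ B := by
    intro s hs0 hs
    refine le_trans ?_ (h s hs0 hs)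
    have hsub : {x | H x = ∞} ⊆ {x | s < H x} := by
      intro x hx
      have hx' : H x = ∞ := hx
      change s < H x
      rw [hx']
      exact hs.lt_top
    gcongr
  rw [ae_iff]
  simp only [not_lt, top_le_iff]
  set V := ν {x | H x = ∞} ^ (1 / q) with hV
  have hV0 : V = 0 := by
    by_contra hV0
    -- A level too high for the bound: it yields B + V ≤ B when `V` is finite, and it equals 1 when
    -- V = ∞.
    have h1 := hZ (B / V + 1) (by simp) (by simp [ENNReal.div_eq_top, hV0, hB])
    rcases eq_or_ne V ∞ with hVt | hVt
    · rw [hVt] at h1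
      simp at h1
      exact hB h1
    · rw [add_mul, ENNReal.div_mul_cancel hV0 hVt, one_mul] at h1
      exact (ENNReal.lt_add_right hB hV0).not_ge h1
  exact (ENNReal.rpow_eq_zero_iff_of_pos (by positivity)).1 hV0

/-- The constant in the embedding of weak `L^q` into `L^1` on sets of finite measure. -/
noncomputable def weakEmbedConst (q : ℝ) : ℝ≥0∞ := 4 * (1 + (1 - (2⁻¹ : ℝ≥0∞) ^ (q - 1))⁻¹)

theorem weakEmbedConst_ne_top {q : ℝ} (hq : 1 < q) : weakEmbedConst q ≠ ∞ :=
  ENNReal.mul_ne_top (by simp) (ENNReal.add_ne_top.2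
    ⟨by simp, one_sub_two_inv_rpow_inv_ne_top (by linarith)⟩)

/-- Decomposition of H into dyadic levels 2^j s. The weak bound gives ν{H > 2^j s} ≤ 2^(-jq) ν(Q),
so level j contributes a multiple of 2^(-j(q-1)), summable since q > 1. -/
theorem setLIntegral_le_of_weak {X : Type*} [MeasurableSpace X] {ν : Measure X} {q q' : ℝ}
    (hqq : q.HolderConjugate q') {H : X → ℝ≥0∞} (hH : Measurable H) {B : ℝ≥0∞} (hB : B ≠ ∞)
    (h : ∀ s : ℝ≥0∞, s ≠ 0 → s ≠ ∞ → s * ν {x | s < H x} ^ (1 / q) ≤ B) {Q : Set X}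
    (hQ : ν Q ≠ ∞) :
    ∫⁻ x in Q, H x ∂ν ≤ weakEmbedConst q * B * ν Q ^ (1 / q') := by
  have hq0 := hqq.pos
  have hq0' := hqq.symm.pos
  rcases eq_or_ne (ν Q) 0 with hQ0 | hQ0
  · rw [setLIntegral_measure_zero _ _ hQ0]; exact zero_le
  set V := ν Q with hV
  set r : ℝ≥0∞ := V ^ (1 / q) with hr
  have hr0 : r ≠ 0 := (ENNReal.rpow_pos (pos_iff_ne_zero.2 hQ0) hQ).ne'
  have hr1 : r ≠ ∞ := ENNReal.rpow_ne_top_of_nonneg (by positivity) hQ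
  have hVr : V = r * V ^ (1 / q') := by
    rw [hr, ← ENNReal.rpow_add _ _ hQ0 hQ]
    have : 1 / q + 1 / q' = 1 := by simpa only [one_div] using hqq.inv_add_inv_eq_one
    rw [this, ENNReal.rpow_one]
  have hrV : r ^ (q - 1) = V ^ (1 / q') := by
    rw [hr, ← ENNReal.rpow_mul]
    congr 1
    have := hqq.inv_add_inv_eq_one
    have h2 := hqq.ne_zero
    have : 1 / q' = 1 - 1 / q := by simp only [one_div]; linarith
    rw [this]
    field_simp
  -- For B = 0 the base level below would be 0; in that case H vanishes almost everywhere.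
  rcases eq_or_ne B 0 with hB0 | hB0
  · have hnull : ∀ᵐ x ∂ν, H x = 0 := by
      have h1 : ∀ k : ℕ, ν {x | (k + 1 : ℝ≥0∞)⁻¹ < H x} = 0 := by
        intro k
        have hk0 : ((k : ℝ≥0∞) + 1)⁻¹ ≠ 0 := ENNReal.inv_ne_zero.2 (by simp)
        have := h _ hk0 (ENNReal.inv_ne_top.2 (by simp))
        rw [hB0, nonpos_iff_eq_zero, mul_eq_zero] at this
        exact (ENNReal.rpow_eq_zero_iff_of_pos (by positivity)).1 (this.resolve_left hk0)
      have h2 := measure_iUnion_null h1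
      rw [ae_iff]
      refine measure_mono_null (fun x hx => ?_) h2
      have hx' : ¬ H x = 0 := hx
      obtain ⟨k, hk⟩ := ENNReal.exists_inv_nat_lt hx'
      refine Set.mem_iUnion.2 ⟨k, ?_⟩
      change ((k : ℝ≥0∞) + 1)⁻¹ < H x
      refine lt_of_le_of_lt ?_ hk
      exact ENNReal.inv_le_inv.2 le_self_add
    rw [lintegral_congr_ae (ae_restrict_of_ae hnull)]
    simp
  -- The level at which the weak bound for ν{H > s} equals ν(Q); below it the trivial bound by ν(Q)
  -- is better.
  set s : ℝ≥0∞ := B / r with hs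
  have hs0 : s ≠ 0 := ENNReal.div_ne_zero.2 ⟨hB0, hr1⟩
  have hs1 : s ≠ ∞ := ENNReal.div_ne_top hB hr0
  have hsr : s * r = B := ENNReal.div_mul_cancel hr0 hr1
  set θ : ℝ≥0∞ := (2⁻¹ : ℝ≥0∞) ^ (q - 1) with hθ
  have hlev0 : ∀ j : ℕ, (2 : ℝ≥0∞) ^ j * s ≠ 0 := fun j => mul_ne_zero (by simp) hs0
  have hlev1 : ∀ j : ℕ, (2 : ℝ≥0∞) ^ j * s ≠ ∞ := fun j => ENNReal.mul_ne_top (by simp) hs1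
  let L : ℕ → Set X := fun j => {x | (2 : ℝ≥0∞) ^ j * s < H x}
  have hLm : ∀ j, MeasurableSet (L j) := fun j => measurableSet_lt measurable_const hH
  have hterm : ∀ j : ℕ, (2 : ℝ≥0∞) ^ j * s * ν (L j) ≤ B * V ^ (1 / q') * θ ^ j := by
    intro j
    set N := ν (L j) ^ (1 / q) with hN
    have e1 : (2 : ℝ≥0∞) ^ j * s * N ≤ B := h _ (hlev0 j) (hlev1 j)
    have e2 : N ≤ (2⁻¹ : ℝ≥0∞) ^ j * r := by
      have e3 : N ≤ B / ((2 : ℝ≥0∞) ^ j * s) := by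
        rw [ENNReal.le_div_iff_mul_le (Or.inl (hlev0 j)) (Or.inl (hlev1 j)), mul_comm]
        exact e1
      refine e3.trans (le_of_eq ?_)
      rw [← hsr, div_eq_mul_inv, ENNReal.mul_inv (by simp) (by simp), ← ENNReal.inv_pow]
      calc s * r * ((2 ^ j)⁻¹ * s⁻¹) = (2 ^ j)⁻¹ * r * (s * s⁻¹) := by ring
        _ = _ := by rw [ENNReal.mul_inv_cancel hs0 hs1, mul_one]
    have e4 : ν (L j) = N * N ^ (q - 1) := by
      rw [mul_rpow_sub_one hqq.lt.le, hN, ← ENNReal.rpow_mul, one_div_mul_cancel hq0.ne',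
        ENNReal.rpow_one]
    have hq1 : 0 ≤ q - 1 := by linarith [hqq.lt]
    calc (2 : ℝ≥0∞) ^ j * s * ν (L j) = ((2 : ℝ≥0∞) ^ j * s * N) * N ^ (q - 1) := by
          rw [e4]; ring
      _ ≤ B * ((2⁻¹ : ℝ≥0∞) ^ j * r) ^ (q - 1) := by gcongr
      _ = B * V ^ (1 / q') * θ ^ j := by
          rw [ENNReal.mul_rpow_of_nonneg _ _ hq1, hrV, hθ, ← ENNReal.rpow_natCast,
            ← ENNReal.rpow_natCast, ← ENNReal.rpow_mul, ← ENNReal.rpow_mul, mul_comm (j : ℝ)]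
          ring
  have hpt : ∀ᵐ x ∂ν, H x ≤ 4 * s + ∑' j, (L j).indicator (fun _ => 4 * ((2 : ℝ≥0∞) ^ j * s)) x := by
    filter_upwards [ae_lt_top_of_weak hq0 hB h] with x hx
    rcases le_or_gt (H x) (4 * s) with h4 | h4
    · exact h4.trans le_self_add
    · refine le_trans ?_ le_add_self
      have hHs0 : H x / s ≠ 0 := ENNReal.div_ne_zero.2 ⟨(pos_of_gt h4).ne', hs1⟩
      obtain ⟨k, hk1, hk2⟩ := ENNReal.exists_mem_Ico_zpow hHs0 (ENNReal.div_ne_top hx.ne hs0)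
        (y := 2) (by norm_num) (by simp)
      have hk : 1 ≤ k := by
        by_contra hk
        have h5 : (2 : ℝ≥0∞) ^ (k + 1) ≤ 2 ^ (2 : ℤ) :=
          ENNReal.zpow_le_of_le (by norm_num) (by omega)
        have h6 : H x / s < 4 := by
          refine (hk2.trans_le h5).trans_le (le_of_eq ?_)
          norm_cast
        rw [ENNReal.div_lt_iff (Or.inl hs0) (Or.inl hs1)] at h6
        exact h6.not_gt h4
      -- One level below `k`, so that the strict inequality defining `L j` holds.
      obtain ⟨j, rfl⟩ : ∃ j : ℕ, k = j + 1 := ⟨(k - 1).toNat, by omega⟩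
      rw [two_zpow_succ, zpow_natCast, ENNReal.le_div_iff_mul_le (Or.inl hs0) (Or.inl hs1)] at hk1
      rw [two_zpow_succ, two_zpow_succ, zpow_natCast,
        ENNReal.div_lt_iff (Or.inl hs0) (Or.inl hs1)] at hk2
      have hxL : x ∈ L j := by
        change (2 : ℝ≥0∞) ^ j * s < H x
        refine lt_of_lt_of_le ?_ hk1
        rw [mul_assoc, two_mul]
        exact ENNReal.lt_add_right (hlev1 j) (hlev0 j)
      calc H x ≤ 4 * (2 ^ j * s) := hk2.le.trans (le_of_eq (by ring))
        _ = (L j).indicator (fun _ => 4 * ((2 : ℝ≥0∞) ^ j * s)) x := by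
          rw [Set.indicator_of_mem hxL]
        _ ≤ _ := ENNReal.le_tsum (f := fun j => (L j).indicator
          (fun _ => 4 * ((2 : ℝ≥0∞) ^ j * s)) x) j
  calc ∫⁻ x in Q, H x ∂ν
      ≤ ∫⁻ x in Q, (4 * s + ∑' j, (L j).indicator (fun _ => 4 * ((2 : ℝ≥0∞) ^ j * s)) x) ∂ν :=
        lintegral_mono_ae (ae_restrict_of_ae hpt)
    _ = 4 * s * V + ∑' j, ∫⁻ x in Q, (L j).indicator (fun _ => 4 * ((2 : ℝ≥0∞) ^ j * s)) x ∂ν := by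
        rw [lintegral_add_left measurable_const, setLIntegral_const, lintegral_tsum]
        exact fun j => (measurable_const.indicator (hLm j)).aemeasurable
    _ ≤ 4 * s * V + ∑' j : ℕ, 4 * (B * V ^ (1 / q') * θ ^ j) := by
        gcongr with j
        refine (setLIntegral_le_lintegral _ _).trans ?_
        rw [lintegral_indicator_const (hLm j), mul_assoc]
        exact mul_le_mul_right (hterm j) _
    _ = weakEmbedConst q * B * V ^ (1 / q') := by
        have e : s * V = B * V ^ (1 / q') := by
          calc s * V = s * (r * V ^ (1 / q')) := by rw [← hVr]
            _ = _ := by rw [← mul_assoc, hsr]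
        rw [ENNReal.tsum_mul_left, ENNReal.tsum_mul_left, ENNReal.tsum_geometric, mul_assoc 4 s, e,
          weakEmbedConst]
        ring

/-! ### Necessity for potentials -/

/-- The weak type inequality for potentials of finite-valued non-negative functions. -/
def PotWeak (ε p q : ℝ) (μ ν : Measure (EuclideanSpace ℝ (Fin n))) (A : ℝ≥0∞) : Prop :=
  ∀ f : EuclideanSpace ℝ (Fin n) → ℝ≥0, Measurable f → ∫⁻ x, (f x : ℝ≥0∞) ^ p ∂μ ≠ ∞ →
    ∀ s : ℝ≥0∞, s ≠ 0 → s ≠ ∞ → s * ν {x | s < pot ε μ (fun y => f y) x} ^ (1 / q) ≤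
      A * (∫⁻ x, (f x : ℝ≥0∞) ^ p ∂μ) ^ (1 / p)

theorem lintegral_indicator_one_rpow {X : Type*} [MeasurableSpace X] (μ : Measure X) {S : Set X}
    (hS : MeasurableSet S) {p : ℝ} (hp : 0 < p) :
    ∫⁻ x, ((S.indicator (1 : X → ℝ≥0) x : ℝ≥0) : ℝ≥0∞) ^ p ∂μ = μ S := by
  rw [← lintegral_indicator_one hS]
  congr 1; ext x
  by_cases hx : x ∈ S <;> simp [hx, hp]

/-- The function χ_S has potential at least `kernLower` times μ(S) throughout the cube. Half of this
value is a level strictly below the potential, at which the weak inequality is applied. -/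
theorem PotWeak.bound {ε : ℝ} (hε : 0 < ε) (hn : n ≠ 0) {p q : ℝ} (hp : 0 < p) (hq : 0 < q)
    {μ ν : Measure (EuclideanSpace ℝ (Fin n))} [NullSingletonClass μ] {A : ℝ≥0∞}
    (h : PotWeak ε p q μ ν A) {a : EuclideanSpace ℝ (Fin n)} {l : ℝ} (hl : 0 < l)
    {S : Set (EuclideanSpace ℝ (Fin n))} (hS : MeasurableSet S) (hSQ : S ⊆ cube a l)
    (hS0 : μ S ≠ 0) (hS1 : μ S ≠ ∞) :
    kernLower n ε l / 2 * μ S * ν (cube a l) ^ (1 / q) ≤ A * μ S ^ (1 / p) := by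
  have hc0 := kernLower_ne_zero hn ε hl
  have hc1 := kernLower_ne_top (n := n) ε l
  have h1 := h (S.indicator 1) (measurable_one.indicator hS)
    (by rwa [lintegral_indicator_one_rpow μ hS hp]) (kernLower n ε l / 2 * μ S)
    (mul_ne_zero (ENNReal.div_ne_zero.2 ⟨hc0, by simp⟩) hS0)
    (ENNReal.mul_ne_top (ENNReal.div_ne_top hc1 (by simp)) hS1)
  rw [lintegral_indicator_one_rpow μ hS hp] at h1
  refine le_trans ?_ h1
  gcongr
  intro x hx
  have e : (fun y => ((S.indicator (1 : EuclideanSpace ℝ (Fin n) → ℝ≥0) y : ℝ≥0) : ℝ≥0∞)) = S.indicator 1 := by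
    ext y
    by_cases hy : y ∈ S <;> simp [hy]
  change kernLower n ε l / 2 * μ S < pot ε μ (fun y => ((S.indicator 1 y : ℝ≥0) : ℝ≥0∞)) x
  rw [e, pot_indicator_one ε μ hS]
  refine lt_of_lt_of_le ?_ (kernLower_mul_le hε hl hx hS hSQ)
  exact ENNReal.mul_lt_mul_left hS0 hS1 (ENNReal.half_lt_self hc0 hc1)

/-- By σ-finiteness, a cube of infinite measure contains sets S of arbitrarily large finite measure,
while `PotWeak.bound` on a cube of positive ν-measure bounds μ(S)^(1/p'). -/
theorem PotWeak.source_ne_top {ε : ℝ} (hε : 0 < ε) (hn : n ≠ 0) {p p' q : ℝ}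
    (hpp : p.HolderConjugate p') (hq : 0 < q) {μ ν : Measure (EuclideanSpace ℝ (Fin n))}
    [NullSingletonClass μ] [SigmaFinite μ] (hν : ν ≠ 0) {A : ℝ≥0∞} (hA : A ≠ ∞)
    (h : PotWeak ε p q μ ν A) (a : EuclideanSpace ℝ (Fin n)) {l : ℝ} (hl : 0 < l) :
    μ (cube a l) ≠ ∞ := by
  intro htop
  obtain ⟨b, l', hl', hsub, hν0⟩ := exists_cube_superset hν a hl
  have hp0 := hpp.pos
  have hp0' := hpp.symm.pos
  set D : ℝ≥0∞ := kernLower n ε l' / 2 * ν (cube b l') ^ (1 / q) with hD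
  have hD0 : D ≠ 0 := by
    refine mul_ne_zero (ENNReal.div_ne_zero.2 ⟨kernLower_ne_zero hn ε hl', by simp⟩) ?_
    rw [Ne, ENNReal.rpow_eq_zero_iff_of_pos (by positivity)]
    exact hν0
  have hAD : (A / D) ^ p' ≠ ∞ :=
    ENNReal.rpow_ne_top_of_nonneg hp0'.le (ENNReal.div_ne_top hA hD0)
  obtain ⟨S, hS, hSQ, hSlt, hSfin⟩ := Measure.exists_subset_measure_lt_top (μ := μ)
    (r := (A / D) ^ p') (measurableSet_cube a l) (by rw [htop]; exact hAD.lt_top)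
  have hS0 : μ S ≠ 0 := (pos_of_gt hSlt).ne'
  have h1 := h.bound hε hn hp0 hq hl' hS (hSQ.trans hsub) hS0 hSfin.ne
  set m1 := μ S ^ (1 / p) with hm1
  have hm10 : m1 ≠ 0 := (ENNReal.rpow_pos (pos_iff_ne_zero.2 hS0) hSfin.ne).ne'
  have hm11 : m1 ≠ ∞ := ENNReal.rpow_ne_top_of_nonneg (by positivity) hSfin.ne
  have hsplit : μ S = μ S ^ (1 / p') * m1 := by
    rw [hm1, ← ENNReal.rpow_add _ _ hS0 hSfin.ne]
    have : 1 / p' + 1 / p = 1 := by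
      simpa only [one_div] using hpp.symm.inv_add_inv_eq_one
    rw [this, ENNReal.rpow_one]
  have h2 : (D * μ S ^ (1 / p')) * m1 ≤ A * m1 := by
    refine le_trans (le_of_eq ?_) h1
    rw [mul_assoc, ← hsplit, hD]; ring
  have h3 := (ENNReal.mul_le_mul_iff_left hm10 hm11).1 h2
  have h4 : μ S ^ (1 / p') ≤ A / D := by
    rw [ENNReal.le_div_iff_mul_le (Or.inl hD0) (Or.inr hA), mul_comm]
    exact h3
  rw [one_div, ENNReal.rpow_inv_le_iff hp0'] at h4
  exact hSlt.not_ge h4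

theorem PotWeak.target_ne_top {ε : ℝ} (hε : 0 < ε) (hn : n ≠ 0) {p p' q : ℝ}
    (hpp : p.HolderConjugate p') (hq : 0 < q) {μ ν : Measure (EuclideanSpace ℝ (Fin n))}
    [NullSingletonClass μ] [SigmaFinite μ] (hμ : μ ≠ 0) (hν : ν ≠ 0) {A : ℝ≥0∞} (hA : A ≠ ∞)
    (h : PotWeak ε p q μ ν A) (a : EuclideanSpace ℝ (Fin n)) {l : ℝ} (hl : 0 < l) :
    ν (cube a l) ≠ ∞ := by
  obtain ⟨b, l', hl', hsub, hμ0⟩ := exists_cube_superset hμ a hl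
  have hfin := h.source_ne_top hε hn hpp hq hν hA b hl'
  have hp0 := hpp.pos
  have h1 := h.bound hε hn hp0 hq hl' (measurableSet_cube b l') subset_rfl hμ0 hfin
  intro htop
  have htop' : ν (cube b l') = ∞ := top_le_iff.1 (htop ▸ measure_mono hsub)
  have h0 : kernLower n ε l' / 2 * μ (cube b l') ≠ 0 :=
    mul_ne_zero (ENNReal.div_ne_zero.2 ⟨kernLower_ne_zero hn ε hl', by simp⟩) hμ0
  rw [htop', ENNReal.top_rpow_of_pos (by positivity), ENNReal.mul_top h0, top_le_iff] at h1
  exact ENNReal.mul_ne_top hA (ENNReal.rpow_ne_top_of_nonneg (by positivity) hfin) h1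

/-- With H the potential of χ_Q ν and f = χ_Q H^(p'-1), Tonelli gives ∫_Q H^p' dμ = ∫_Q pot(f) dν.
The weak bound for f, integrated over Q, is at most C A (∫_Q H^p' dμ)^(1/p) ν(Q)^(1/q'), and one
divides by the power of the integral. -/
theorem PotWeak.dualTesting {ε : ℝ} (hε : 0 < ε) (hn : n ≠ 0) {p p' q q' : ℝ}
    (hpp : p.HolderConjugate p') (hqq : q.HolderConjugate q')
    {μ ν : Measure (EuclideanSpace ℝ (Fin n))}
    [NullSingletonClass μ] [SigmaFinite μ] [SigmaFinite ν] (hμ : μ ≠ 0) (hν : ν ≠ 0) {A : ℝ≥0∞}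
    (hA : A ≠ ∞) (h : PotWeak ε p q μ ν A) :
    KernelTesting ε q' p' ν μ (weakEmbedConst q * A) := by
  intro a l hl
  have hp0 := hpp.pos
  have hp0' := hpp.symm.pos
  have hq0' := hqq.symm.pos
  have hμQ := h.source_ne_top hε hn hpp hqq.pos hν hA a hl
  have hνQ := h.target_ne_top hε hn hpp hqq.pos hμ hν hA a hl
  set Q := cube a l with hQ
  have hQm : MeasurableSet Q := measurableSet_cube a l
  set H : EuclideanSpace ℝ (Fin n) → ℝ≥0∞ := fun y => ∫⁻ x in Q, kern ε y x ∂ν with hH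
  have hHm : Measurable H := Measurable.lintegral_prod_right (measurable_kern ε)
  -- Truncation makes `I` finite, so that it can be divided out, and `f` finite-valued; it is
  -- removed at the end by monotone convergence.
  let HN : ℕ → EuclideanSpace ℝ (Fin n) → ℝ≥0∞ := fun N y => min (H y) N
  have hHNm : ∀ N, Measurable (HN N) := fun N => hHm.min measurable_const
  have hHN1 : ∀ N y, HN N y ≠ ∞ := fun N y =>
    ne_top_of_le_ne_top (ENNReal.natCast_ne_top N) (min_le_right _ _)
  have key : ∀ N : ℕ, (∫⁻ y in Q, HN N y ^ p' ∂μ) ≤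
      (weakEmbedConst q * A * ν Q ^ (1 / q')) ^ p' := by
    intro N
    set I := ∫⁻ y in Q, HN N y ^ p' ∂μ with hI
    have hIfin : I ≠ ∞ := by
      refine ne_top_of_le_ne_top (ENNReal.mul_ne_top (ENNReal.rpow_ne_top_of_nonneg hp0'.le
        (ENNReal.natCast_ne_top N)) hμQ) ?_
      rw [← setLIntegral_const]
      exact lintegral_mono fun y => ENNReal.rpow_le_rpow (min_le_right _ _) hp0'.le
    rcases eq_or_ne I 0 with hI0 | hI0
    · rw [hI0]; exact zero_le
    let f : EuclideanSpace ℝ (Fin n) → ℝ≥0 :=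
      Q.indicator fun y => (HN N y ^ (p' - 1)).toNNReal
    have hfm : Measurable f := ((hHNm N).pow_const _).ennreal_toNNReal.indicator hQm
    have hp1' : 0 ≤ p' - 1 := by linarith [hpp.symm.lt]
    have hf : ∀ y, (f y : ℝ≥0∞) = Q.indicator (fun y => HN N y ^ (p' - 1)) y := by
      intro y
      by_cases hy : y ∈ Q
      · simp only [f, Set.indicator_of_mem hy]
        exact ENNReal.coe_toNNReal (ENNReal.rpow_ne_top_of_nonneg hp1' (hHN1 N y))
      · simp [f, hy]
    have hfp : ∫⁻ y, (f y : ℝ≥0∞) ^ p ∂μ = I := by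
      rw [hI, ← lintegral_indicator hQm]
      congr 1; ext y
      rw [hf]
      by_cases hy : y ∈ Q
      · simp only [Set.indicator_of_mem hy]
        rw [← ENNReal.rpow_mul, hpp.symm.sub_one_mul_conj]
      · simp [hy, hp0]
    have hweak := h f hfm (by rwa [hfp])
    rw [hfp] at hweak
    have hfm' : Measurable fun y => (f y : ℝ≥0∞) := hfm.coe_nnreal_ennreal
    have hpot := setLIntegral_le_of_weak hqq (measurable_pot ε μ hfm')
      (ENNReal.mul_ne_top hA (ENNReal.rpow_ne_top_of_nonneg (by positivity) hIfin)) hweak hνQ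
    have hdual : I ≤ ∫⁻ x in Q, pot ε μ (fun y => f y) x ∂ν := by
      calc I = ∫⁻ y in Q, HN N y * HN N y ^ (p' - 1) ∂μ := by
            simp_rw [mul_rpow_sub_one hpp.symm.lt.le]; rfl
        _ ≤ ∫⁻ y in Q, H y * HN N y ^ (p' - 1) ∂μ := by
            refine lintegral_mono fun y => ?_
            gcongr
            exact min_le_left _ _
        _ = ∫⁻ y, H y * f y ∂μ := by
            rw [← lintegral_indicator hQm]
            congr 1; ext y
            rw [hf]
            by_cases hy : y ∈ Q <;> simp [hy]
        _ = ∫⁻ y, ∫⁻ x in Q, kern ε x y * f y ∂ν ∂μ := by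
            congr 1; ext y
            rw [hH]
            simp only
            rw [← lintegral_mul_const _ (measurable_kern_right ε y)]
            simp_rw [kern_comm ε y]
        _ = ∫⁻ x in Q, ∫⁻ y, kern ε x y * f y ∂μ ∂ν := by
            refine lintegral_lintegral_swap ?_
            refine Measurable.aemeasurable ?_
            exact ((measurable_kern ε).comp measurable_swap).mul (hfm'.comp measurable_fst)
        _ = _ := rfl
    have h1 := hdual.trans hpot
    set J := I ^ (1 / p) with hJ
    have hJ0 : J ≠ 0 := (ENNReal.rpow_pos (pos_iff_ne_zero.2 hI0) hIfin).ne'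
    have hJ1 : J ≠ ∞ := ENNReal.rpow_ne_top_of_nonneg (by positivity) hIfin
    have hsplit : I = I ^ (1 / p') * J := by
      rw [hJ, ← ENNReal.rpow_add _ _ hI0 hIfin]
      have : 1 / p' + 1 / p = 1 := by
        simpa only [one_div] using hpp.symm.inv_add_inv_eq_one
      rw [this, ENNReal.rpow_one]
    have h2 : I ^ (1 / p') * J ≤ (weakEmbedConst q * A * ν Q ^ (1 / q')) * J := by
      rw [← hsplit]
      refine h1.trans (le_of_eq ?_)
      ring
    have h3 := (ENNReal.mul_le_mul_iff_left hJ0 hJ1).1 h2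
    rwa [one_div p', ENNReal.rpow_inv_le_iff hp0'] at h3
  have hlim : ∫⁻ y in Q, H y ^ p' ∂μ ≤ (weakEmbedConst q * A * ν Q ^ (1 / q')) ^ p' := by
    have hsup : ∀ y, H y ^ p' = ⨆ N, HN N y ^ p' := by
      intro y
      have e1 : H y = ⨆ N, HN N y := by
        simp only [HN]
        rw [← inf_iSup_eq, ENNReal.iSup_natCast, inf_top_eq]
      conv_lhs => rw [e1]
      exact (ENNReal.orderIsoRpow p' hp0').map_iSup _
    simp_rw [hsup]
    rw [lintegral_iSup (fun N => (hHNm N).pow_const _)]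
    · exact iSup_le key
    · intro N M hNM y
      refine ENNReal.rpow_le_rpow (min_le_min le_rfl ?_) hp0'.le
      exact_mod_cast hNM
  rw [one_div p', ENNReal.rpow_inv_le_iff hp0']
  exact hlim

end FracTesting

namespace FracTesting

variable {n : ℕ}

/-! ### Weighted measures -/

instance sigmaFinite_wMeasure (w : EuclideanSpace ℝ (Fin n) → ℝ) : SigmaFinite (wMeasure w) := by
  unfold wMeasure
  infer_instance

theorem nullSingletonClass_wMeasure (hn : n ≠ 0) (w : EuclideanSpace ℝ (Fin n) → ℝ) :
    NullSingletonClass (wMeasure w) := by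
  have : Nonempty (Fin n) := ⟨⟨0, Nat.pos_of_ne_zero hn⟩⟩
  unfold wMeasure
  infer_instance

theorem IsWeight.lintegral_wMeasure {w : EuclideanSpace ℝ (Fin n) → ℝ} (hw : IsWeight w)
    {F : EuclideanSpace ℝ (Fin n) → ℝ≥0∞} (hF : AEMeasurable F (wMeasure w)) :
    ∫⁻ y, F y ∂(wMeasure w) = ∫⁻ y, ENNReal.ofReal (w y) * F y := by
  unfold wMeasure at hF ⊢
  rw [lintegral_withDensity_eq_lintegral_mul₀' hw.aemeasurable.ennreal_ofReal hF]
  rfl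

theorem IsWeight.wMeasure_ne_zero {w : EuclideanSpace ℝ (Fin n) → ℝ} (hw : IsWeight w) :
    wMeasure w ≠ 0 := by
  intro h
  unfold wMeasure at h
  rw [withDensity_eq_zero_iff hw.aemeasurable.ennreal_ofReal] at h
  refine hw.pos.ne' (measure_mono_null (fun x hx => ?_) (ae_iff.1 h))
  have hx' : 0 < w x := hx
  simpa using hx'

theorem enorm_fracIntegrand {α : ℝ} {f w : EuclideanSpace ℝ (Fin n) → ℝ} (hw : ∀ y, 0 ≤ w y)
    (x y : EuclideanSpace ℝ (Fin n)) :
    ‖fracIntegrand α (fun y => f y * w y) x y‖ₑ =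
      ENNReal.ofReal (w y) * (kern (n - α) x y * ‖f y‖ₑ) := by
  rw [fracIntegrand, div_eq_mul_inv, enorm_mul, enorm_mul, kern,
    Real.enorm_of_nonneg (hw y),
    Real.enorm_of_nonneg (by positivity : 0 ≤ (‖x - y‖ ^ ((n : ℝ) - α))⁻¹)]
  ring

theorem IsWeight.lintegral_enorm_fracIntegrand {α : ℝ} {w : EuclideanSpace ℝ (Fin n) → ℝ}
    (hw : IsWeight w) {f : EuclideanSpace ℝ (Fin n) → ℝ} (hf : AEMeasurable f (wMeasure w))
    (x : EuclideanSpace ℝ (Fin n)) :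
    ∫⁻ y, ‖fracIntegrand α (fun y => f y * w y) x y‖ₑ =
      pot (n - α) (wMeasure w) (fun y => ‖f y‖ₑ) x := by
  rw [pot, hw.lintegral_wMeasure (F := fun y => kern (n - α) x y * ‖f y‖ₑ)
    ((measurable_kern_right _ x).aemeasurable.mul hf.enorm)]
  simp_rw [enorm_fracIntegrand hw.nonneg]

/-- Here f is measurable only up to σ dx-null sets and is arbitrary where the weight vanishes; the
product with the weight is zero there. -/
theorem IsWeight.aestronglyMeasurable_fracIntegrand {α : ℝ} {w : EuclideanSpace ℝ (Fin n) → ℝ}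
    (hw : IsWeight w) {f : EuclideanSpace ℝ (Fin n) → ℝ} (hf : AEMeasurable f (wMeasure w))
    (x : EuclideanSpace ℝ (Fin n)) :
    AEStronglyMeasurable (fracIntegrand α (fun y => f y * w y) x) volume := by
  have h1 : (fun y => f y * w y) =ᵐ[volume] fun y => hf.mk f y * w y := by
    have := hf.ae_eq_mk
    unfold wMeasure at this
    filter_upwards [(ae_withDensity_iff' hw.aemeasurable.ennreal_ofReal).1 this] with y hy
    rcases eq_or_ne (w y) 0 with h | h
    · simp [h]
    · have : 0 < w y := lt_of_le_of_ne (hw.nonneg y) h.symm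
      exact congrArg (· * w y) (hy (by simpa using this))
  have h2 : AEMeasurable (fun y => f y * w y) volume :=
    (hf.measurable_mk.aemeasurable.mul hw.aemeasurable).congr h1.symm
  have h3 : AEMeasurable (fracIntegrand α (fun y => f y * w y) x) volume := by
    unfold fracIntegrand
    exact h2.div (by fun_prop)
  exact h3.aestronglyMeasurable

theorem IsWeight.fracIntPos_indicator {α : ℝ} {w : EuclideanSpace ℝ (Fin n) → ℝ}
    (hw : IsWeight w) {Q : Set (EuclideanSpace ℝ (Fin n))} (hQ : MeasurableSet Q)
    (x : EuclideanSpace ℝ (Fin n)) :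
    fracIntPos α (Q.indicator w) x = ∫⁻ y in Q, kern (n - α) x y ∂(wMeasure w) := by
  rw [← lintegral_indicator hQ, hw.lintegral_wMeasure
    ((measurable_kern_right _ x).indicator hQ).aemeasurable, fracIntPos]
  congr 1; ext y
  by_cases hy : y ∈ Q
  · simp only [fracIntegrand, Set.indicator_of_mem hy, kern]
    rw [div_eq_mul_inv, ENNReal.ofReal_mul (hw.nonneg y)]
  · simp [fracIntegrand, hy]

/-! ### Testing constants -/

theorem IsWeight.testingNorm_eq {α q : ℝ} (u : EuclideanSpace ℝ (Fin n) → ℝ)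
    {σ : EuclideanSpace ℝ (Fin n) → ℝ} (hσ : IsWeight σ) (a : EuclideanSpace ℝ (Fin n)) (l : ℝ) :
    testingNorm α q u σ (cube a l) = (∫⁻ x in cube a l, (∫⁻ y in cube a l,
      kern (n - α) x y ∂(wMeasure σ)) ^ q ∂(wMeasure u)) ^ (1 / q) := by
  unfold testingNorm
  simp_rw [hσ.fracIntPos_indicator (measurableSet_cube a l)]

theorem testingNorm_of_testingConst_lt_top {α p q : ℝ} {u σ : EuclideanSpace ℝ (Fin n) → ℝ}
    (h : testingConst α p q u σ < ∞) (a : EuclideanSpace ℝ (Fin n)) {l : ℝ} (hl : 0 < l) :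
    testingNorm α q u σ (cube a l) ≠ ∞ ∧
      testingNorm α q u σ (cube a l) / wMeasure σ (cube a l) ^ (1 / p) ≤
        testingConst α p q u σ := by
  classical
  have h1 : (if testingNorm α q u σ (cube a l) = ∞ then ∞
      else testingNorm α q u σ (cube a l) / wMeasure σ (cube a l) ^ (1 / p)) ≤
        testingConst α p q u σ := by
    unfold testingConst
    refine le_trans (le_of_eq ?_) (le_iSup_of_le a (le_iSup_of_le l (le_iSup_of_le hl le_rfl)))
    congr!
  split_ifs at h1 with h2
  · exact absurd (top_le_iff.1 h1) h.ne
  · exact ⟨h2, h1⟩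

/-- If σ(Q) = ∞, a larger cube of positive u-measure has infinite potential at each of its points,
so its testing term is infinite by convention. -/
theorem IsWeight.measure_cube_ne_top (hn : n ≠ 0) {α p q : ℝ} (hα : α < n) (hq : 0 < q)
    {u σ : EuclideanSpace ℝ (Fin n) → ℝ} (hu : IsWeight u) (hσ : IsWeight σ)
    (h : testingConst α p q u σ < ∞) (a : EuclideanSpace ℝ (Fin n)) {l : ℝ} (hl : 0 < l) :
    wMeasure σ (cube a l) ≠ ∞ := by
  have := nullSingletonClass_wMeasure hn σ
  intro htop
  obtain ⟨b, l', hl', hsub, hb⟩ := exists_cube_superset hu.wMeasure_ne_zero a hl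
  have htop' : wMeasure σ (cube b l') = ∞ := top_le_iff.1 (htop ▸ measure_mono hsub)
  refine (testingNorm_of_testingConst_lt_top h b hl').1 ?_
  rw [hσ.testingNorm_eq]
  have h1 : ∞ ≤ ∫⁻ x in cube b l', (∫⁻ y in cube b l',
      kern (n - α) x y ∂(wMeasure σ)) ^ q ∂(wMeasure u) := by
    calc ∞ = ∫⁻ x in cube b l', ∞ ∂(wMeasure u) := by
          rw [setLIntegral_const, ENNReal.top_mul hb]
      _ ≤ _ := by
          refine setLIntegral_mono' (measurableSet_cube b l') fun x hx => ?_
          have h2 := kernLower_mul_le (sub_pos.2 hα) (μ := wMeasure σ) hl' hx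
            (measurableSet_cube b l') subset_rfl
          rw [htop', ENNReal.mul_top (kernLower_ne_zero hn _ hl'), top_le_iff] at h2
          rw [h2, ENNReal.top_rpow_of_pos hq]
  rw [top_le_iff.1 h1, ENNReal.top_rpow_of_pos (by positivity)]

theorem IsWeight.kernelTesting {α p q : ℝ} (hp : 0 < p) (hq : 0 < q)
    {u σ : EuclideanSpace ℝ (Fin n) → ℝ} (hσ : IsWeight σ)
    (h : testingConst α p q u σ < ∞) (hfin : ∀ a l, 0 < l → wMeasure σ (cube a l) ≠ ∞) :
    KernelTesting (n - α) p q (wMeasure σ) (wMeasure u) (testingConst α p q u σ) := by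
  intro a l hl
  obtain ⟨-, h2⟩ := testingNorm_of_testingConst_lt_top h a hl
  rw [← hσ.testingNorm_eq]
  -- The quotient can be multiplied out only for 0 < σ(Q) < ∞; when σ(Q) = 0 the potential vanishes.
  rcases eq_or_ne (wMeasure σ (cube a l)) 0 with h0 | h0
  · have : testingNorm α q u σ (cube a l) = 0 := by
      rw [hσ.testingNorm_eq]
      have hz : ∀ x, ∫⁻ y in cube a l, kern (n - α) x y ∂(wMeasure σ) = 0 := fun x =>
        setLIntegral_measure_zero _ _ h0
      simp [hz, hq]
    rw [this]; exact zero_le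
  · rwa [ENNReal.div_le_iff_le_mul] at h2
    · left
      rw [Ne, ENNReal.rpow_eq_zero_iff_of_pos (by positivity)]
      exact h0
    · left
      exact ENNReal.rpow_ne_top_of_nonneg (by positivity) (hfin a l hl)

theorem KernelTesting.testingConst_lt_top {α p q : ℝ} (hp : 0 < p)
    {u σ : EuclideanSpace ℝ (Fin n) → ℝ} (hσ : IsWeight σ) {K : ℝ≥0∞} (hK : K ≠ ∞)
    (hfin : ∀ a l, 0 < l → wMeasure σ (cube a l) ≠ ∞)
    (h : KernelTesting (n - α) p q (wMeasure σ) (wMeasure u) K) :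
    testingConst α p q u σ < ∞ := by
  refine lt_of_le_of_lt ?_ hK.lt_top
  unfold testingConst
  refine iSup_le fun a => iSup_le fun l => iSup_le fun hl => ?_
  have h1 := h a l hl
  rw [← hσ.testingNorm_eq] at h1
  have h2 : testingNorm α q u σ (cube a l) ≠ ∞ := ne_top_of_le_ne_top (ENNReal.mul_ne_top hK
    (ENNReal.rpow_ne_top_of_nonneg (by positivity) (hfin a l hl))) h1
  rw [if_neg h2]
  exact ENNReal.div_le_of_le_mul h1

/-! ### From potentials of measures to fractional integrals -/

theorem eLpNorm_ofReal_eq {X : Type*} [MeasurableSpace X] {μ : Measure X} {p : ℝ} (hp : 0 < p)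
    (f : X → ℝ) : eLpNorm f (ENNReal.ofReal p) μ = (∫⁻ x, ‖f x‖ₑ ^ p ∂μ) ^ (1 / p) := by
  rw [eLpNorm_eq_lintegral_rpow_enorm_toReal (by simpa using hp) ENNReal.ofReal_ne_top,
    ENNReal.toReal_ofReal hp.le]

theorem exists_measurable_enorm {X : Type*} [MeasurableSpace X] {μ : Measure X} {p : ℝ}
    (hp : 0 < p) {f : X → ℝ} (hf : MemLp f (ENNReal.ofReal p) μ) :
    ∃ F : X → ℝ≥0∞, Measurable F ∧ (fun x => ‖f x‖ₑ) =ᵐ[μ] F ∧ ∫⁻ x, F x ^ p ∂μ ≠ ∞ ∧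
      eLpNorm f (ENNReal.ofReal p) μ = (∫⁻ x, F x ^ p ∂μ) ^ (1 / p) := by
  have hfm := hf.aestronglyMeasurable.aemeasurable.enorm
  have h1 : ∫⁻ x, ‖f x‖ₑ ^ p ∂μ = ∫⁻ x, hfm.mk _ x ^ p ∂μ := by
    refine lintegral_congr_ae ?_
    filter_upwards [hfm.ae_eq_mk] with x hx
    rw [hx]
  have h2 := eLpNorm_ofReal_eq (μ := μ) hp f
  rw [h1] at h2
  refine ⟨hfm.mk _, hfm.measurable_mk, hfm.ae_eq_mk, fun htop => ?_, h2⟩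
  rw [htop, ENNReal.top_rpow_of_pos (by positivity)] at h2
  exact hf.eLpNorm_ne_top h2

theorem pot_congr {ε : ℝ} {μ : Measure (EuclideanSpace ℝ (Fin n))}
    {f g : EuclideanSpace ℝ (Fin n) → ℝ≥0∞} (h : f =ᵐ[μ] g) : pot ε μ f = pot ε μ g := by
  ext x
  refine lintegral_congr_ae ?_
  filter_upwards [h] with y hy
  rw [hy]

theorem IsWeight.integrable_iff {α : ℝ} {w : EuclideanSpace ℝ (Fin n) → ℝ}
    (hw : IsWeight w) {f : EuclideanSpace ℝ (Fin n) → ℝ} (hf : AEMeasurable f (wMeasure w))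
    (x : EuclideanSpace ℝ (Fin n)) :
    Integrable (fracIntegrand α (fun y => f y * w y) x) volume ↔
      pot (n - α) (wMeasure w) (fun y => ‖f y‖ₑ) x < ∞ := by
  rw [← hw.lintegral_enorm_fracIntegrand hf x]
  exact ⟨fun h => h.2, fun h => ⟨hw.aestronglyMeasurable_fracIntegrand hf x, h⟩⟩

theorem IsWeight.enorm_fracInt_le {α : ℝ} {w : EuclideanSpace ℝ (Fin n) → ℝ}
    (hw : IsWeight w) {f : EuclideanSpace ℝ (Fin n) → ℝ} (hf : AEMeasurable f (wMeasure w))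
    (x : EuclideanSpace ℝ (Fin n)) :
    ‖fracInt α (fun y => f y * w y) x‖ₑ ≤ pot (n - α) (wMeasure w) (fun y => ‖f y‖ₑ) x := by
  rw [← hw.lintegral_enorm_fracIntegrand hf x]
  exact enorm_integral_le_lintegral_enorm _

theorem IsWeight.enorm_fracInt_eq {α : ℝ} {w : EuclideanSpace ℝ (Fin n) → ℝ}
    (hw : IsWeight w) {f : EuclideanSpace ℝ (Fin n) → ℝ} (hf : AEMeasurable f (wMeasure w))
    (hf0 : ∀ y, 0 ≤ f y) {x : EuclideanSpace ℝ (Fin n)}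
    (hx : Integrable (fracIntegrand α (fun y => f y * w y) x) volume) :
    ‖fracInt α (fun y => f y * w y) x‖ₑ = pot (n - α) (wMeasure w) (fun y => ‖f y‖ₑ) x := by
  have h0 : ∀ y, 0 ≤ fracIntegrand α (fun y => f y * w y) x y := fun y =>
    div_nonneg (mul_nonneg (hf0 y) (hw.nonneg y)) (by positivity)
  rw [← hw.lintegral_enorm_fracIntegrand hf x, fracInt,
    Real.enorm_of_nonneg (integral_nonneg h0),
    ofReal_integral_eq_lintegral_ofReal hx (Filter.Eventually.of_forall h0)]
  simp_rw [Real.enorm_of_nonneg (h0 _)]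

/-! ### Sufficiency of testing for weights -/

theorem strongType_of_testing {α p q : ℝ} (hp : 1 < p) (hpq : p ≤ q) (hn : n ≠ 0) (hα0 : 0 ≤ α)
    (hα : α < n) {u σ : EuclideanSpace ℝ (Fin n) → ℝ} (hu : IsWeight u) (hσ : IsWeight σ)
    (hT : testingConst α p q u σ < ∞) (hT' : dualTestingConst α p q u σ < ∞) :
    StrongType α p q u σ (potStrongConst n p q.conjExponent *
      (testingConst α p q u σ + dualTestingConst α p q u σ)) := by
  have hpp := Real.HolderConjugate.conjExponent hp
  have hqq := Real.HolderConjugate.conjExponent (hp.trans_le hpq)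
  have := nullSingletonClass_wMeasure hn u
  have := nullSingletonClass_wMeasure hn σ
  have hσfin := fun a l (hl : 0 < l) => hu.measure_cube_ne_top hn hα hqq.pos hσ hT a hl
  have hufin := fun a l (hl : 0 < l) => hσ.measure_cube_ne_top hn hα hpp.symm.pos hu hT' a hl
  have hK := hσ.kernelTesting hpp.pos hqq.pos hT hσfin
  have hK' := hu.kernelTesting hqq.symm.pos hpp.symm.pos hT' hufin
  intro f hf
  have hfm := hf.aestronglyMeasurable.aemeasurable
  obtain ⟨F, hF, hfF, hFfin, hnorm⟩ := exists_measurable_enorm hpp.pos hf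
  have main := pot_strong hn (sub_pos.2 hα) (by linarith) hpp hqq hpq hσfin hufin hK hK' hF hFfin
  have hpotF := pot_congr (ε := n - α) hfF
  have hq0 := hqq.pos
  have hfin : ∫⁻ x, pot (n - α) (wMeasure σ) F x ^ q ∂(wMeasure u) ≠ ∞ := by
    intro htop
    rw [htop, ENNReal.top_rpow_of_pos (by positivity), top_le_iff] at main
    refine ENNReal.mul_ne_top (ENNReal.mul_ne_top (potStrongConst_ne_top hp hqq.symm.lt)
      (ENNReal.add_ne_top.2 ⟨hT.ne, hT'.ne⟩)) ?_ main
    exact ENNReal.rpow_ne_top_of_nonneg (one_div_nonneg.2 hpp.nonneg) hFfin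
  refine ⟨?_, ?_⟩
  · filter_upwards [ae_lt_top ((measurable_pot _ _ hF).pow_const q) hfin] with x hx
    rw [hσ.integrable_iff hfm, hpotF]
    exact (ENNReal.rpow_lt_top_iff_of_pos hq0).1 hx
  · rw [eLpNorm_ofReal_eq hq0, hnorm]
    refine le_trans ?_ main
    gcongr with x
    rw [← hpotF]
    exact hσ.enorm_fracInt_le hfm x

theorem weakType_of_testing {α p q : ℝ} (hp : 1 < p) (hpq : p ≤ q) (hn : n ≠ 0) (hα0 : 0 ≤ α)
    (hα : α < n) {u σ : EuclideanSpace ℝ (Fin n) → ℝ} (hu : IsWeight u) (hσ : IsWeight σ)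
    (hT' : dualTestingConst α p q u σ < ∞) :
    WeakType α p q u σ (potWeakConst n q * dualTestingConst α p q u σ) := by
  have hpp := Real.HolderConjugate.conjExponent hp
  have hqq := Real.HolderConjugate.conjExponent (hp.trans_le hpq)
  have := nullSingletonClass_wMeasure hn u
  have hufin := fun a l (hl : 0 < l) => hσ.measure_cube_ne_top hn hα hpp.symm.pos hu hT' a hl
  have hK' := hu.kernelTesting hqq.symm.pos hpp.symm.pos hT' hufin
  intro f hf
  have hfm := hf.aestronglyMeasurable.aemeasurable
  obtain ⟨F, hF, hfF, hFfin, hnorm⟩ := exists_measurable_enorm hpp.pos hf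
  have main : ∀ s : ℝ≥0∞, s ≠ 0 → s ≠ ∞ →
      s * wMeasure u {x | s < pot (n - α) (wMeasure σ) F x} ^ (1 / q) ≤ _ := fun s hs0 hs =>
    pot_weak hn (sub_pos.2 hα) (by linarith) hpp hqq hpq hufin hK' hF hs0 hs
  have hpotF := pot_congr (ε := n - α) hfF
  have hq0 := hqq.pos
  refine ⟨?_, fun t ht => ?_⟩
  · have hB : potWeakConst n q * testingConst α q.conjExponent p.conjExponent σ u *
        (∫⁻ x, F x ^ p ∂(wMeasure σ)) ^ (1 / p) ≠ ∞ :=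
      ENNReal.mul_ne_top (ENNReal.mul_ne_top (potWeakConst_ne_top hq0.le) hT'.ne)
        (ENNReal.rpow_ne_top_of_nonneg (one_div_nonneg.2 hpp.nonneg) hFfin)
    filter_upwards [ae_lt_top_of_weak hq0 hB main] with x hx
    rwa [hσ.integrable_iff hfm, hpotF]
  · rw [hnorm]
    refine le_trans ?_ (main (ENNReal.ofReal t) (by simpa using ht) ENNReal.ofReal_ne_top)
    have hsub : {x | t < |fracInt α (fun y => f y * σ y) x|} ⊆
        {x | ENNReal.ofReal t < pot (n - α) (wMeasure σ) F x} := by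
      intro x hx
      have hx' : t < |fracInt α (fun y => f y * σ y) x| := hx
      change ENNReal.ofReal t < pot (n - α) (wMeasure σ) F x
      rw [← hpotF]
      refine lt_of_lt_of_le ?_ (hσ.enorm_fracInt_le hfm x)
      rw [Real.enorm_eq_ofReal_abs]
      exact (ENNReal.ofReal_lt_ofReal_iff (ht.trans hx')).2 hx'
    gcongr

/-! ### Necessity of testing for weights -/

theorem memLp_coe_of_lintegral_ne_top {X : Type*} [MeasurableSpace X] {μ : Measure X} {p : ℝ}
    (hp : 0 < p) {f : X → ℝ≥0} (hf : Measurable f) (hfin : ∫⁻ x, (f x : ℝ≥0∞) ^ p ∂μ ≠ ∞) :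
    MemLp (fun x => (f x : ℝ)) (ENNReal.ofReal p) μ ∧
      eLpNorm (fun x => (f x : ℝ)) (ENNReal.ofReal p) μ =
        (∫⁻ x, (f x : ℝ≥0∞) ^ p ∂μ) ^ (1 / p) := by
  have h : eLpNorm (fun x => (f x : ℝ)) (ENNReal.ofReal p) μ =
      (∫⁻ x, (f x : ℝ≥0∞) ^ p ∂μ) ^ (1 / p) := by
    rw [eLpNorm_ofReal_eq hp]
    simp
  refine ⟨⟨hf.coe_nnreal_real.aestronglyMeasurable, ?_⟩, h⟩
  rw [h]
  exact ENNReal.rpow_lt_top_of_nonneg (by positivity) hfin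

theorem WeakType.potWeak {α p q : ℝ} (hp : 0 < p) (hq : 0 < q)
    {u σ : EuclideanSpace ℝ (Fin n) → ℝ} (hσ : IsWeight σ) {A : ℝ≥0∞}
    (h : WeakType α p q u σ A) : PotWeak (n - α) p q (wMeasure σ) (wMeasure u) A := by
  intro f hf hfin s hs0 hs
  obtain ⟨hmem, hnorm⟩ := memLp_coe_of_lintegral_ne_top hp hf hfin
  obtain ⟨hint, hbound⟩ := h _ hmem
  have h1 := hbound s.toReal (ENNReal.toReal_pos hs0 hs)
  rw [hnorm, ENNReal.ofReal_toReal hs] at h1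
  refine le_trans ?_ h1
  gcongr s * ?_ ^ (1 / q)
  refine measure_mono_ae ?_
  -- Where the integral diverges `fracInt` is 0 by default, so the assumed absolute convergence is
  -- what identifies it with the potential.
  filter_upwards [hint] with x hx hxs
  have hxs' : s < pot (n - α) (wMeasure σ) (fun y => (f y : ℝ≥0∞)) x := hxs
  have h2 := hσ.enorm_fracInt_eq hmem.aestronglyMeasurable.aemeasurable
    (fun y => (f y).coe_nonneg) hx
  have h3 : (fun y => ‖(f y : ℝ)‖ₑ) = fun y => (f y : ℝ≥0∞) := by ext y; simp
  rw [h3] at h2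
  rw [← h2, Real.enorm_eq_ofReal_abs] at hxs'
  exact (ENNReal.lt_ofReal_iff_toReal_lt hs).1 hxs'

theorem StrongType.lintegral_pot_le {α p q : ℝ} (hp : 0 < p) (hq : 0 < q)
    {u σ : EuclideanSpace ℝ (Fin n) → ℝ} (hσ : IsWeight σ) {A : ℝ≥0∞}
    (h : StrongType α p q u σ A) {f : EuclideanSpace ℝ (Fin n) → ℝ≥0} (hf : Measurable f)
    (hfin : ∫⁻ x, (f x : ℝ≥0∞) ^ p ∂(wMeasure σ) ≠ ∞) :
    (∫⁻ x, pot (n - α) (wMeasure σ) (fun y => f y) x ^ q ∂(wMeasure u)) ^ (1 / q) ≤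
      A * (∫⁻ x, (f x : ℝ≥0∞) ^ p ∂(wMeasure σ)) ^ (1 / p) := by
  obtain ⟨hmem, hnorm⟩ := memLp_coe_of_lintegral_ne_top hp hf hfin
  obtain ⟨hint, hbound⟩ := h _ hmem
  rw [hnorm, eLpNorm_ofReal_eq hq] at hbound
  refine le_trans (le_of_eq ?_) hbound
  congr 1
  refine lintegral_congr_ae ?_
  filter_upwards [hint] with x hx
  rw [hσ.enorm_fracInt_eq hmem.aestronglyMeasurable.aemeasurable
    (fun y => (f y).coe_nonneg) hx]
  simp

theorem StrongType.potWeak {α p q : ℝ} (hp : 0 < p) (hq : 0 < q)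
    {u σ : EuclideanSpace ℝ (Fin n) → ℝ} (hσ : IsWeight σ) {A : ℝ≥0∞}
    (h : StrongType α p q u σ A) : PotWeak (n - α) p q (wMeasure σ) (wMeasure u) A := by
  intro f hf hfin s hs0 hs
  refine le_trans ?_ (h.lintegral_pot_le hp hq hσ hf hfin)
  have hm := measurable_pot (n - α) (wMeasure σ) hf.coe_nnreal_ennreal
  have hsq : s = (s ^ q) ^ (1 / q) := by
    rw [← ENNReal.rpow_mul, mul_one_div_cancel hq.ne', ENNReal.rpow_one]
  have hq1 : 0 ≤ 1 / q := by positivity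
  calc s * wMeasure u {x | s < pot (n - α) (wMeasure σ) (fun y => f y) x} ^ (1 / q)
      = (s ^ q * wMeasure u {x | s < pot (n - α) (wMeasure σ) (fun y => f y) x}) ^ (1 / q) := by
        rw [ENNReal.mul_rpow_of_nonneg _ _ hq1, ← hsq]
    _ ≤ (s ^ q * wMeasure u {x | s ^ q ≤
          pot (n - α) (wMeasure σ) (fun y => f y) x ^ q}) ^ (1 / q) := by
        have hsub : {x | s < pot (n - α) (wMeasure σ) (fun y => (f y : ℝ≥0∞)) x} ⊆
            {x | s ^ q ≤ pot (n - α) (wMeasure σ) (fun y => (f y : ℝ≥0∞)) x ^ q} := by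
          intro x hx
          have hx' : s < pot (n - α) (wMeasure σ) (fun y => (f y : ℝ≥0∞)) x := hx
          exact ENNReal.rpow_le_rpow hx'.le hq.le
        gcongr
    _ ≤ _ := by
        gcongr
        exact mul_meas_ge_le_lintegral (hm.pow_const q) _

theorem StrongType.kernelTesting {α p q : ℝ} (hp : 0 < p) (hq : 0 < q)
    {u σ : EuclideanSpace ℝ (Fin n) → ℝ} (hσ : IsWeight σ) {A : ℝ≥0∞}
    (h : StrongType α p q u σ A) (hfin : ∀ a l, 0 < l → wMeasure σ (cube a l) ≠ ∞) :
    KernelTesting (n - α) p q (wMeasure σ) (wMeasure u) A := by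
  intro a l hl
  have hQ := measurableSet_cube a l
  have h1 := h.lintegral_pot_le hp hq hσ (f := (cube a l).indicator 1)
    (measurable_one.indicator hQ)
    (by rw [lintegral_indicator_one_rpow _ hQ hp]; exact hfin a l hl)
  rw [lintegral_indicator_one_rpow _ hQ hp] at h1
  refine le_trans ?_ h1
  have e : (fun y => (((cube a l).indicator (1 : EuclideanSpace ℝ (Fin n) → ℝ≥0) y : ℝ≥0) : ℝ≥0∞))
      = (cube a l).indicator 1 := by
    ext y
    by_cases hy : y ∈ cube a l <;> simp [hy]
  rw [e]
  simp_rw [pot_indicator_one _ _ hQ]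
  gcongr
  exact Measure.restrict_le_self

theorem PotWeak.dualTestingConst_lt_top {α p q : ℝ} (hp : 1 < p) (hpq : p ≤ q) (hn : n ≠ 0)
    (hα : α < n) {u σ : EuclideanSpace ℝ (Fin n) → ℝ} (hu : IsWeight u) (hσ : IsWeight σ)
    {A : ℝ≥0∞} (hA : A ≠ ∞) (h : PotWeak (n - α) p q (wMeasure σ) (wMeasure u) A) :
    dualTestingConst α p q u σ < ∞ := by
  have hpp := Real.HolderConjugate.conjExponent hp
  have hqq := Real.HolderConjugate.conjExponent (hp.trans_le hpq)
  have := nullSingletonClass_wMeasure hn σ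
  refine KernelTesting.testingConst_lt_top hqq.symm.pos hu
    (ENNReal.mul_ne_top (weakEmbedConst_ne_top hqq.lt) hA) (fun a l hl => ?_)
    (h.dualTesting (sub_pos.2 hα) hn hpp hqq hσ.wMeasure_ne_zero hu.wMeasure_ne_zero hA)
  exact h.target_ne_top (sub_pos.2 hα) hn hpp hqq.pos hσ.wMeasure_ne_zero hu.wMeasure_ne_zero hA a hl

theorem StrongType.mono {α p q : ℝ} {u σ : EuclideanSpace ℝ (Fin n) → ℝ} {A B : ℝ≥0∞}
    (h : StrongType α p q u σ A) (hAB : A ≤ B) : StrongType α p q u σ B := fun f hf =>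
  ⟨(h f hf).1, (h f hf).2.trans (by gcongr)⟩

theorem WeakType.mono {α p q : ℝ} {u σ : EuclideanSpace ℝ (Fin n) → ℝ} {A B : ℝ≥0∞}
    (h : WeakType α p q u σ A) (hAB : A ≤ B) : WeakType α p q u σ B := fun f hf =>
  ⟨(h f hf).1, fun t ht => ((h f hf).2 t ht).trans (by gcongr)⟩

end FracTesting

/-! ### The characterization for weights -/

theorem mainTheorem1 (n : ℕ) (p q : ℝ) (hp : 1 < p) (hpq : p ≤ q) :
    ∃ C : ℝ≥0, ∀ α : ℝ, 0 ≤ α → α < n →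
      ∀ u σ : EuclideanSpace ℝ (Fin n) → ℝ, FracTesting.IsWeight u → FracTesting.IsWeight σ →
        -- strong type: boundedness is equivalent to both testing conditions
        ((FracTesting.testingConst α p q u σ < ∞ ∧ FracTesting.dualTestingConst α p q u σ < ∞) ↔
          ∃ A : ℝ≥0, FracTesting.StrongType α p q u σ A) ∧
        -- strong type: quantitative bound
        ((FracTesting.testingConst α p q u σ < ∞ ∧ FracTesting.dualTestingConst α p q u σ < ∞) →
          FracTesting.StrongType α p q u σ
            (C * (FracTesting.testingConst α p q u σ + FracTesting.dualTestingConst α p q u σ))) ∧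
        -- weak type: boundedness is equivalent to the dual testing condition
        (FracTesting.dualTestingConst α p q u σ < ∞ ↔
          ∃ A : ℝ≥0, FracTesting.WeakType α p q u σ A) ∧
        -- weak type: quantitative bound
        (FracTesting.dualTestingConst α p q u σ < ∞ →
          FracTesting.WeakType α p q u σ (C * FracTesting.dualTestingConst α p q u σ)) := by
  have hpp := Real.HolderConjugate.conjExponent hp
  have hqq := Real.HolderConjugate.conjExponent (hp.trans_le hpq)
  have hC1 : FracTesting.potStrongConst n p q.conjExponent ≠ ∞ :=
    FracTesting.potStrongConst_ne_top hp hqq.symm.lt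
  have hC2 : FracTesting.potWeakConst n q ≠ ∞ := FracTesting.potWeakConst_ne_top hqq.nonneg
  -- Neither constant involves α, u or σ; their sum serves both inequalities.
  refine ⟨(FracTesting.potStrongConst n p q.conjExponent + FracTesting.potWeakConst n q).toNNReal,
    fun α hα0 hα u σ hu hσ => ?_⟩
  rw [ENNReal.coe_toNNReal (ENNReal.add_ne_top.2 ⟨hC1, hC2⟩)]
  have hn : n ≠ 0 := by
    rintro rfl
    rw [Nat.cast_zero] at hα
    exact absurd hα hα0.not_gt
  have := FracTesting.nullSingletonClass_wMeasure hn σ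
  have strong := fun h : _ ∧ _ =>
    (FracTesting.strongType_of_testing hp hpq hn hα0 hα hu hσ h.1 h.2).mono
      (B := (FracTesting.potStrongConst n p q.conjExponent + FracTesting.potWeakConst n q) *
        (FracTesting.testingConst α p q u σ + FracTesting.dualTestingConst α p q u σ))
      (mul_le_mul_left le_self_add _)
  have weak := fun h : _ < ∞ =>
    (FracTesting.weakType_of_testing hp hpq hn hα0 hα hu hσ h).mono
      (B := (FracTesting.potStrongConst n p q.conjExponent + FracTesting.potWeakConst n q) *
        FracTesting.dualTestingConst α p q u σ)
      (mul_le_mul_left le_add_self _)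
  refine ⟨⟨fun h => ⟨_, (strong h).mono (ENNReal.coe_toNNReal ?_).ge⟩, ?_⟩, strong,
    ⟨fun h => ⟨_, (weak h).mono (ENNReal.coe_toNNReal ?_).ge⟩, ?_⟩, weak⟩
  · exact ENNReal.mul_ne_top (ENNReal.add_ne_top.2 ⟨hC1, hC2⟩)
      (ENNReal.add_ne_top.2 ⟨h.1.ne, h.2.ne⟩)
  · rintro ⟨A, hA⟩
    have hw := hA.potWeak hpp.pos hqq.pos hσ
    have hfin := fun a l (hl : 0 < l) => hw.source_ne_top (sub_pos.2 hα) hn hpp hqq.pos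
      hu.wMeasure_ne_zero ENNReal.coe_ne_top a hl
    exact ⟨(hA.kernelTesting hpp.pos hqq.pos hσ hfin).testingConst_lt_top hpp.pos hσ
      ENNReal.coe_ne_top hfin, hw.dualTestingConst_lt_top hp hpq hn hα hu hσ ENNReal.coe_ne_top⟩
  · exact ENNReal.mul_ne_top (ENNReal.add_ne_top.2 ⟨hC1, hC2⟩) h.ne
  · rintro ⟨A, hA⟩
    exact (hA.potWeak hpp.pos hqq.pos hσ).dualTestingConst_lt_top hp hpq hn hα hu hσ
      ENNReal.coe_ne_top
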